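/- Let $G$ be a bipartite distance hereditary (BDH) graph on $n\ge 1$ vertices, that is, a connected bipartite graph in which the distance between any two vertices is the same in every connected induced subgraph containing them. Let $X,Y$ be its shores. A maximal biclique of $G$ is an inclusion-maximal pair $B=(X(B),Y(B))$ of nonempty sets $X(B)\subseteq X$, $Y(B)\subseteq Y$ such that every vertex of $X(B)$ is adjacent to every vertex of $Y(B)$. Maximal bicliques are ordered by $B\preceq B'\iff X(B)\subseteq X(B')$. The Galois lattice of $G$ consists of this poset, whose Hasse diagram is denoted $\mathbf H^\circ(G)$, together with a bottom and a top element. The introducer of a vertex $v$ is the least (if $v\in X$) or greatest (if $v\in Y$) maximal biclique containing $v$. It exists whenever $n\ge2$. The reverse of a pruning sequence of $G$ is an enumeration $v_1,\dots,v_n$ of the vertices together with triples $(v_i,C_i,v_{k_i})$, $2\le i\le n$, $k_i<i$, $C_i\in\{P,F\}$, such that, in the subgraph $G_i$ induced by $v_1,\dots,v_i$, the vertex $v_i$ has $v_{k_i}$ as its only neighbor if $C_i=P$, and is a false twin of $v_{k_i}$ (non-adjacent, with the same neighborhood) if $C_i=F$. Name the shores so that $v_1\in X$. An implicit representation of the Galois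 lattice of $G$ consists of - two arborescences $T_X,T_Y$, stored by parent pointers, with bijections $\psi:X\to E(T_X)$ and $\psi:Y\to E(T_Y)$, and the shore of each vertex; - for each maximal biclique $B$, listed exactly once, the first and last arcs of a directed path of $T_X$ with arc set $\psi(X(B))$ and of a directed path of $T_Y$ with arc set $\psi(Y(B))$; - for each maximal biclique, linked lists of the maximal bicliques that cover it and of those covered by it in $\mathbf H^\circ(G)$; - for each vertex, a reference to its introducer, or a null reference if it has none. **Theorem.** On a unit-cost random access machine with words of $O(\log n)$ bits there are three programs, and a constant independent of $G$, $n$ and the sequence governing all the bounds below, such that the following hold. 1. Given $n$ and the reverse of a pruning sequence of a BDH graph $G$ on $n$ vertices, the first program computes an implicit representation of the Galois lattice of $G$ in $O(n)$ worst case time and $O(n)$ space. The representation itself occupies $O(n)$ words. 2. Given any such stored representation and a reference to a maximal biclique $B$ with $p=|X(B)|+|Y(B)|$ vertices, the second program lists $X(B)$ and $Y(B)$, each vertex once, in $O(p)$ worst case time. 3. Given any such stored representation and a vertex $v$ contained in $k$ maximal bicliques, the third program lists these maximal bicliques, each once, in $O(k)$ worst case time (in $O(1)$ time if $k=0$, which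 happens only for $n=1$). The second and third programs use $O(n)$ space and leave the stored representation intact. -/

import Mathlib

namespace BDH

/-! ## A random access machine with a step count

Finitely many registers and arrays (a program mentions only finitely many of them), all holding
natural numbers.  The semantics is relative to a bound `M`: every value written is at most `M` and
every array address used is at most `M`.  Thus a run with bound `M = O(n)` uses `O(n)` words of
memory, each of `O(log n)` bits. -/

/-- Registers and arrays. -/
@[ext] structure State where
  reg : ℕ → ℕ
  arr : ℕ → ℕ → ℕ

/-- Overwrite one register. -/
def State.setReg (σ : State) (d x : ℕ) : State :=
  { σ with reg := Function.update σ.reg d x }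

/-- Overwrite one array cell. -/
def State.setArr (σ : State) (a i x : ℕ) : State :=
  { σ with arr := Function.update σ.arr a (Function.update (σ.arr a) i x) }

/-- The list of the first `len` entries of the array `a`. -/
def State.read (σ : State) (a len : ℕ) : List ℕ :=
  (List.range len).map (σ.arr a)

/-- Tests on registers. -/
inductive Test where
  | eq (a b : ℕ)
  | lt (a b : ℕ)

/-- Truth of a test in a state. -/
def Test.Holds : Test → State → Prop
  | .eq a b, σ => σ.reg a = σ.reg b
  | .lt a b, σ => σ.reg a < σ.reg b

/-- Programs.  Arguments `d`, `r`, `r'`, `i` are names of registers, `a` is the name of an array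
and `c` is a numerical constant. -/
inductive Prog where
  | skip
  | const (d c : ℕ)
  | move (d r : ℕ)
  | add (d r r' : ℕ)
  | sub (d r r' : ℕ)
  | load (d a i : ℕ)
  | store (a i r : ℕ)
  | seq (p q : Prog)
  | ite (b : Test) (p q : Prog)
  | while (b : Test) (p : Prog)

/-- `Exec M p σ σ' t`: started in `σ`, the program `p` halts in `σ'` after exactly `t` steps, and
never writes a value, or uses an array address, larger than `M`.  Every instruction and every
evaluation of a test is one step. -/
inductive Exec (M : ℕ) : Prog → State → State → ℕ → Prop
  | skip (σ) : Exec M .skip σ σ 1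
  | const (σ d c) (h : c ≤ M) : Exec M (.const d c) σ (σ.setReg d c) 1
  | move (σ d r) (h : σ.reg r ≤ M) : Exec M (.move d r) σ (σ.setReg d (σ.reg r)) 1
  | add (σ d r r') (h : σ.reg r + σ.reg r' ≤ M) :
      Exec M (.add d r r') σ (σ.setReg d (σ.reg r + σ.reg r')) 1
  | sub (σ d r r') (h : σ.reg r - σ.reg r' ≤ M) :
      Exec M (.sub d r r') σ (σ.setReg d (σ.reg r - σ.reg r')) 1
  | load (σ d a i) (hi : σ.reg i ≤ M) (h : σ.arr a (σ.reg i) ≤ M) :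
      Exec M (.load d a i) σ (σ.setReg d (σ.arr a (σ.reg i))) 1
  | store (σ a i r) (hi : σ.reg i ≤ M) (h : σ.reg r ≤ M) :
      Exec M (.store a i r) σ (σ.setArr a (σ.reg i) (σ.reg r)) 1
  | seq {p q σ₁ σ₂ σ₃ t₁ t₂} (h₁ : Exec M p σ₁ σ₂ t₁) (h₂ : Exec M q σ₂ σ₃ t₂) :
      Exec M (.seq p q) σ₁ σ₃ (t₁ + t₂)
  | ite_true {b p q σ σ' t} (hb : b.Holds σ) (h : Exec M p σ σ' t) :
      Exec M (.ite b p q) σ σ' (1 + t)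
  | ite_false {b p q σ σ' t} (hb : ¬ b.Holds σ) (h : Exec M q σ σ' t) :
      Exec M (.ite b p q) σ σ' (1 + t)
  | while_true {b p σ₁ σ₂ σ₃ t₁ t₂} (hb : b.Holds σ₁) (h₁ : Exec M p σ₁ σ₂ t₁)
      (h₂ : Exec M (.while b p) σ₂ σ₃ t₂) : Exec M (.while b p) σ₁ σ₃ (1 + t₁ + t₂)
  | while_false {b p σ} (hb : ¬ b.Holds σ) : Exec M (.while b p) σ σ 1

/-! ## Bipartite distance hereditary graphs and pruning sequences -/

/-- The distance between two vertices is the same in every connected induced subgraph containing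
them. -/
def IsDistanceHereditary {V : Type*} (G : SimpleGraph V) : Prop :=
  ∀ s : Set V, (G.induce s).Connected → ∀ u v : s, (G.induce s).dist u v = G.dist u v

/-- Bipartite distance hereditary graphs (connected, as those built from a single vertex by adding
pending vertices and false twins). -/
def IsBDH {V : Type*} (G : SimpleGraph V) : Prop :=
  G.Connected ∧ G.IsBipartite ∧ IsDistanceHereditary G

/-- How a vertex is added. -/
inductive Kind where
  | pending
  | twin

/-- A sequence of triples `(v_i, C_i, v_{k_i})`, with indices starting from `0`.  Only `vert` is
meaningful at index `0`. -/
structure VertexSequence (n : ℕ) where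
  vert : Fin n → Fin n
  kind : Fin n → Kind
  ref : Fin n → Fin n

/-- The neighborhood of `u` in the subgraph `G_i` induced by `v_0, …, v_i`. -/
def VertexSequence.nbhd {n : ℕ} (s : VertexSequence n) (G : SimpleGraph (Fin n)) (i u : Fin n) :
    Set (Fin n) :=
  {w | G.Adj u w ∧ ∃ j, j ≤ i ∧ s.vert j = w}

/-- `s` is the reverse of a pruning sequence of `G`: it lists each vertex of `G` once and, for each
`i > 0`, the vertex `v_i` is in `G_i` a pending vertex adjacent to, or a false twin of, an earlier
vertex `v_{k_i}`. -/
def IsReversePruning {n : ℕ} (G : SimpleGraph (Fin n)) (s : VertexSequence n) : Prop :=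
  Function.Bijective s.vert ∧
  ∀ i : Fin n, 0 < i.val →
    (∃ k, k < i ∧ s.vert k = s.ref i) ∧
    match s.kind i with
    | .pending => s.nbhd G i (s.vert i) = {s.ref i}
    | .twin => s.nbhd G i (s.vert i) = s.nbhd G i (s.ref i) ∧
        s.vert i ∉ s.nbhd G i (s.ref i)

/-! ## Maximal bicliques and the order of the Galois lattice -/

/-- `(A, B)` is a biclique of the bipartite graph `G` with shores `X` and `Xᶜ`. -/
structure IsBiclique {V : Type*} (G : SimpleGraph V) (X A B : Set V) : Prop where
  nonemptyX : A.Nonempty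
  nonemptyY : B.Nonempty
  subsetX : A ⊆ X
  subsetY : B ⊆ Xᶜ
  adj : ∀ a ∈ A, ∀ b ∈ B, G.Adj a b

/-- The maximal bicliques of the bipartite graph `G` with shores `X` and `Xᶜ`. -/
@[ext] structure MaxBiclique {V : Type*} (G : SimpleGraph V) (X : Set V) where
  shoreX : Set V
  shoreY : Set V
  isBiclique : IsBiclique G X shoreX shoreY
  maximal : ∀ A B : Set V, IsBiclique G X A B → shoreX ⊆ A → shoreY ⊆ B →
    A = shoreX ∧ B = shoreY

/-- The vertex set of a maximal biclique. -/
def MaxBiclique.verts {V : Type*} {G : SimpleGraph V} {X : Set V} (B : MaxBiclique G X) : Set V :=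
  B.shoreX ∪ B.shoreY

theorem MaxBiclique.ext_shoreX {V : Type*} {G : SimpleGraph V} {X : Set V}
    {B C : MaxBiclique G X} (h : B.shoreX = C.shoreX) : B = C := by
  have key : IsBiclique G X B.shoreX (B.shoreY ∪ C.shoreY) := by
    refine ⟨B.isBiclique.nonemptyX, B.isBiclique.nonemptyY.mono Set.subset_union_left,
      B.isBiclique.subsetX, Set.union_subset B.isBiclique.subsetY C.isBiclique.subsetY, ?_⟩
    rintro a ha b (hb | hb)
    · exact B.isBiclique.adj a ha b hb
    · exact C.isBiclique.adj a (h ▸ ha) b hb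
  have h₁ := (B.maximal _ _ key subset_rfl Set.subset_union_left).2
  have h₂ := (C.maximal _ _ key h.ge Set.subset_union_right).2
  exact MaxBiclique.ext h (h₁.symm.trans h₂)

/-- The order of the Galois lattice on maximal bicliques: inclusion of the `X`-shores. -/
instance {V : Type*} {G : SimpleGraph V} {X : Set V} : PartialOrder (MaxBiclique G X) where
  le B C := B.shoreX ⊆ C.shoreX
  le_refl B := subset_rfl
  le_trans B C D h h' := h.trans h'
  le_antisymm B C h h' := MaxBiclique.ext_shoreX (h.antisymm h')

/-- `B` is the introducer of `v`: the least (if `v ∈ X`) or the greatest (if `v ∉ X`) maximal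
biclique containing `v`. -/
def IsIntroducer {V : Type*} {G : SimpleGraph V} {X : Set V} (v : V) (B : MaxBiclique G X) :
    Prop :=
  v ∈ B.verts ∧ ∀ C : MaxBiclique G X, v ∈ C.verts → (v ∈ X → B ≤ C) ∧ (v ∉ X → C ≤ B)

/-! ## Arborescences and dipaths -/

/-- `T` is an arborescence with set of nodes `N` and root `r`. -/
structure IsArborescence {W : Type*} (T : Digraph W) (N : Set W) (r : W) : Prop where
  root_mem : r ∈ N
  mem_of_adj : ∀ a b, T.Adj a b → a ∈ N ∧ b ∈ N
  not_adj_root : ∀ a, ¬ T.Adj a r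
  adj_unique : ∀ a a' b, T.Adj a b → T.Adj a' b → a = a'
  reachable : ∀ b ∈ N, Relation.ReflTransGen T.Adj r b

/-- A nonempty list of consecutive arcs of `T`. -/
def IsDipath {W : Type*} (T : Digraph W) (l : List (W × W)) : Prop :=
  l ≠ [] ∧ (∀ e ∈ l, T.Adj e.1 e.2) ∧ l.IsChain (fun e f => e.2 = f.1)

/-- The arc `ψ(v)` associated with the vertex `v`.  Nodes are the root `none` and, for each `v`,
the head `some v` of `ψ(v)`. -/
def arc {V : Type*} (parent : V → Option V) (v : V) : Option V × Option V :=
  (parent v, some v)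

/-- The digraph with arcs `ψ(v)`, `v ∈ S`. -/
def arcTree {V : Type*} (S : Set V) (parent : V → Option V) : Digraph (Option V) where
  Adj a b := ∃ v ∈ S, (a, b) = arc parent v

/-- `ψ` is a bijection between `S` and the set of arcs. -/
theorem arc_bijOn {V : Type*} (S : Set V) (parent : V → Option V) :
    Set.BijOn (arc parent) S {e | (arcTree S parent).Adj e.1 e.2} := by
  refine ⟨fun v hv => ⟨v, hv, rfl⟩, fun u _ v _ h => ?_, ?_⟩
  · simpa [arc] using congrArg Prod.snd h
  · rintro ⟨a, b⟩ ⟨v, hv, h⟩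
    exact ⟨v, hv, h.symm⟩

/-- `ψ(F)` is the dipath of `T` from the arc `ψ(α)` to the arc `ψ(β)`, where `T` has the arcs
`ψ(v)`, `v ∈ S`. -/
def IsIntervalOf {V : Type*} (S : Set V) (parent : V → Option V) (α β : V) (F : Set V) : Prop :=
  ∃ l, IsDipath (arcTree S parent) l ∧ l.head? = some (arc parent α) ∧
    l.getLast? = some (arc parent β) ∧ {e | e ∈ l} = arc parent '' F

/-! ## The implicit representation -/

/-- An implicit representation of the Galois lattice of `G`: an arborescence for each shore, the
maximal bicliques, each encoded by the end-arcs of one dipath in each arborescence, the cover pairs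
of the Hasse diagram, and the introducer of each vertex. -/
structure ImplicitRep {n : ℕ} (G : SimpleGraph (Fin n)) (X : Set (Fin n)) where
  parent : Fin n → Option (Fin n)
  treeX : IsArborescence (arcTree X parent) (insert none (some '' X)) none
  treeY : IsArborescence (arcTree Xᶜ parent) (insert none (some '' Xᶜ)) none
  size : ℕ
  biclique : Fin size ≃ MaxBiclique G X
  firstX : Fin size → Fin n
  lastX : Fin size → Fin n
  firstY : Fin size → Fin n
  lastY : Fin size → Fin n
  intervalX : ∀ b, IsIntervalOf X parent (firstX b) (lastX b) (biclique b).shoreX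
  intervalY : ∀ b, IsIntervalOf Xᶜ parent (firstY b) (lastY b) (biclique b).shoreY
  upper : Fin size → List (Fin size)
  upper_nodup : ∀ b, (upper b).Nodup
  mem_upper : ∀ b c, c ∈ upper b ↔ biclique b ⋖ biclique c
  lower : Fin size → List (Fin size)
  lower_nodup : ∀ b, (lower b).Nodup
  mem_lower : ∀ b c, c ∈ lower b ↔ biclique c ⋖ biclique b
  introducer : Fin n → Option (Fin size)
  introducer_eq : ∀ v b, introducer v = some b ↔ IsIntroducer v (biclique b)

/-! ## Memory layout -/

/-- Names of the arrays that hold the input. -/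
abbrev inVert : ℕ := 0
abbrev inKind : ℕ := 1
abbrev inRef : ℕ := 2

/-- Names of the arrays that hold the representation. -/
abbrev aSide : ℕ := 3
abbrev aParent : ℕ := 4
abbrev aSize : ℕ := 5
abbrev aFirstX : ℕ := 6
abbrev aLastX : ℕ := 7
abbrev aFirstY : ℕ := 8
abbrev aLastY : ℕ := 9
abbrev aUpperHead : ℕ := 10
abbrev aUpperNext : ℕ := 11
abbrev aUpperItem : ℕ := 12
abbrev aLowerHead : ℕ := 13
abbrev aLowerNext : ℕ := 14
abbrev aLowerItem : ℕ := 15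
abbrev aIntroducer : ℕ := 16

/-- Names of the arrays that hold the answer to a query. -/
abbrev outA : ℕ := 17
abbrev outB : ℕ := 18

/-- Code of the kind of a vertex addition. -/
def Kind.code : Kind → ℕ
  | .pending => 0
  | .twin => 1

/-- Code of an optional reference: `0` is the null reference. -/
def optCode {m : ℕ} : Option (Fin m) → ℕ
  | none => 0
  | some u => u.val + 1

/-- The reference `p` points to a linked list with items `l`, whose cells have addresses in
`{1, …, bound}`; `0` is the null reference. -/
def HoldsList (next item : ℕ → ℕ) (bound : ℕ) : ℕ → List ℕ → Prop
  | p, [] => p = 0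
  | p, x :: l => 0 < p ∧ p ≤ bound ∧ item p = x ∧ HoldsList next item bound (next p) l

/-- The memory holds the input: `n` in register `0` and the sequence in the input arrays.  All other
registers and cells are arbitrary. -/
structure HoldsInput {n : ℕ} (s : VertexSequence n) (σ : State) : Prop where
  size : σ.reg 0 = n
  vert : ∀ i : Fin n, σ.arr inVert i = s.vert i
  kind : ∀ i : Fin n, 0 < i.val → σ.arr inKind i = (s.kind i).code
  ref : ∀ i : Fin n, 0 < i.val → σ.arr inRef i = s.ref i

/-- The memory holds the representation `R`, in cells with addresses at most `n` of the arrays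
reserved for it. -/
structure Stores {n : ℕ} {G : SimpleGraph (Fin n)} {X : Set (Fin n)} (R : ImplicitRep G X)
    (σ : State) : Prop where
  size_le : R.size ≤ n
  sideX : ∀ v : Fin n, v ∈ X → σ.arr aSide v = 0
  sideY : ∀ v : Fin n, v ∉ X → σ.arr aSide v = 1
  parent : ∀ v : Fin n, σ.arr aParent v = optCode (R.parent v)
  size : σ.arr aSize 0 = R.size
  firstX : ∀ b : Fin R.size, σ.arr aFirstX b = R.firstX b
  lastX : ∀ b : Fin R.size, σ.arr aLastX b = R.lastX b
  firstY : ∀ b : Fin R.size, σ.arr aFirstY b = R.firstY b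
  lastY : ∀ b : Fin R.size, σ.arr aLastY b = R.lastY b
  upper : ∀ b : Fin R.size, HoldsList (σ.arr aUpperNext) (σ.arr aUpperItem) n
    (σ.arr aUpperHead b) ((R.upper b).map Fin.val)
  lower : ∀ b : Fin R.size, HoldsList (σ.arr aLowerNext) (σ.arr aLowerItem) n
    (σ.arr aLowerHead b) ((R.lower b).map Fin.val)
  introducer : ∀ v : Fin n, σ.arr aIntroducer v = optCode (R.introducer v)

/-- `l` lists each element of `S` exactly once, and nothing else. -/
def Lists {m : ℕ} (l : List ℕ) (S : Set (Fin m)) : Prop :=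
  l.Nodup ∧ ∀ x, x ∈ l ↔ ∃ i ∈ S, i.val = x

end BDH

namespace BDH

/-! ## Program logic -/

/-! A maximal biclique is a Galois-closed pair of nonempty sets (`IsConcept`): each shore consists
of all common neighbors of the other, so either shore determines the biclique.

Construction. Vertices are added one by one, and every addition can be recorded in constant time. A
false twin v of u joins exactly the maximal bicliques that contain u (`Concepts.twin`), so the order
does not change. Inserting the arc of v directly above the arc of u puts v on every path that
contains u (`Seg.insert_above`), except that a path starting with u must now start with v. There may
be many such paths; therefore a path stores a cell instead of its first arc, and one exchange of
cell contents updates all of them.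

A pending vertex v at u lies in a single maximal biclique, with shores {u} and N(u) ∪ {v}
(`Concepts.pend`). Let c be the introducer of u; its shore opposite u is the old N(u). If its other
shore is {u}, the new biclique replaces c. Otherwise it is an additional extremal element whose only
cover relation is with c. In one tree its path is the arc of u; in the other it is the path of N(u)
prolonged by v. Thus each vertex brings at most one biclique and one cover pair, which gives linear
space. The invariant is `Model.Valid`, kept by `Model.Valid.twin` and `Model.Valid.pend`.
Connectedness forces the second vertex to be pending; from then on every vertex has a neighbor, so
the introducer c always exists.

Queries. The vertices of a biclique are found by following parent pointers from the last arc of each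
path to the first. The bicliques that contain v form the up-set (v in X) or the down-set (v in Y) of
the introducer of v. In a distance hereditary graph every interval of this order is a chain
(`IsDistanceHereditary.le_total_of_bounded`), because two incomparable elements of an interval would
yield an induced path on five vertices whose ends have a common neighbor. Hence that up-set or
down-set is a tree in the Hasse diagram, and a breadth first search without marks meets each element
once.

Programs are verified through weakest preconditions that count steps and require all values and
addresses to stay within the memory bound. -/

@[simp] theorem State.reg_setReg (σ : State) (d x r : ℕ) :
    (σ.setReg d x).reg r = if r = d then x else σ.reg r := by
  simp [State.setReg, Function.update_apply]

@[simp] theorem State.arr_setReg (σ : State) (d x : ℕ) : (σ.setReg d x).arr = σ.arr := rfl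

@[simp] theorem State.reg_setArr (σ : State) (a i x : ℕ) : (σ.setArr a i x).reg = σ.reg := rfl

@[simp] theorem State.arr_setArr (σ : State) (a i x b : ℕ) :
    (σ.setArr a i x).arr b = if b = a then Function.update (σ.arr a) i x else σ.arr b := by
  by_cases h : b = a
  · subst h; simp [State.setArr]
  · simp [State.setArr, h]

theorem State.read_congr {σ τ : State} {a len : ℕ} (h : ∀ i < len, σ.arr a i = τ.arr a i) :
    σ.read a len = τ.read a len :=
  List.map_congr_left fun i hi => h i (List.mem_range.1 hi)

theorem State.read_succ (σ : State) (a len : ℕ) :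
    σ.read a (len + 1) = σ.read a len ++ [σ.arr a len] := by
  simp [State.read, List.range_succ]

theorem State.length_read (σ : State) (a len : ℕ) : (σ.read a len).length = len := by
  simp [State.read]

theorem State.getElem_read (σ : State) (a len i : ℕ) (h : i < (σ.read a len).length) :
    (σ.read a len)[i] = σ.arr a i := by
  simp [State.read]

/-- Weakest precondition of a program for a postcondition on the final state and the number of
steps. -/
def Prog.wp (M : ℕ) : Prog → (State → ℕ → Prop) → State → Prop
  | .skip, Q, σ => Q σ 1
  | .const d c, Q, σ => c ≤ M ∧ Q (σ.setReg d c) 1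
  | .move d r, Q, σ => σ.reg r ≤ M ∧ Q (σ.setReg d (σ.reg r)) 1
  | .add d r r', Q, σ => σ.reg r + σ.reg r' ≤ M ∧ Q (σ.setReg d (σ.reg r + σ.reg r')) 1
  | .sub d r r', Q, σ => σ.reg r - σ.reg r' ≤ M ∧ Q (σ.setReg d (σ.reg r - σ.reg r')) 1
  | .load d a i, Q, σ =>
      σ.reg i ≤ M ∧ σ.arr a (σ.reg i) ≤ M ∧ Q (σ.setReg d (σ.arr a (σ.reg i))) 1
  | .store a i r, Q, σ =>
      σ.reg i ≤ M ∧ σ.reg r ≤ M ∧ Q (σ.setArr a (σ.reg i) (σ.reg r)) 1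
  | .seq p q, Q, σ => p.wp M (fun σ₁ t₁ => q.wp M (fun σ₂ t₂ => Q σ₂ (t₁ + t₂)) σ₁) σ
  | .ite b p q, Q, σ =>
      (b.Holds σ → p.wp M (fun σ' t => Q σ' (1 + t)) σ) ∧
      (¬ b.Holds σ → q.wp M (fun σ' t => Q σ' (1 + t)) σ)
  | .while b p, Q, σ => ∃ σ' t, Exec M (.while b p) σ σ' t ∧ Q σ' t

theorem Prog.exists_exec_of_wp {M : ℕ} (p : Prog) {Q : State → ℕ → Prop} {σ : State}
    (h : p.wp M Q σ) : ∃ σ' t, Exec M p σ σ' t ∧ Q σ' t := by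
  induction p generalizing Q σ with
  | skip => exact ⟨_, _, .skip σ, h⟩
  | const d c => exact ⟨_, _, .const σ d c h.1, h.2⟩
  | move d r => exact ⟨_, _, .move σ d r h.1, h.2⟩
  | add d r r' => exact ⟨_, _, .add σ d r r' h.1, h.2⟩
  | sub d r r' => exact ⟨_, _, .sub σ d r r' h.1, h.2⟩
  | load d a i => exact ⟨_, _, .load σ d a i h.1 h.2.1, h.2.2⟩
  | store a i r => exact ⟨_, _, .store σ a i r h.1 h.2.1, h.2.2⟩
  | seq p q hp hq =>
    obtain ⟨σ₁, t₁, e₁, h₁⟩ := hp h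
    obtain ⟨σ₂, t₂, e₂, h₂⟩ := hq h₁
    exact ⟨σ₂, _, .seq e₁ e₂, h₂⟩
  | ite b p q hp hq =>
    by_cases hb : b.Holds σ
    · obtain ⟨σ', t, e, h'⟩ := hp (h.1 hb)
      exact ⟨σ', _, .ite_true hb e, h'⟩
    · obtain ⟨σ', t, e, h'⟩ := hq (h.2 hb)
      exact ⟨σ', _, .ite_false hb e, h'⟩
  -- For a loop, `Prog.wp` is by definition the existence of a run.
  | _ => exact h

/-- With the preceding lemma this identifies `Prog.wp` with the existence of a run, from which
monotonicity follows without an induction over programs. -/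
theorem Prog.wp_of_exists_exec {M : ℕ} (p : Prog) {Q : State → ℕ → Prop} {σ : State}
    (h : ∃ σ' t, Exec M p σ σ' t ∧ Q σ' t) : p.wp M Q σ := by
  obtain ⟨σ', t, e, hQ⟩ := h
  induction e generalizing Q with
  | skip => exact hQ
  | const _ _ _ h => exact ⟨h, hQ⟩
  | move _ _ _ h => exact ⟨h, hQ⟩
  | add _ _ _ _ h => exact ⟨h, hQ⟩
  | sub _ _ _ _ h => exact ⟨h, hQ⟩
  | load _ _ _ _ hi h => exact ⟨hi, h, hQ⟩
  | store _ _ _ _ hi h => exact ⟨hi, h, hQ⟩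
  | seq _ _ ih₁ ih₂ => exact ih₁ (ih₂ hQ)
  | ite_true hb _ ih => exact ⟨fun _ => ih hQ, fun h => absurd hb h⟩
  | ite_false hb _ ih => exact ⟨fun h => absurd h hb, fun _ => ih hQ⟩
  | while_true hb h₁ h₂ _ _ => exact ⟨_, _, .while_true hb h₁ h₂, hQ⟩
  | while_false hb => exact ⟨_, _, .while_false hb, hQ⟩

theorem Prog.wp_mono {M : ℕ} (p : Prog) {Q Q' : State → ℕ → Prop} {σ : State}
    (h : p.wp M Q σ) (hQ : ∀ σ' t, Q σ' t → Q' σ' t) : p.wp M Q' σ := by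
  obtain ⟨σ', t, e, h'⟩ := p.exists_exec_of_wp h
  exact p.wp_of_exists_exec ⟨σ', t, e, hQ _ _ h'⟩

/-- Total correctness of a loop with `N` iterations; the invariant may refer to the elapsed time. -/
theorem Prog.wp_while {M N : ℕ} {b : Test} {p : Prog} (I : ℕ → ℕ → State → Prop)
    (hstep : ∀ j T σ, j < N → I j T σ →
      b.Holds σ ∧ p.wp M (fun σ' t => I (j + 1) (T + 1 + t) σ') σ)
    (hexit : ∀ T σ, I N T σ → ¬ b.Holds σ)
    {Q : State → ℕ → Prop} {σ : State} (h0 : I 0 0 σ) (hQ : ∀ T σ', I N T σ' → Q σ' (T + 1)) :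
    (Prog.while b p).wp M Q σ := by
  -- Induction on the number `k` of iterations left. The extra step is the last, failing evaluation
  -- of the test.
  have key : ∀ k j T σ, j + k = N → I j T σ →
      ∃ σ' t, Exec M (.while b p) σ σ' (t + 1) ∧ I N (T + t) σ' := by
    intro k
    induction k with
    | zero =>
      intro j T σ hj h
      obtain rfl : j = N := by omega
      exact ⟨σ, 0, .while_false (hexit T σ h), h⟩
    | succ k ih =>
      intro j T σ hj h
      obtain ⟨hb, hp⟩ := hstep j T σ (by omega) h
      obtain ⟨σ₁, t₁, e₁, h₁⟩ := p.exists_exec_of_wp hp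
      obtain ⟨σ₂, t₂, e₂, h₂⟩ := ih (j + 1) _ σ₁ (by omega) h₁
      refine ⟨σ₂, 1 + t₁ + t₂, ?_, ?_⟩
      · have := Exec.while_true hb e₁ e₂
        rwa [← add_assoc] at this
      · rwa [← add_assoc, ← add_assoc]
  obtain ⟨σ', t, e, h⟩ := key N 0 0 σ (by omega) h0
  exact ⟨σ', t + 1, e, hQ t σ' (by simpa using h)⟩

/-- Sequential composition of a list of programs. -/
def Prog.block : List Prog → Prog
  | [] => .skip
  | [p] => p
  | p :: q :: l => .seq p (Prog.block (q :: l))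

/-! ## Ascending paths -/

/-- `Seg parent α β l`: the list `l` starts with `β`, ends with `α`, and each entry is followed by
its parent. -/
inductive Seg {V : Type*} (parent : V → Option V) (α : V) : V → List V → Prop
  | base : Seg parent α α [α]
  | step {β γ : V} {l : List V} (h : parent γ = some β) (hl : Seg parent α β l) :
      Seg parent α γ (γ :: l)

/-- Ascending from `v` one reaches a vertex without a parent. -/
inductive Rooted {V : Type*} (parent : V → Option V) : V → Prop
  | root {v : V} (h : parent v = none) : Rooted parent v
  | child {v w : V} (h : parent v = some w) (hw : Rooted parent w) : Rooted parent v

section Seg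

variable {V : Type*} {parent : V → Option V} {α β γ : V} {l : List V}

theorem Seg.head_mem (h : Seg parent α β l) : β ∈ l := by
  cases h <;> simp

theorem Seg.last_mem (h : Seg parent α β l) : α ∈ l := by
  induction h with
  | base => simp
  | step _ _ ih => exact List.mem_cons_of_mem _ ih

theorem Seg.concat (h : Seg parent α β l) (hα : parent α = some γ) :
    Seg parent γ β (l ++ [γ]) := by
  induction h with
  | base => exact .step hα .base
  | step h _ ih => exact .step h ih

theorem Seg.exists_of_mem (h : Seg parent α β l) (hγ : γ ∈ l) : ∃ l', Seg parent γ β l' := by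
  induction h with
  | base =>
    obtain rfl : γ = α := by simpa using hγ
    exact ⟨_, .base⟩
  | @step β δ l h hl ih =>
    rcases List.mem_cons.1 hγ with rfl | h'
    · exact ⟨_, .base⟩
    · obtain ⟨l', hl'⟩ := ih h'
      exact ⟨_, .step h hl'⟩

/-- If `v` recurred above its parent `w`, then ascending from `w` to `v` and once more to `w` would
give a segment from `w` that repeats `w`, against the induction hypothesis. -/
theorem Rooted.nodup (hr : Rooted parent β) (h : Seg parent α β l) : l.Nodup := by
  induction hr generalizing α l with
  | root hn =>
    cases h with
    | base => simp
    | step h _ => simp [hn] at h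
  | @child v w hp hw ih =>
    cases h with
    | base => simp
    | @step β _ l' h hl =>
      obtain rfl : w = β := by simpa [hp] using h
      refine List.nodup_cons.2 ⟨fun hv => ?_, ih hl⟩
      obtain ⟨l'', hl''⟩ := hl.exists_of_mem hv
      have := ih (hl''.concat hp)
      have hm := hl''.head_mem
      rw [List.nodup_append] at this
      exact this.2.2 w hm w (by simp) rfl

/-- A path is recognized as a single arc by comparing its ends, in constant time. -/
theorem Seg.eq_singleton_iff (h : Seg parent α β l) (hl : l.Nodup) : α = β ↔ l = [α] := by
  cases h with
  | base => simp
  | step h hl' =>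
    have := hl'.last_mem
    constructor
    · rintro rfl
      simp [this] at hl
    · intro h
      simp_all

theorem IsArborescence.rooted {S : Set V}
    (h : IsArborescence (arcTree S parent) (insert none (some '' S)) none) {v : V} (hv : v ∈ S) :
    Rooted parent v := by
  have key : ∀ b, Relation.ReflTransGen (arcTree S parent).Adj none b → ∀ v, b = some v →
      Rooted parent v := by
    intro b hb
    induction hb with
    | refl => intro v h; simp at h
    | @tail a b _ hab ih =>
      rintro v rfl
      obtain ⟨w, _, hw⟩ := hab
      simp only [arc, Prod.mk.injEq, Option.some.injEq] at hw
      obtain ⟨rfl, rfl⟩ := hw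
      cases hp : parent v with
      | none => exact .root hp
      | some w => exact .child hp (ih w hp)
  exact key _ (h.reachable (some v) (Or.inr ⟨v, hv, rfl⟩)) v rfl

theorem isArborescence_arcTree {S : Set V} (hr : ∀ v ∈ S, Rooted parent v)
    (hS : ∀ v ∈ S, ∀ w, parent v = some w → w ∈ S) :
    IsArborescence (arcTree S parent) (insert none (some '' S)) none where
  root_mem := Set.mem_insert _ _
  mem_of_adj := by
    rintro a b ⟨v, hv, h⟩
    simp only [arc, Prod.mk.injEq] at h
    obtain ⟨rfl, rfl⟩ := h
    refine ⟨?_, Or.inr ⟨v, hv, rfl⟩⟩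
    cases hp : parent v with
    | none => exact Set.mem_insert _ _
    | some w => exact Or.inr ⟨w, hS v hv w hp, rfl⟩
  not_adj_root := by
    rintro a ⟨v, hv, h⟩
    simp [arc] at h
  adj_unique := by
    rintro a a' b ⟨v, hv, h⟩ ⟨v', hv', h'⟩
    simp only [arc, Prod.mk.injEq] at h h'
    obtain ⟨rfl, rfl⟩ := h
    obtain ⟨rfl, h⟩ := h'
    rw [Option.some.inj h]
  reachable := by
    have key : ∀ v, Rooted parent v → v ∈ S →
        Relation.ReflTransGen (arcTree S parent).Adj none (some v) := by
      intro v hv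
      induction hv with
      | @root v h => exact fun hv => .single ⟨v, hv, by simp [arc, h]⟩
      | @child v w h hw ih =>
        exact fun hv => (ih (hS v hv w h)).tail ⟨v, hv, by simp [arc, h]⟩
    rintro b (rfl | ⟨v, hv, rfl⟩)
    · exact .refl
    · exact key v (hr v hv) hv

/-- Segments ascend and dipaths descend, so the dipath is the reversed list of arcs. -/
theorem Seg.isIntervalOf {S : Set V} (h : Seg parent α β l) (hl : ∀ v ∈ l, v ∈ S) :
    IsIntervalOf S parent α β {v | v ∈ l} := by
  refine ⟨(l.map (arc parent)).reverse, ⟨?_, ?_, ?_⟩, ?_, ?_, ?_⟩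
  · cases h <;> simp
  · intro e he
    simp only [List.mem_reverse, List.mem_map] at he
    obtain ⟨v, hv, rfl⟩ := he
    exact ⟨v, hl v hv, rfl⟩
  · rw [List.isChain_reverse]
    clear hl
    induction h with
    | base => simp
    | @step β γ l h hl ih =>
      cases hl with
      | base => simpa [arc] using h.symm
      | step h' hl' => exact List.IsChain.cons_cons (by simp [arc, h]) ih
  · rw [List.head?_reverse]
    clear hl
    induction h with
    | base => simp
    | @step β γ l h hl ih =>
      cases hl with
      | base => simp
      | step h' hl' => rw [List.map_cons, List.map_cons, List.getLast?_cons_cons]; exact ih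
  · rw [List.getLast?_reverse]
    cases h <;> simp
  · ext e
    simp

theorem IsIntervalOf.exists_seg {S F : Set V} (h : IsIntervalOf S parent α β F) :
    ∃ l, Seg parent α β l ∧ (∀ v, v ∈ l ↔ v ∈ F) ∧ ∀ v ∈ l, v ∈ S := by
  obtain ⟨l, ⟨hne, hadj, hch⟩, hα, hβ, hF⟩ := h
  have inj : ∀ {v w}, arc parent v = arc parent w → v = w := fun h => by
    simpa [arc] using congrArg Prod.snd h
  have key : ∀ l : List (Option V × Option V),
      (∀ e ∈ l, (arcTree S parent).Adj e.1 e.2) → l.IsChain (fun e f => e.2 = f.1) →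
      ∀ β, l.head? = some (arc parent α) → l.getLast? = some (arc parent β) →
      ∃ vs, Seg parent α β vs ∧ (vs.map (arc parent)).reverse = l := by
    intro l
    -- A segment grows at its lower end, so the dipath is peeled from its last arc.
    induction l using List.reverseRecOn with
    | nil => intro _ _ β h; simp at h
    | append_singleton l f ih =>
      intro hadj hch β hα hβ
      have hf : f = arc parent β := by simpa using hβ
      rcases List.eq_nil_or_concat l with rfl | ⟨l', e, rfl⟩
      · have : f = arc parent α := by simpa using hα
        obtain rfl : α = β := inj (this.symm.trans hf)
        exact ⟨_, .base, by simp [hf]⟩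
      · obtain ⟨v, hv, he⟩ := hadj e (by simp)
        have he : e = arc parent v := he
        rw [List.isChain_append] at hch
        obtain ⟨vs, hvs, hm⟩ := ih (fun e he => hadj e (by simp at he ⊢; tauto)) hch.1 v
          (by
            rw [← hα]
            cases l' <;> simp) (by simp [he])
        refine ⟨β :: vs, .step ?_ hvs, ?_⟩
        · have := hch.2.2 e (by simp) f (by simp)
          rw [he, hf] at this
          exact this.symm
        · simp only [List.map_cons, List.reverse_cons, hm, hf]
  obtain ⟨vs, hvs, hm⟩ := key l hadj hch β hα hβ
  have hmem : ∀ v, v ∈ vs ↔ arc parent v ∈ l := by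
    intro v
    rw [← hm, List.mem_reverse, List.mem_map]
    exact ⟨fun h => ⟨v, h, rfl⟩, fun ⟨w, hw, h⟩ => inj h ▸ hw⟩
  refine ⟨vs, hvs, fun v => ?_, fun v hv => ?_⟩
  · rw [hmem]
    change arc parent v ∈ {e | e ∈ l} ↔ _
    rw [hF]
    exact ⟨fun ⟨w, hw, h⟩ => inj h ▸ hw, fun h => ⟨v, h, rfl⟩⟩
  · obtain ⟨w, hw, h⟩ := hadj _ ((hmem v).1 hv)
    exact inj h ▸ hw

end Seg

/-! ## Listing the vertices of a maximal biclique -/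

/-- List in the array `out` the path that ends with the arc of array `last` and starts with the arc
of array `first` at the address held by register `0`.  The length goes to register `4`. -/
def walkInit (first last out : ℕ) : Prog :=
  .block [.load 2 last 0, .load 3 first 0, .const 4 0, .const 5 1, .store out 4 2, .move 4 5,
    .const 8 0, .sub 6 2 3, .sub 7 3 2, .add 6 6 7]

/-- One of the two truncated differences vanishes, so register `6` is the distance between the
numbers of the current vertex and of the target; the loop runs while it is positive. Parent codes
are shifted by one, whence the first subtraction. -/
def walkBody (out : ℕ) : Prog :=
  .block [.load 2 aParent 2, .sub 2 2 5, .store out 4 2, .add 4 4 5,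
    .sub 6 2 3, .sub 7 3 2, .add 6 6 7]

def walkLoop (out : ℕ) : Prog := .while (.lt 8 6) (walkBody out)

def listVertices : Prog :=
  .block [walkInit aFirstX aLastX outA, walkLoop outA, .move 9 4,
    walkInit aFirstY aLastY outB, walkLoop outB, .move 0 9, .move 1 4]

/-- `τ` differs from `σ` only in the array `out` and in registers among `2, …, 8`. -/
structure Frame (out : ℕ) (σ τ : State) : Prop where
  arr : ∀ a, a ≠ out → τ.arr a = σ.arr a
  reg : ∀ r, r < 2 ∨ 8 < r → τ.reg r = σ.reg r

/-- On entry `β` has already been written, so only the tail of `l` is appended; this accounts for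
the `n + 1` in the bound on register `4`. An iteration costs a test and seven instructions. -/
theorem wp_walkLoop {n M out : ℕ} (hM : n + 1 ≤ M) {parent : Fin n → Option (Fin n)}
    {α β : Fin n} {l : List (Fin n)} (h : Seg parent α β l) (hl : l.Nodup)
    (hout : aParent ≠ out) {σ : State}
    (hpar : ∀ v : Fin n, σ.arr aParent v = optCode (parent v))
    (h2 : σ.reg 2 = β) (h3 : σ.reg 3 = α) (h5 : σ.reg 5 = 1) (h8 : σ.reg 8 = 0)
    (h6 : σ.reg 6 = (β - α : ℕ) + (α - β : ℕ)) (h4 : σ.reg 4 + l.length ≤ n + 1) :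
    (walkLoop out).wp M (fun σ' t => t ≤ 8 * l.length ∧ Frame out σ σ' ∧
      σ'.reg 4 + 1 = σ.reg 4 + l.length ∧
      σ'.read out (σ'.reg 4) = σ.read out (σ.reg 4) ++ l.tail.map Fin.val) σ := by
  induction h generalizing σ with
  | base =>
    refine ⟨σ, 1, .while_false ?_, by simp, ⟨fun _ _ => rfl, fun _ _ => rfl⟩, by simp, by simp⟩
    simp [Test.Holds, h6, h8]
  | @step β γ l hp hseg ih =>
    -- Without repetition in the list, the test cannot stop the walk before its end.
    have hne : (γ : ℕ) ≠ α := fun h => by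
      have := hseg.last_mem
      rw [← Fin.ext h] at this
      exact (List.nodup_cons.1 hl).1 this
    have hb : Test.Holds (.lt 8 6) σ := by
      simp only [Test.Holds, h6, h8]; omega
    have hγ := hpar γ
    rw [hp] at hγ
    simp only [optCode] at hγ
    have := γ.2
    have := β.2
    have := α.2
    simp only [List.length_cons] at h4
    have hbody : (walkBody out).wp M (fun σ₁ t₁ => t₁ = 7 ∧ Frame out σ σ₁ ∧
        σ₁.reg 2 = β ∧ σ₁.reg 3 = α ∧ σ₁.reg 5 = 1 ∧ σ₁.reg 8 = 0 ∧
        σ₁.reg 6 = (β - α : ℕ) + (α - β : ℕ) ∧ σ₁.reg 4 = σ.reg 4 + 1 ∧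
        σ₁.read out (σ.reg 4 + 1) = σ.read out (σ.reg 4) ++ [β.val]) σ := by
      simp only [walkBody, Prog.block, Prog.wp, State.reg_setReg,
        State.reg_setArr, h2, h3, h5, h8, hγ]
      simp
      and_intros
      any_goals omega
      · refine ⟨fun a ha => by simp [ha], fun r hr => ?_⟩
        simp only [State.reg_setReg, State.reg_setArr]
        split_ifs <;> omega
      · rw [State.read_succ]
        simp only [State.arr_setReg, State.arr_setArr, if_true, Function.update_self]
        congr 1
        refine State.read_congr fun i hi => ?_
        simp [Function.update_of_ne (show i ≠ σ.reg 4 by omega)]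
    obtain ⟨σ₁, t₁, e₁, rfl, f₁, g2, g3, g5, g8, g6, g4, gr⟩ := (walkBody out).exists_exec_of_wp hbody
    obtain ⟨σ₂, t₂, e₂, ht, f₂, k4, kr⟩ := ih (List.nodup_cons.1 hl).2
      (fun v => by rw [f₁.arr _ hout]; exact hpar v) g2 g3 g5 g8 g6 (by omega)
    refine ⟨σ₂, _, .while_true hb e₁ e₂, by simp; omega,
      ⟨fun a ha => (f₂.arr a ha).trans (f₁.arr a ha),
       fun r hr => (f₂.reg r hr).trans (f₁.reg r hr)⟩, by simp; omega, ?_⟩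
    rw [kr, g4, gr]
    cases hseg <;> simp

/-- The nesting of `wp` is the shape into which a block unfolds. The ten initial steps are charged
to the list, which is nonempty: 18 = 10 + 8. -/
theorem wp_walk {n M first last out : ℕ} (hM : n + 1 ≤ M) {parent : Fin n → Option (Fin n)}
    {α β : Fin n} {l : List (Fin n)} (h : Seg parent α β l) (hl : l.Nodup)
    (hout : aParent ≠ out) {σ : State} (h0 : σ.reg 0 ≤ M)
    (hpar : ∀ v : Fin n, σ.arr aParent v = optCode (parent v))
    (hfirst : σ.arr first (σ.reg 0) = α) (hlast : σ.arr last (σ.reg 0) = β) :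
    (walkInit first last out).wp M (fun σ₁ t₁ => (walkLoop out).wp M (fun σ' t =>
      t₁ + t ≤ 18 * l.length ∧ Frame out σ σ' ∧
      σ'.reg 4 = l.length ∧ σ'.read out (σ'.reg 4) = l.map Fin.val) σ₁) σ := by
  have := α.2
  have := β.2
  have hlen : 0 < l.length := List.length_pos_of_mem h.head_mem
  have hcard : l.length ≤ n := by simpa using hl.length_le_card
  have hinit : (walkInit first last out).wp M (fun σ₁ t₁ => t₁ = 10 ∧ Frame out σ σ₁ ∧
        σ₁.reg 2 = β ∧ σ₁.reg 3 = α ∧ σ₁.reg 5 = 1 ∧ σ₁.reg 8 = 0 ∧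
        σ₁.reg 6 = (β - α : ℕ) + (α - β : ℕ) ∧ σ₁.reg 4 = 1 ∧
        σ₁.read out 1 = [β.val]) σ := by
    simp only [walkInit, Prog.block, Prog.wp, State.reg_setReg, State.arr_setReg,
        State.reg_setArr]
    simp [hfirst, hlast]
    and_intros
    any_goals omega
    · refine ⟨fun a ha => by simp [ha], fun r hr => ?_⟩
      simp only [State.reg_setReg, State.reg_setArr]
      split_ifs <;> omega
    · simp [State.read]
  refine Prog.wp_mono _ hinit ?_
  rintro σ₁ t₁ ⟨rfl, f₁, g2, g3, g5, g8, g6, g4, gr⟩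
  refine Prog.wp_mono _ (wp_walkLoop hM h hl hout
    (fun v => by rw [f₁.arr _ hout]; exact hpar v) g2 g3 g5 g8 g6 (by omega)) ?_
  rintro σ₂ t₂ ⟨ht, f₂, k4, kr⟩
  refine ⟨by omega, ⟨fun a ha => (f₂.arr a ha).trans (f₁.arr a ha),
       fun r hr => (f₂.reg r hr).trans (f₁.reg r hr)⟩, by omega, ?_⟩
  rw [kr, g4, gr]
  cases h <;> simp

theorem lists_map_val {m : ℕ} {l : List (Fin m)} {S : Set (Fin m)} (hl : l.Nodup)
    (h : ∀ v, v ∈ l ↔ v ∈ S) : Lists (l.map Fin.val) S :=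
  ⟨hl.map Fin.val_injective, fun x => by simp [h]⟩

theorem Stores.congr {n : ℕ} {G : SimpleGraph (Fin n)} {X : Set (Fin n)} {R : ImplicitRep G X}
    {σ τ : State} (h : Stores R σ) (heq : ∀ a, a ≠ outA → a ≠ outB → τ.arr a = σ.arr a) :
    Stores R τ := by
  have key : ∀ a, a < outA → τ.arr a = σ.arr a := fun a ha =>
    heq a (by unfold outA at *; omega) (by unfold outA outB at *; omega)
  constructor
  · exact h.size_le
  · rw [key aSide (by decide)]; exact h.sideX
  · rw [key aSide (by decide)]; exact h.sideY
  · rw [key aParent (by decide)]; exact h.parent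
  · rw [key aSize (by decide)]; exact h.size
  · rw [key aFirstX (by decide)]; exact h.firstX
  · rw [key aLastX (by decide)]; exact h.lastX
  · rw [key aFirstY (by decide)]; exact h.firstY
  · rw [key aLastY (by decide)]; exact h.lastY
  · rw [key aUpperNext (by decide), key aUpperItem (by decide), key aUpperHead (by decide)]
    exact h.upper
  · rw [key aLowerNext (by decide), key aLowerItem (by decide), key aLowerHead (by decide)]
    exact h.lower
  · rw [key aIntroducer (by decide)]; exact h.introducer

/-- The two walks cost 18 steps per vertex, and the three moves are absorbed because there is at
least one vertex. -/
theorem listVertices_correct {n : ℕ} {G : SimpleGraph (Fin n)} {X : Set (Fin n)}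
    (R : ImplicitRep G X) (σ : State) (hσ : Stores R σ) (b : Fin R.size) (hb : σ.reg 0 = b)
    {M : ℕ} (hM : n + 1 ≤ M) :
    ∃ (σ' : State) (t : ℕ), Exec M listVertices σ σ' t ∧ Stores R σ' ∧
      t ≤ 21 * (R.biclique b).verts.ncard ∧
      Lists (σ'.read outA (σ'.reg 0)) (R.biclique b).shoreX ∧
      Lists (σ'.read outB (σ'.reg 1)) (R.biclique b).shoreY := by
  obtain ⟨l, hl, hlF, hlS⟩ := (R.intervalX b).exists_seg
  obtain ⟨l', hl', hlF', hlS'⟩ := (R.intervalY b).exists_seg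
  have hnd : l.Nodup := (R.treeX.rooted (hlS _ hl.head_mem)).nodup hl
  have hnd' : l'.Nodup := (R.treeY.rooted (hlS' _ hl'.head_mem)).nodup hl'
  have hlen' : 0 < l'.length := List.length_pos_of_mem hl'.head_mem
  have hcard : l.length ≤ n := by simpa using hnd.length_le_card
  have hcard' : l'.length ≤ n := by simpa using hnd'.length_le_card
  have hbn : (b : ℕ) < n := b.2.trans_le hσ.size_le
  have hverts : (R.biclique b).verts.ncard = l.length + l'.length := by
    have : (R.biclique b).verts = ((l ++ l').toFinset : Set (Fin n)) := by
      ext v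
      simp [MaxBiclique.verts, hlF, hlF']
    rw [this, Set.ncard_coe_finset, List.toFinset_card_of_nodup, List.length_append]
    refine List.Nodup.append hnd hnd' fun v hv hv' => ?_
    exact hlS' v hv' (hlS v hv)
  refine Prog.exists_exec_of_wp (M := M) listVertices (Q := fun σ' t => Stores R σ' ∧
      t ≤ 21 * (R.biclique b).verts.ncard ∧
      Lists (σ'.read outA (σ'.reg 0)) (R.biclique b).shoreX ∧
      Lists (σ'.read outB (σ'.reg 1)) (R.biclique b).shoreY) ?_
  simp only [listVertices, Prog.block, Prog.wp]
  refine Prog.wp_mono _ (wp_walk hM hl hnd (by decide) (by omega) hσ.parent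
    (by rw [hb]; exact hσ.firstX b) (by rw [hb]; exact hσ.lastX b)) ?_
  intro σ₁ t₁ h₁
  refine Prog.wp_mono _ h₁ ?_
  rintro σ₂ t₂ ⟨ht, f, h4, hr⟩
  refine ⟨by omega, ?_⟩
  -- Walks leave registers `0` and `9` alone, so the biclique number survives the first walk and the
  -- first length survives the second.
  have h0 : (σ₂.setReg 9 (σ₂.reg 4)).reg 0 = b := by
    simp [f.reg 0 (by omega), hb]
  refine Prog.wp_mono _ (wp_walk hM hl' hnd' (by decide) (by omega)
    (fun v => by simp [f.arr, hσ.parent])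
    (by rw [h0]; simpa [f.arr] using hσ.firstY b) (by rw [h0]; simpa [f.arr] using hσ.lastY b)) ?_
  intro σ₃ t₃ h₃
  refine Prog.wp_mono _ h₃ ?_
  rintro σ₄ t₄ ⟨ht', f', h4', hr'⟩
  have h9 : σ₄.reg 9 = l.length := by
    rw [f'.reg 9 (by omega)]; simpa using h4
  simp only [State.reg_setReg]
  simp only [h9, h4']
  simp
  refine ⟨by omega, by omega, ?_, by omega, ?_, ?_⟩
  · refine hσ.congr fun a ha hb => ?_
    simp [f'.arr a hb, f.arr a ha]
  · have : σ₄.read outA l.length = σ₂.read outA l.length :=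
      State.read_congr fun i _ => by rw [f'.arr _ (by decide)]; rfl
    change Lists (σ₄.read outA l.length) _
    rw [this, ← h4, hr]
    exact lists_map_val hnd hlF
  · change Lists (σ₄.read outB l'.length) _
    rw [← h4', hr']
    exact lists_map_val hnd' hlF'

/-! ## Concepts -/

/-- `(A, B)` is a pair of nonempty sets that determine each other by the adjacency between `P` and
`Q`. -/
structure IsConcept {V : Type*} (G : SimpleGraph V) (P Q A B : Set V) : Prop where
  nonempty_left : A.Nonempty
  nonempty_right : B.Nonempty
  mem_left : ∀ x, x ∈ A ↔ x ∈ P ∧ ∀ y ∈ B, G.Adj x y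
  mem_right : ∀ y, y ∈ B ↔ y ∈ Q ∧ ∀ x ∈ A, G.Adj x y

section Concept

variable {V : Type*} {G : SimpleGraph V} {P Q X A B C D : Set V}

theorem IsConcept.symm (h : IsConcept G P Q A B) : IsConcept G Q P B A :=
  ⟨h.2, h.1, by simpa only [G.adj_comm] using h.4, by simpa only [G.adj_comm] using h.3⟩

/-- This is the antitone Galois correspondence between the two shores. -/
theorem IsConcept.subset_iff (h : IsConcept G P Q A B) (h' : IsConcept G P Q C D) :
    A ⊆ C ↔ D ⊆ B := by
  constructor
  · intro hs y hy
    rw [h.mem_right]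
    exact ⟨((h'.mem_right y).1 hy).1, fun x hx => ((h'.mem_right y).1 hy).2 x (hs hx)⟩
  · intro hs x hx
    rw [h'.mem_left]
    exact ⟨((h.mem_left x).1 hx).1, fun y hy => ((h.mem_left x).1 hx).2 y (hs hy)⟩

theorem IsConcept.eq_iff (h : IsConcept G P Q A B) (h' : IsConcept G P Q C D) :
    A = C ↔ B = D := by
  rw [Set.Subset.antisymm_iff, Set.Subset.antisymm_iff, h.subset_iff h', h'.subset_iff h, and_comm]

/-- The concept generated by a vertex with a neighbor. -/
theorem isConcept_neighbors {x : V} (hx : x ∈ P) (hN : ∃ y ∈ Q, G.Adj x y) :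
    IsConcept G P Q {z | z ∈ P ∧ ∀ y ∈ Q, G.Adj x y → G.Adj z y} {y | y ∈ Q ∧ G.Adj x y} where
  nonempty_left := ⟨x, hx, fun _ _ h => h⟩
  nonempty_right := hN
  mem_left z := by simp
  mem_right y := by
    constructor
    · rintro ⟨hy, h⟩
      exact ⟨hy, fun z hz => hz.2 y hy h⟩
    · rintro ⟨hy, h⟩
      exact ⟨hy, h x ⟨hx, fun _ _ h => h⟩⟩

/-- Maximality is only needed against the insertion of one vertex. -/
theorem MaxBiclique.isConcept (B : MaxBiclique G X) :
    IsConcept G X Xᶜ B.shoreX B.shoreY where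
  nonempty_left := B.isBiclique.nonemptyX
  nonempty_right := B.isBiclique.nonemptyY
  mem_left x := by
    refine ⟨fun h => ⟨B.isBiclique.subsetX h, fun y hy => B.isBiclique.adj x h y hy⟩, ?_⟩
    rintro ⟨hx, h⟩
    rw [← (B.maximal (insert x B.shoreX) B.shoreY ⟨⟨x, Or.inl rfl⟩, B.isBiclique.nonemptyY,
      Set.insert_subset hx B.isBiclique.subsetX, B.isBiclique.subsetY, ?_⟩
      (Set.subset_insert _ _) subset_rfl).1]
    · exact Set.mem_insert _ _
    · rintro a (rfl | ha) b hb
      · exact h b hb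
      · exact B.isBiclique.adj a ha b hb
  mem_right y := by
    refine ⟨fun h => ⟨B.isBiclique.subsetY h, fun x hx => B.isBiclique.adj x hx y h⟩, ?_⟩
    rintro ⟨hy, h⟩
    rw [← (B.maximal B.shoreX (insert y B.shoreY) ⟨B.isBiclique.nonemptyX, ⟨y, Or.inl rfl⟩,
      B.isBiclique.subsetX, Set.insert_subset hy B.isBiclique.subsetY, ?_⟩
      subset_rfl (Set.subset_insert _ _)).2]
    · exact Set.mem_insert _ _
    · rintro a ha b (rfl | hb)
      · exact h a ha
      · exact B.isBiclique.adj a ha b hb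

/-- The maximal biclique given by a concept. -/
def MaxBiclique.ofConcept (h : IsConcept G X Xᶜ A B) : MaxBiclique G X where
  shoreX := A
  shoreY := B
  isBiclique := ⟨h.nonempty_left, h.nonempty_right, fun x hx => ((h.mem_left x).1 hx).1,
    fun y hy => ((h.mem_right y).1 hy).1, fun x hx => ((h.mem_left x).1 hx).2⟩
  maximal A' B' h' hA hB := by
    refine ⟨subset_antisymm (fun x hx => ?_) hA, subset_antisymm (fun y hy => ?_) hB⟩
    · exact (h.mem_left x).2 ⟨h'.subsetX hx, fun y hy => h'.adj x hx y (hB hy)⟩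
    · exact (h.mem_right y).2 ⟨h'.subsetY hy, fun x hx => h'.adj x (hA hx) y hy⟩

theorem MaxBiclique.le_iff_shoreY {B C : MaxBiclique G X} : B ≤ C ↔ C.shoreY ⊆ B.shoreY :=
  B.isConcept.subset_iff C.isConcept

/-- The introducer is the concept generated by `v`. Expressed as an equation for one shore, the
condition no longer quantifies over all bicliques and can be maintained while the graph grows. -/
theorem isIntroducer_iff_of_mem {v : V} (hv : v ∈ X) {B : MaxBiclique G X} :
    IsIntroducer v B ↔ B.shoreY = {y | y ∈ Xᶜ ∧ G.Adj v y} := by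
  have hmem : ∀ C : MaxBiclique G X, v ∈ C.verts ↔ v ∈ C.shoreX := fun C =>
    ⟨fun h => h.resolve_right fun h => C.isBiclique.subsetY h hv, Or.inl⟩
  constructor
  · rintro ⟨h, hB⟩
    rw [hmem] at h
    have hsub : B.shoreY ⊆ {y | y ∈ Xᶜ ∧ G.Adj v y} := fun y hy =>
      ⟨B.isBiclique.subsetY hy, B.isBiclique.adj v h y hy⟩
    have hN : ∃ y ∈ Xᶜ, G.Adj v y := by
      obtain ⟨y, hy⟩ := B.isBiclique.nonemptyY
      exact ⟨y, hsub hy⟩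
    refine hsub.antisymm ?_
    have := (hB (.ofConcept (isConcept_neighbors hv hN))
      ((hmem _).2 ⟨hv, fun _ _ h => h⟩)).1 hv
    exact MaxBiclique.le_iff_shoreY.1 this
  · intro hB
    refine ⟨Or.inl ((B.isConcept.mem_left v).2 ⟨hv, fun y hy => ?_⟩), fun C hC => ⟨fun _ => ?_,
      fun h => absurd hv h⟩⟩
    · rw [hB] at hy
      exact hy.2
    · rw [MaxBiclique.le_iff_shoreY, hB]
      exact fun y hy => ⟨C.isBiclique.subsetY hy, C.isBiclique.adj v ((hmem C).1 hC) y hy⟩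

theorem isIntroducer_iff_of_notMem {v : V} (hv : v ∉ X) {B : MaxBiclique G X} :
    IsIntroducer v B ↔ B.shoreX = {x | x ∈ X ∧ G.Adj v x} := by
  have hmem : ∀ C : MaxBiclique G X, v ∈ C.verts ↔ v ∈ C.shoreY := fun C =>
    ⟨fun h => h.resolve_left fun h => hv (C.isBiclique.subsetX h), Or.inr⟩
  constructor
  · rintro ⟨h, hB⟩
    rw [hmem] at h
    have hsub : B.shoreX ⊆ {y | y ∈ X ∧ G.Adj v y} := fun y hy =>
      ⟨B.isBiclique.subsetX hy, (B.isBiclique.adj y hy v h).symm⟩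
    have hN : ∃ y ∈ X, G.Adj v y := by
      obtain ⟨y, hy⟩ := B.isBiclique.nonemptyX
      exact ⟨y, hsub hy⟩
    refine hsub.antisymm ?_
    exact (hB (.ofConcept (isConcept_neighbors (P := Xᶜ) hv hN).symm)
      ((hmem _).2 ⟨hv, fun _ _ h => h⟩)).2 hv
  · intro hB
    refine ⟨Or.inr ((B.isConcept.mem_right v).2 ⟨hv, fun y hy => ?_⟩), fun C hC =>
      ⟨fun h => absurd h hv, fun _ => ?_⟩⟩
    · rw [hB] at hy
      exact hy.2.symm
    · change C.shoreX ⊆ B.shoreX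
      rw [hB]
      exact fun y hy => ⟨C.isBiclique.subsetX hy, (C.isBiclique.adj y hy v ((hmem C).1 hC)).symm⟩

/-- This turns the query about `v` into the enumeration of a principal up-set; on the other shore it
is a principal down-set. -/
theorem IsIntroducer.mem_verts_iff_of_mem {v : V} (hv : v ∈ X) {B C : MaxBiclique G X}
    (hB : IsIntroducer v B) : v ∈ C.verts ↔ B ≤ C := by
  refine ⟨fun h => (hB.2 C h).1 hv, fun h => Or.inl (h ?_)⟩
  exact hB.1.resolve_right fun h => B.isBiclique.subsetY h hv

theorem IsIntroducer.mem_verts_iff_of_notMem {v : V} (hv : v ∉ X) {B C : MaxBiclique G X}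
    (hB : IsIntroducer v B) : v ∈ C.verts ↔ C ≤ B := by
  refine ⟨fun h => (hB.2 C h).2 hv, fun h => Or.inr (MaxBiclique.le_iff_shoreY.1 h ?_)⟩
  exact hB.1.resolve_left fun h => hv (B.isBiclique.subsetX h)

theorem MaxBiclique.exists_isIntroducer {v : V} {C : MaxBiclique G X} (hv : v ∈ C.verts) :
    ∃ B : MaxBiclique G X, IsIntroducer v B := by
  rcases hv with hv | hv
  · have hX := C.isBiclique.subsetX hv
    obtain ⟨y, hy⟩ := C.isBiclique.nonemptyY
    exact ⟨.ofConcept (isConcept_neighbors hX ⟨y, C.isBiclique.subsetY hy,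
      C.isBiclique.adj v hv y hy⟩), (isIntroducer_iff_of_mem hX).2 rfl⟩
  · have hX := C.isBiclique.subsetY hv
    obtain ⟨y, hy⟩ := C.isBiclique.nonemptyX
    exact ⟨.ofConcept (isConcept_neighbors hX ⟨y, C.isBiclique.subsetX hy,
      (C.isBiclique.adj y hy v hv).symm⟩).symm, (isIntroducer_iff_of_notMem hX).2 rfl⟩

/-! ## The Hasse diagram has no two paths with the same ends -/

/-- A distance hereditary graph has no induced path `a b c d e` whose ends have a common neighbor.
-/
theorem IsDistanceHereditary.no_induced_path (hG : IsDistanceHereditary G) {a b c d e y : V}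
    (hab : G.Adj a b) (hbc : G.Adj b c) (hcd : G.Adj c d) (hde : G.Adj d e)
    (hac : ¬ G.Adj a c) (had : ¬ G.Adj a d) (hae : ¬ G.Adj a e) (hbe : ¬ G.Adj b e)
    (hne : a ≠ e) (hya : G.Adj a y) (hye : G.Adj y e) : False := by
  let s : Set V := {a, b, c, d, e}
  have ha : a ∈ s := by simp [s]
  have hb : b ∈ s := by simp [s]
  have hc : c ∈ s := by simp [s]
  have hd : d ∈ s := by simp [s]
  have he : e ∈ s := by simp [s]
  have rab : (G.induce s).Reachable ⟨a, ha⟩ ⟨b, hb⟩ := SimpleGraph.Adj.reachable hab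
  have rbc : (G.induce s).Reachable ⟨b, hb⟩ ⟨c, hc⟩ := SimpleGraph.Adj.reachable hbc
  have rcd : (G.induce s).Reachable ⟨c, hc⟩ ⟨d, hd⟩ := SimpleGraph.Adj.reachable hcd
  have rde : (G.induce s).Reachable ⟨d, hd⟩ ⟨e, he⟩ := SimpleGraph.Adj.reachable hde
  have hr : ∀ z : s, (G.induce s).Reachable ⟨a, ha⟩ z := by
    rintro ⟨z, hz⟩
    simp only [s, Set.mem_insert_iff, Set.mem_singleton_iff] at hz
    rcases hz with rfl | rfl | rfl | rfl | rfl
    · exact .refl _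
    · exact rab
    · exact rab.trans rbc
    · exact rab.trans (rbc.trans rcd)
    · exact rab.trans (rbc.trans (rcd.trans rde))
  have hconn : (G.induce s).Connected :=
    { preconnected := fun z w => (hr z).symm.trans (hr w), nonempty := ⟨⟨a, ha⟩⟩ }
  have hdist : (G.induce s).dist ⟨a, ha⟩ ⟨e, he⟩ = G.dist a e := hG s hconn _ _
  have hle : G.dist a e ≤ 2 :=
    SimpleGraph.dist_le (SimpleGraph.Walk.cons hya (SimpleGraph.Walk.cons hye .nil))
  obtain ⟨w, hw⟩ := (hr ⟨e, he⟩).exists_walk_length_eq_dist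
  have hlen : w.length ≤ 2 := by omega
  -- Within `s` the only neighbor of `a` is `b`, which is not adjacent to `e`; so no walk of length
  -- at most 2 joins `a` to `e`.
  cases w with
  | nil => exact hne rfl
  | @cons _ z _ h w =>
    obtain ⟨z, hz⟩ := z
    have haz : G.Adj a z := h
    have hz' : z = b := by
      simp only [s, Set.mem_insert_iff, Set.mem_singleton_iff] at hz
      rcases hz with rfl | rfl | rfl | rfl | rfl
      · exact absurd haz (G.loopless.irrefl _)
      · rfl
      all_goals contradiction
    subst hz'
    cases w with
    | nil => contradiction
    | @cons _ z' _ h' w =>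
      cases w with
      | nil => exact hbe h'
      | cons _ w => simp at hlen

/-- If `D` and `D'` are incomparable, choose `x₁` in `D` but not in `D'`, `x₂` in `D'` but not in
`D`, and non-neighbors `y₁` of `x₂` in `D` and `y₂` of `x₁` in `D'`. With `x₀` in `B`, the path `x₁
y₁ x₀ y₂ x₂` is induced, while its ends have a common neighbor `y` in `C`. -/
theorem IsDistanceHereditary.le_total_of_bounded (hG : IsDistanceHereditary G)
    (hX : G.IsBipartiteWith X Xᶜ) {B C D D' : MaxBiclique G X} (h1 : B ≤ D) (h2 : D ≤ C)
    (h1' : B ≤ D') (h2' : D' ≤ C) : D ≤ D' ∨ D' ≤ D := by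
  by_contra! hcon
  obtain ⟨x₁, hx₁, hx₁'⟩ := Set.not_subset.1 hcon.1
  obtain ⟨x₂, hx₂, hx₂'⟩ := Set.not_subset.1 hcon.2
  obtain ⟨x₀, hx₀⟩ := B.isBiclique.nonemptyX
  obtain ⟨y, hy⟩ := C.isBiclique.nonemptyY
  have hX₁ := D.isBiclique.subsetX hx₁
  have hX₂ := D'.isBiclique.subsetX hx₂
  have hX₀ := B.isBiclique.subsetX hx₀
  obtain ⟨y₁, hy₁, hn₁⟩ : ∃ y ∈ D.shoreY, ¬ G.Adj x₂ y := by
    by_contra! h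
    exact hx₂' ((D.isConcept.mem_left x₂).2 ⟨hX₂, h⟩)
  obtain ⟨y₂, hy₂, hn₂⟩ : ∃ y ∈ D'.shoreY, ¬ G.Adj x₁ y := by
    by_contra! h
    exact hx₁' ((D'.isConcept.mem_left x₁).2 ⟨hX₁, h⟩)
  have hind : ∀ {a b}, a ∈ X → b ∈ X → ¬ G.Adj a b := fun ha hb h =>
    (hX.mem_of_mem_adj ha h) hb
  refine hG.no_induced_path (D.isBiclique.adj x₁ hx₁ y₁ hy₁)
    (D.isBiclique.adj x₀ (h1 hx₀) y₁ hy₁).symm (D'.isBiclique.adj x₀ (h1' hx₀) y₂ hy₂)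
    (D'.isBiclique.adj x₂ hx₂ y₂ hy₂).symm (hind hX₁ hX₀) hn₂ (hind hX₁ hX₂)
    (fun h => hn₁ h.symm) ?_
    (C.isBiclique.adj x₁ (h2 hx₁) y hy) (C.isBiclique.adj x₂ (h2' hx₂) y hy).symm
  rintro rfl
  exact hx₁' hx₂

end Concept

/-! ## Listing the maximal bicliques that contain a vertex -/

/-- Append the items of the linked list at register `6` to the array `outA`. -/
def pushLoop (next item : ℕ) : Prog :=
  .while (.lt 8 6) (.block [.load 7 item 6, .store outA 4 7, .add 4 4 5, .load 6 next 6])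

/-- Breadth first search from the item in the first cell of `outA`; the items reached go to `outA`
and their number to register `4`. -/
def search (head next item : ℕ) : Prog :=
  .block [.const 2 0, .const 4 1, .const 5 1, .const 8 0,
    .while (.lt 2 4) (.block [.load 7 outA 2, .load 6 head 7, pushLoop next item, .add 2 2 5])]

def listBicliques : Prog :=
  .block [.load 2 aIntroducer 0, .const 5 1, .const 8 0,
    .ite (.lt 8 2)
      (.block [.sub 2 2 5, .store outA 8 2, .load 3 aSide 0,
        .ite (.eq 3 8) (search aUpperHead aUpperNext aUpperItem)
          (search aLowerHead aLowerNext aLowerItem),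
        .move 0 4])
      (.move 0 8)]

theorem wp_pushLoop {n M next item : ℕ} (hM : n + 1 ≤ M) (hnext : next ≠ outA)
    (hitem : item ≠ outA) (l : List ℕ) {σ : State}
    (hl : HoldsList (σ.arr next) (σ.arr item) n (σ.reg 6) l) (hlt : ∀ x ∈ l, x < n)
    (h5 : σ.reg 5 = 1) (h8 : σ.reg 8 = 0) (h4 : σ.reg 4 + l.length ≤ n) :
    (pushLoop next item).wp M (fun σ' t => t = 5 * l.length + 1 ∧
      (∀ a, a ≠ outA → σ'.arr a = σ.arr a) ∧
      (∀ r, r ≠ 4 → r ≠ 6 → r ≠ 7 → σ'.reg r = σ.reg r) ∧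
      σ'.reg 4 = σ.reg 4 + l.length ∧
      σ'.read outA (σ'.reg 4) = σ.read outA (σ.reg 4) ++ l) σ := by
  induction l generalizing σ with
  | nil =>
    have h6 : σ.reg 6 = 0 := hl
    refine ⟨σ, 1, .while_false ?_, by simp, fun _ _ => rfl, fun _ _ _ _ => rfl, by simp, by simp⟩
    simp [Test.Holds, h6, h8]
  | cons x l ih =>
    obtain ⟨hp, hpn, hx, hl⟩ := hl
    have hxn := hlt x (by simp)
    simp only [List.length_cons] at h4
    have hnx : σ.arr next (σ.reg 6) ≤ n := by
      cases l with
      | nil => exact (show σ.arr next (σ.reg 6) = 0 from hl) ▸ Nat.zero_le _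
      | cons _ _ => exact hl.2.1
    have hbody : (Prog.block [.load 7 item 6, .store outA 4 7, .add 4 4 5, .load 6 next 6]).wp M
        (fun σ₁ t₁ => t₁ = 4 ∧ (∀ a, a ≠ outA → σ₁.arr a = σ.arr a) ∧
        (∀ r, r ≠ 4 → r ≠ 6 → r ≠ 7 → σ₁.reg r = σ.reg r) ∧
        σ₁.reg 6 = σ.arr next (σ.reg 6) ∧ σ₁.reg 4 = σ.reg 4 + 1 ∧
        σ₁.read outA (σ.reg 4 + 1) = σ.read outA (σ.reg 4) ++ [x]) σ := by
      simp [Prog.block, Prog.wp, h5, hx, hnext]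
      and_intros
      any_goals omega
      · intro r h h' h''; simp [h, h', h'']
      · rw [State.read_succ]
        simp only [State.arr_setReg, State.arr_setArr, if_true, Function.update_self]
        congr 1
        refine State.read_congr fun i hi => ?_
        simp [Function.update_of_ne (show i ≠ σ.reg 4 by omega)]
    obtain ⟨σ₁, t₁, e₁, rfl, fa, fr, g6, g4, gr⟩ := Prog.exists_exec_of_wp _ hbody
    obtain ⟨σ₂, t₂, e₂, rfl, fa', fr', k4, kr⟩ := ih (σ := σ₁)
      (by rw [fa _ hnext, fa _ hitem, g6]; exact hl) (fun y hy => hlt y (by simp [hy]))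
      (by rw [fr 5 (by decide) (by decide) (by decide), h5])
      (by rw [fr 8 (by decide) (by decide) (by decide), h8]) (by omega)
    refine ⟨σ₂, _, .while_true (by simp only [Test.Holds]; omega) e₁ e₂, by simp; ring,
      fun a ha => (fa' a ha).trans (fa a ha),
      fun r h h' h'' => (fr' r h h' h'').trans (fr r h h' h''), by simp; omega, ?_⟩
    rw [kr, g4, gr]
    simp

/-- The set `U` is generated from `b₀` by `nb`, and each of its elements is reached in one way. -/
structure IsSearchTree {m : ℕ} (nb : Fin m → List (Fin m)) (b₀ : Fin m) (U : Set (Fin m)) :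
    Prop where
  nodup : ∀ b, (nb b).Nodup
  root_mem : b₀ ∈ U
  closed : ∀ b ∈ U, ∀ c ∈ nb b, c ∈ U ∧ c ≠ b₀
  unique : ∀ b ∈ U, ∀ b' ∈ U, ∀ c, c ∈ nb b → c ∈ nb b' → b = b'
  minimal : ∀ T : Set (Fin m), b₀ ∈ T → (∀ b ∈ T, ∀ c ∈ nb b, c ∈ T) → U ⊆ T

/-- The list of items reached after the neighbors of its first `j` entries have been added. -/
structure SearchState {m : ℕ} (nb : Fin m → List (Fin m)) (b₀ : Fin m) (U : Set (Fin m)) (j : ℕ)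
    (L : List (Fin m)) : Prop where
  nodup : L.Nodup
  subset : ∀ b ∈ L, b ∈ U
  root_mem : b₀ ∈ L
  le_length : j ≤ L.length
  mem_iff : ∀ c, c ∈ L ↔ c = b₀ ∨ ∃ b ∈ L.take j, c ∈ nb b

section

variable {m : ℕ} {nb : Fin m → List (Fin m)} {b₀ : Fin m} {U : Set (Fin m)} {j : ℕ}
  {L : List (Fin m)}

theorem SearchState.length_le (h : SearchState nb b₀ U j L) : L.length ≤ U.ncard := by
  rw [← List.toFinset_card_of_nodup h.nodup, ← Set.ncard_coe_finset]
  refine Set.ncard_le_ncard (fun b hb => h.subset b (by simpa using hb)) (Set.toFinite U)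

/-- Once every entry of the queue has been expanded, the queue is closed under `nb` and contains the
root. -/
theorem SearchState.mem_of_length_eq (hU : IsSearchTree nb b₀ U) (h : SearchState nb b₀ U j L)
    (hj : j = L.length) (b : Fin m) : b ∈ L ↔ b ∈ U := by
  refine ⟨h.subset b, fun hb => hU.minimal {b | b ∈ L} h.root_mem (fun b hb c hc => ?_) hb⟩
  refine (h.mem_iff c).2 (Or.inr ⟨b, ?_, hc⟩)
  rwa [hj, List.take_length]

/-- The queue cannot be exhausted early, so the number of iterations is known in advance, as
`Prog.wp_while` requires. -/
theorem SearchState.lt_length (hU : IsSearchTree nb b₀ U) (h : SearchState nb b₀ U j L)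
    (hj : j < U.ncard) : j < L.length := by
  refine h.le_length.lt_of_ne fun hj' => ?_
  have : U = (L.toFinset : Set (Fin m)) := by
    ext b
    simp [h.mem_of_length_eq hU hj' b]
  rw [this, Set.ncard_coe_finset, List.toFinset_card_of_nodup h.nodup] at hj
  omega

/-- No appended item is already present: the root is nobody's neighbor by `closed`, and any other
item was reached from an earlier entry, which `unique` forbids. This is why the search needs no
marks. -/
theorem SearchState.next (hU : IsSearchTree nb b₀ U) (h : SearchState nb b₀ U j L)
    (hj : j < L.length) : SearchState nb b₀ U (j + 1) (L ++ nb L[j]) := by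
  have hmem : L[j] ∈ U := h.subset _ (List.getElem_mem hj)
  have htake : (L ++ nb L[j]).take (j + 1) = L.take j ++ [L[j]] := by
    rw [List.take_append_of_le_length hj, List.take_succ_eq_append_getElem hj]
  refine ⟨List.Nodup.append h.nodup (hU.nodup _) fun c hc hc' => ?_, fun b hb => ?_, by
    simp [h.root_mem], by simp; omega, fun c => ?_⟩
  · rcases (h.mem_iff c).1 hc with rfl | ⟨b, hb, hcb⟩
    · exact (hU.closed _ hmem _ hc').2 rfl
    · have hbL := List.take_subset _ _ hb
      obtain rfl := hU.unique b (h.subset _ hbL) _ hmem c hcb hc'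
      obtain ⟨i, hi, hij⟩ := List.getElem_of_mem hb
      simp only [List.length_take] at hi
      rw [List.getElem_take, h.nodup.getElem_inj_iff] at hij
      omega
  · rcases List.mem_append.1 hb with hb | hb
    · exact h.subset b hb
    · exact (hU.closed _ hmem _ hb).1
  · rw [htake, List.mem_append, h.mem_iff]
    simp only [List.mem_append, List.mem_singleton, or_and_right, exists_or, exists_eq_left]
    exact or_assoc

end

theorem wp_search {n M m head next item : ℕ} (hM : n + 1 ≤ M) (hhead : head ≠ outA)
    (hnext : next ≠ outA) (hitem : item ≠ outA) (hm : m ≤ n) {nb : Fin m → List (Fin m)}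
    {b₀ : Fin m} {U : Set (Fin m)} (hU : IsSearchTree nb b₀ U) {σ : State}
    (hnb : ∀ b : Fin m, HoldsList (σ.arr next) (σ.arr item) n (σ.arr head b)
      ((nb b).map Fin.val)) (h0 : σ.arr outA 0 = b₀) :
    (search head next item).wp M (fun σ' t => t ≤ 10 * U.ncard + 5 ∧
      (∀ a, a ≠ outA → σ'.arr a = σ.arr a) ∧ σ'.reg 4 ≤ n ∧
      Lists (σ'.read outA (σ'.reg 4)) U) σ := by
  simp only [search, Prog.block, Prog.wp]
  refine ⟨by omega, by omega, by omega, by omega, ?_⟩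
  -- An iteration costs 5 steps and 5 more per appended item, which matches the growth of `5 *
  -- L.length + 5 * j`. The 5 added to `T` accounts for the root, which is in the queue from the
  -- start.
  refine Prog.wp_while (N := U.ncard) (fun j T τ => ∃ L : List (Fin m), SearchState nb b₀ U j L ∧
    (∀ a, a ≠ outA → τ.arr a = σ.arr a) ∧ τ.reg 2 = j ∧ τ.reg 4 = L.length ∧ τ.reg 5 = 1 ∧
    τ.reg 8 = 0 ∧ τ.read outA L.length = L.map Fin.val ∧ T + 5 ≤ 5 * L.length + 5 * j) ?_ ?_ ?_ ?_
  · rintro j T τ hj ⟨L, hL, ha, h2, h4, h5, h8, hr, hT⟩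
    have hjL := hL.lt_length hU hj
    have hlen : L.length ≤ m := by simpa using hL.nodup.length_le_card
    have hnext' := hL.next hU hjL
    have hlen' : (L ++ nb L[j]).length ≤ m := by simpa using hnext'.nodup.length_le_card
    rw [List.length_append] at hlen'
    refine ⟨by simp only [Test.Holds]; omega, ?_⟩
    have hout : τ.arr outA j = (L[j] : ℕ) := by
      rw [← State.getElem_read τ outA L.length j (by simpa [State.length_read] using hjL)]
      simp [hr]
    have hl := hnb L[j]
    have hhd : σ.arr head L[j] ≤ n := by
      cases hnbj : nb L[j] with
      | nil =>
        rw [hnbj] at hl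
        exact (show σ.arr head L[j] = 0 from hl) ▸ Nat.zero_le _
      | cons _ _ =>
        rw [hnbj] at hl
        exact hl.2.1
    simp only [Prog.wp, State.reg_setReg, State.arr_setReg, h2, hout]
    refine ⟨by omega, by omega, by simp; omega, by simp [ha _ hhead]; omega, ?_⟩
    refine Prog.wp_mono _ (wp_pushLoop (n := n) hM hnext hitem ((nb L[j]).map Fin.val)
      (by simpa [ha _ hhead, ha _ hnext, ha _ hitem] using hl) ?_ (by simpa using h5)
      (by simpa using h8) (by simp; omega)) ?_
    · simp only [List.mem_map]
      rintro x ⟨c, -, rfl⟩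
      omega
    · rintro τ' t ⟨rfl, ha', fr, k4, kr⟩
      have k2 : τ'.reg 2 = j := by
        rw [fr 2 (by decide) (by decide) (by decide)]; simpa using h2
      have k5 : τ'.reg 5 = 1 := by
        rw [fr 5 (by decide) (by decide) (by decide)]; simpa using h5
      have k8 : τ'.reg 8 = 0 := by
        rw [fr 8 (by decide) (by decide) (by decide)]; simpa using h8
      have k4' : τ'.reg 4 = (L ++ nb L[j]).length := by
        rw [k4]; simp [h4]
      refine ⟨by omega, L ++ nb L[j], hnext', fun a h => ?_, by simp [k2, k5], by simpa using k4',
        by simpa using k5, by simpa using k8, ?_, ?_⟩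
      · simpa using (ha' a h).trans (ha a h)
      · rw [← k4']
        change τ'.read outA (τ'.reg 4) = _
        rw [kr, List.map_append, ← hr]
        simp [h4]
        rfl
      · simp; omega
  · rintro T τ ⟨L, hL, -, h2, h4, -⟩
    have := hL.length_le
    have := hL.le_length
    simp only [Test.Holds]
    omega
  · refine ⟨[b₀], ⟨by simp, by simpa using hU.root_mem, by simp, by simp, by simp⟩,
      fun _ _ => rfl, ?_⟩
    simp [State.read, h0]
  · rintro T τ ⟨L, hL, ha, h2, h4, h5, h8, hr, hT⟩
    have := hL.length_le
    have := hL.le_length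
    have hlen : L.length ≤ m := by simpa using hL.nodup.length_le_card
    refine ⟨by omega, ha, by omega, ?_⟩
    rw [h4, hr]
    exact lists_map_val hL.nodup (hL.mem_of_length_eq hU (by omega))

/-! ### Up-sets and down-sets of the Hasse diagram as search trees -/

section

variable {n : ℕ} {G : SimpleGraph (Fin n)} {X : Set (Fin n)}

/-- There are finitely many maximal bicliques, so their order is generated by its covering pairs. -/
theorem ImplicitRep.reflTransGen_upper (R : ImplicitRep G X) {b c : Fin R.size}
    (h : R.biclique b ≤ R.biclique c) :
    Relation.ReflTransGen (fun b c => R.biclique b ⋖ R.biclique c) b c := by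
  classical
  have : Fintype (MaxBiclique G X) := Fintype.ofEquiv _ R.biclique
  let _ : LocallyFiniteOrder (MaxBiclique G X) := Fintype.toLocallyFiniteOrder
  have h' := le_iff_reflTransGen_covBy.1 h
  have := h'.lift (p := fun b c => R.biclique b ⋖ R.biclique c) R.biclique.symm
    (fun a b hab => by simpa [Function.onFun] using hab)
  simpa [Function.onFun] using this

theorem ImplicitRep.le_of_reflTransGen (R : ImplicitRep G X) {b c : Fin R.size}
    (h : Relation.ReflTransGen (fun b c => R.biclique b ⋖ R.biclique c) b c) :
    R.biclique b ≤ R.biclique c := by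
  induction h with
  | refl => exact le_rfl
  | tail _ h ih => exact ih.trans h.le

/-- Two elements above `b₀` and covered by the same `c` lie in one interval, which is a chain; being
both covered by `c`, they coincide. -/
theorem ImplicitRep.isSearchTree_upper (R : ImplicitRep G X) (hG : IsDistanceHereditary G)
    (hX : G.IsBipartiteWith X Xᶜ) (b₀ : Fin R.size) :
    IsSearchTree R.upper b₀ {b | R.biclique b₀ ≤ R.biclique b} where
  nodup := R.upper_nodup
  root_mem := le_refl (R.biclique b₀)
  closed b hb c hc := by
    have hbc := (R.mem_upper b c).1 hc
    refine ⟨le_trans hb hbc.le, ?_⟩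
    rintro rfl
    exact hbc.lt.not_ge hb
  unique b hb b' hb' c hc hc' := by
    have h := (R.mem_upper b c).1 hc
    have h' := (R.mem_upper b' c).1 hc'
    apply R.biclique.injective
    rcases hG.le_total_of_bounded hX hb h.le hb' h'.le with hle | hle
    · exact hle.eq_of_not_lt fun hlt => h.2 hlt h'.lt
    · exact (hle.eq_of_not_lt fun hlt => h'.2 hlt h.lt).symm
  minimal T h0 hT := by
    intro c hc
    have := R.reflTransGen_upper hc
    induction this with
    | refl => exact h0
    | tail h1 h2 ih =>
      refine hT _ (ih ?_) _ ((R.mem_upper _ _).2 h2)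
      exact R.le_of_reflTransGen h1

theorem ImplicitRep.isSearchTree_lower (R : ImplicitRep G X) (hG : IsDistanceHereditary G)
    (hX : G.IsBipartiteWith X Xᶜ) (b₀ : Fin R.size) :
    IsSearchTree R.lower b₀ {b | R.biclique b ≤ R.biclique b₀} where
  nodup := R.lower_nodup
  root_mem := le_refl (R.biclique b₀)
  closed b hb c hc := by
    have hbc := (R.mem_lower b c).1 hc
    refine ⟨hbc.le.trans hb, ?_⟩
    rintro rfl
    exact hbc.lt.not_ge hb
  unique b hb b' hb' c hc hc' := by
    have h := (R.mem_lower b c).1 hc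
    have h' := (R.mem_lower b' c).1 hc'
    apply R.biclique.injective
    rcases hG.le_total_of_bounded hX h.le hb h'.le hb' with hle | hle
    · exact hle.eq_of_not_lt fun hlt => h'.2 h.lt hlt
    · exact (hle.eq_of_not_lt fun hlt => h.2 h'.lt hlt).symm
  minimal T h0 hT := by
    intro c hc
    have := R.reflTransGen_upper hc
    induction this using Relation.ReflTransGen.head_induction_on with
    | refl => exact h0
    | head h1 h2 ih =>
      refine hT _ (ih ?_) _ ((R.mem_lower _ _).2 h1)
      exact R.le_of_reflTransGen h2

theorem listBicliques_correct (hG : IsDistanceHereditary G) (hX : G.IsBipartiteWith X Xᶜ)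
    (R : ImplicitRep G X) (σ : State) (hσ : Stores R σ) (v : Fin n) (hv : σ.reg 0 = v)
    {M : ℕ} (hM : n + 1 ≤ M) :
    ∃ (σ' : State) (t : ℕ), Exec M listBicliques σ σ' t ∧ Stores R σ' ∧
      t ≤ 20 * ({b : Fin R.size | v ∈ (R.biclique b).verts}.ncard + 1) ∧
      Lists (σ'.read outA (σ'.reg 0)) {b : Fin R.size | v ∈ (R.biclique b).verts} := by
  have hs := hσ.size_le
  set U := {b : Fin R.size | v ∈ (R.biclique b).verts} with hU
  refine Prog.exists_exec_of_wp (M := M) listBicliques (Q := fun σ' t => Stores R σ' ∧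
      t ≤ 20 * (U.ncard + 1) ∧ Lists (σ'.read outA (σ'.reg 0)) U) ?_
  have hint := hσ.introducer v
  cases hR : R.introducer v with
  | none =>
    rw [hR] at hint
    -- A vertex of some maximal biclique has an introducer, so a null reference means an empty
    -- answer.
    have hUe : U = ∅ := by
      by_contra hne
      obtain ⟨b, hb⟩ := Set.nonempty_iff_ne_empty.2 hne
      obtain ⟨B, hB⟩ := MaxBiclique.exists_isIntroducer hb
      have := (R.introducer_eq v (R.biclique.symm B)).2 (by simpa using hB)
      simp [hR] at this
    simp only [listBicliques, Prog.block, Prog.wp, State.reg_setReg, hv, hint]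
    simp [Test.Holds, optCode]
    refine ⟨by omega, by omega, hσ.congr fun _ _ _ => rfl, by omega, ?_⟩
    simp [Lists, State.read, hUe]
  | some b₀ =>
    rw [hR] at hint
    have hI := (R.introducer_eq v b₀).1 hR
    have hside : σ.arr aSide v ≤ 1 := by
      by_cases h : v ∈ X
      · simp [hσ.sideX v h]
      · simp [hσ.sideY v h]
    simp only [listBicliques, Prog.block, Prog.wp, State.arr_setReg, State.reg_setReg, hv, hint,
      State.reg_setArr, State.arr_setArr]
    simp [Test.Holds, optCode]
    refine ⟨by omega, by omega, by omega, by omega, by omega, by omega, fun h => ?_, fun h => ?_⟩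
    · have hvX : v ∈ X := by
        by_contra h'
        simp [hσ.sideY v h'] at h
      have hUeq : U = {b | R.biclique b₀ ≤ R.biclique b} :=
        Set.ext fun b => hI.mem_verts_iff_of_mem hvX
      refine Prog.wp_mono _ (wp_search hM (by decide) (by decide) (by decide) hs
        (R.isSearchTree_upper hG hX b₀) (by simpa using hσ.upper) (by simp)) ?_
      rintro σ' t ⟨ht, ha, hle, hl⟩
      rw [← hUeq] at ht hl
      refine ⟨by omega, hσ.congr fun a h h' => ?_, by omega, hl⟩
      simp [ha a h, h]
    · have hvX : v ∉ X := fun h' => h (hσ.sideX v h')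
      have hUeq : U = {b | R.biclique b ≤ R.biclique b₀} :=
        Set.ext fun b => hI.mem_verts_iff_of_notMem hvX
      refine Prog.wp_mono _ (wp_search hM (by decide) (by decide) (by decide) hs
        (R.isSearchTree_lower hG hX b₀) (by simpa using hσ.lower) (by simp)) ?_
      rintro σ' t ⟨ht, ha, hle, hl⟩
      rw [← hUeq] at ht hl
      refine ⟨by omega, hσ.congr fun a h h' => ?_, by omega, hl⟩
      simp [ha a h, h]

end

/-! ## Adding a vertex to a bipartite graph -/

/-- The two shores. -/
def shore {V : Type*} (X : Set V) : Bool → Set V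
  | true => X
  | false => Xᶜ

/-- The function with value `x` at `t` and `y` elsewhere. -/
def pick {α : Type*} (t : Bool) (x y : α) : Bool → α := fun t' => if t' = t then x else y

@[simp] theorem pick_self {α : Type*} (t : Bool) (x y : α) : pick t x y t = x := by simp [pick]

@[simp] theorem pick_not {α : Type*} (t : Bool) (x y : α) : pick t x y (!t) = y := by simp [pick]

theorem forall_side (t : Bool) {p : Bool → Prop} : (∀ t', p t') ↔ p t ∧ p (!t) := by
  cases t <;> simp [and_comm]

section

variable {V : Type*} {X : Set V} {G : SimpleGraph V}

theorem mem_shore_not {t : Bool} {v : V} : v ∈ shore X (!t) ↔ v ∉ shore X t := by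
  cases t <;> simp [shore]

theorem mem_shore_of_adj (hX : G.IsBipartiteWith X Xᶜ) {t : Bool} {v w : V} (h : G.Adj v w)
    (hv : v ∈ shore X t) : w ∈ shore X (!t) := by
  cases t
  · exact hX.symm.mem_of_mem_adj hv h
  · exact hX.mem_of_mem_adj hv h

theorem not_adj_of_mem_shore (hX : G.IsBipartiteWith X Xᶜ) {t : Bool} {v w : V}
    (hv : v ∈ shore X t) (hw : w ∈ shore X t) : ¬ G.Adj v w := fun h =>
  mem_shore_not.1 (mem_shore_of_adj hX h hv) hw

/-- `A true b` and `A false b`, for `b < size`, are the shores of the maximal bicliques of the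
subgraph induced by `S`. -/
structure Concepts (G : SimpleGraph V) (X S : Set V) (size : ℕ) (A : Bool → ℕ → Set V) :
    Prop where
  concept : ∀ t, ∀ b < size,
    IsConcept G (shore X t ∩ S) (shore X (!t) ∩ S) (A t b) (A (!t) b)
  complete : ∀ t C D, IsConcept G (shore X t ∩ S) (shore X (!t) ∩ S) C D →
    ∃ b < size, A t b = C ∧ A (!t) b = D
  inj : ∀ t, ∀ b < size, ∀ c < size, A t b = A t c → b = c

/-- Either shore determines the other, so the conditions for one side imply those for both. -/
theorem Concepts.of_side {S : Set V} {size : ℕ} {A : Bool → ℕ → Set V} (t : Bool)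
    (h : ∀ b < size, IsConcept G (shore X t ∩ S) (shore X (!t) ∩ S) (A t b) (A (!t) b))
    (h' : ∀ C D, IsConcept G (shore X t ∩ S) (shore X (!t) ∩ S) C D →
      ∃ b < size, A t b = C)
    (hi : ∀ b < size, ∀ c < size, A t b = A t c → b = c) : Concepts G X S size A := by
  have hc : ∀ C D, IsConcept G (shore X t ∩ S) (shore X (!t) ∩ S) C D →
      ∃ b < size, A t b = C ∧ A (!t) b = D := fun C D hCD => by
    obtain ⟨b, hb, hbC⟩ := h' C D hCD
    exact ⟨b, hb, hbC, ((h b hb).eq_iff hCD).1 hbC⟩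
  refine ⟨(forall_side t).2 ⟨h, ?_⟩, (forall_side t).2 ⟨hc, ?_⟩, (forall_side t).2 ⟨hi, ?_⟩⟩
  · rw [Bool.not_not]
    exact fun b hb => (h b hb).symm
  · rw [Bool.not_not]
    intro C D hCD
    obtain ⟨b, hb, h1, h2⟩ := hc D C hCD.symm
    exact ⟨b, hb, h2, h1⟩
  · exact fun b hb c hc e => hi b hb c hc (((h b hb).eq_iff (h c hc)).2 e)

/-- Covering pairs among the sets `A t d`, `d < size`. -/
def Cov (size : ℕ) (A : Bool → ℕ → Set V) (t : Bool) (b c : ℕ) : Prop :=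
  A t b ⊂ A t c ∧ ∀ d < size, A t b ⊂ A t d → ¬ A t d ⊂ A t c

theorem Concepts.ssubset_iff {S : Set V} {size : ℕ} {A : Bool → ℕ → Set V}
    (h : Concepts G X S size A) (t : Bool) {b c : ℕ} (hb : b < size) (hc : c < size) :
    A t b ⊂ A t c ↔ A (!t) c ⊂ A (!t) b := by
  rw [ssubset_iff_subset_not_subset, ssubset_iff_subset_not_subset,
    (h.concept t b hb).subset_iff (h.concept t c hc),
    (h.concept t c hc).subset_iff (h.concept t b hb)]

theorem Concepts.cov_not {S : Set V} {size : ℕ} {A : Bool → ℕ → Set V}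
    (h : Concepts G X S size A) (t : Bool) {b c : ℕ} (hb : b < size) (hc : c < size) :
    Cov size A (!t) b c ↔ Cov size A t c b := by
  have hs : ∀ {b c}, b < size → c < size → (A (!t) b ⊂ A (!t) c ↔ A t c ⊂ A t b) :=
    fun hb hc => (h.ssubset_iff t hc hb).symm
  unfold Cov
  rw [hs hb hc]
  refine and_congr_right fun _ => forall₂_congr fun d hd => ?_
  rw [hs hb hd, hs hd hc]
  exact ⟨fun h h1 h2 => h h2 h1, fun h h1 h2 => h h2 h1⟩

/-- The sets on one side decide all covering pairs. An update that fixes one shore of every biclique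
therefore leaves the whole Hasse diagram unchanged. -/
theorem Concepts.cov_congr {S S' : Set V} {size : ℕ} {A A' : Bool → ℕ → Set V}
    (h : Concepts G X S size A) (h' : Concepts G X S' size A') (t : Bool)
    (heq : ∀ b < size, A' t b = A t b) (t' : Bool) {b c : ℕ} (hb : b < size) (hc : c < size) :
    Cov size A' t' b c ↔ Cov size A t' b c := by
  have key : ∀ {b c}, b < size → c < size → (Cov size A' t b c ↔ Cov size A t b c) := by
    intro b c hb hc
    unfold Cov
    rw [heq b hb, heq c hc]
    refine and_congr_right fun _ => forall₂_congr fun d hd => ?_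
    rw [heq d hd]
  rcases Bool.eq_or_eq_not t' t with rfl | rfl
  · exact key hb hc
  · rw [h.cov_not t hb hc, h'.cov_not t hb hc, key hc hb]

/-! ### Maximal bicliques after the addition of a false twin -/

section Twin

variable {S : Set V} {t : Bool} {u v : V} {size : ℕ} {A : Bool → ℕ → Set V}

/-- The maximal bicliques after the addition of a false twin `v` of `u`. -/
def twinSets (A : Bool → ℕ → Set V) (t : Bool) (u v : V) : Bool → ℕ → Set V :=
  pick t (fun b => {w | w ∈ A t b ∨ w = v ∧ u ∈ A t b}) (A (!t))

/-- Since `u` and `v` have the same neighbors in `S`, a concept of the larger graph contains both or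
neither, and deleting `v` from it leaves a concept of the smaller one. -/
theorem Concepts.twin (h : Concepts G X S size A) (hu : u ∈ shore X t ∩ S) (hv : v ∉ S)
    (hvt : v ∈ shore X t) (htwin : ∀ w ∈ S, G.Adj v w ↔ G.Adj u w) :
    Concepts G X (insert v S) size (twinSets A t u v) := by
  have hsub : ∀ b < size, ∀ w ∈ A t b, w ∈ shore X t ∩ S := fun b hb w hw =>
    ((((h.concept t b hb).mem_left w).1 hw)).1
  have hsub' : ∀ b < size, ∀ w ∈ A (!t) b, w ∈ shore X (!t) ∩ S := fun b hb w hw =>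
    ((((h.concept t b hb).mem_right w).1 hw)).1
  apply Concepts.of_side t
  · intro b hb
    have hc := h.concept t b hb
    simp only [twinSets, pick_self, pick_not]
    refine ⟨hc.1.mono fun w hw => Or.inl hw, hc.2, fun x => ?_, fun y => ?_⟩
    · constructor
      · rintro (hx | ⟨rfl, hx⟩)
        · exact ⟨⟨(hsub b hb x hx).1, Or.inr (hsub b hb x hx).2⟩, ((hc.mem_left x).1 hx).2⟩
        · refine ⟨⟨hvt, Or.inl rfl⟩, fun y hy => ?_⟩
          rw [htwin y (hsub' b hb y hy).2]
          exact ((hc.mem_left u).1 hx).2 y hy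
      · rintro ⟨⟨hxt, rfl | hxS⟩, hx⟩
        · refine Or.inr ⟨rfl, (hc.mem_left u).2 ⟨hu, fun y hy => ?_⟩⟩
          rw [← htwin y (hsub' b hb y hy).2]
          exact hx y hy
        · exact Or.inl ((hc.mem_left x).2 ⟨⟨hxt, hxS⟩, hx⟩)
    · constructor
      · intro hy
        have hyS := hsub' b hb y hy
        refine ⟨⟨hyS.1, Or.inr hyS.2⟩, ?_⟩
        rintro x (hx | ⟨rfl, hx⟩)
        · exact ((hc.mem_right y).1 hy).2 x hx
        · rw [htwin y hyS.2]
          exact ((hc.mem_right y).1 hy).2 u hx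
      · rintro ⟨⟨hyt, rfl | hyS⟩, hy⟩
        · exact absurd hvt (mem_shore_not.1 hyt)
        · exact (hc.mem_right y).2 ⟨⟨hyt, hyS⟩, fun x hx => hy x (Or.inl hx)⟩
  · intro C D hCD
    have hD : ∀ y ∈ D, y ∈ shore X (!t) ∩ S := by
      intro y hy
      obtain ⟨h1, rfl | h2⟩ := ((hCD.mem_right y).1 hy).1
      · exact absurd hvt (mem_shore_not.1 h1)
      · exact ⟨h1, h2⟩
    have huv : v ∈ C ↔ u ∈ C := by
      rw [hCD.mem_left, hCD.mem_left]
      refine and_congr ⟨fun _ => ⟨hu.1, Or.inr hu.2⟩, fun _ => ⟨hvt, Or.inl rfl⟩⟩ ?_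
      exact forall₂_congr fun y hy => htwin y (hD y hy).2
    have huv' : u ≠ v := by rintro rfl; exact hv hu.2
    have hcon : IsConcept G (shore X t ∩ S) (shore X (!t) ∩ S) (C \ {v}) D := by
      refine ⟨?_, hCD.2, fun x => ?_, fun y => ?_⟩
      · obtain ⟨x, hx⟩ := hCD.1
        by_cases hxv : x = v
        · exact ⟨u, huv.1 (hxv ▸ hx), huv'⟩
        · exact ⟨x, hx, hxv⟩
      · rw [Set.mem_sdiff, hCD.mem_left, Set.mem_singleton_iff]
        constructor
        · rintro ⟨⟨⟨h1, h2 | h2⟩, h3⟩, h4⟩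
          · exact absurd h2 h4
          · exact ⟨⟨h1, h2⟩, h3⟩
        · rintro ⟨⟨h1, h2⟩, h3⟩
          exact ⟨⟨⟨h1, Or.inr h2⟩, h3⟩, fun e => hv (e ▸ h2)⟩
      · constructor
        · intro hy
          exact ⟨hD y hy, fun x hx => ((hCD.mem_right y).1 hy).2 x hx.1⟩
        · rintro ⟨hy, h'⟩
          refine (hCD.mem_right y).2 ⟨⟨hy.1, Or.inr hy.2⟩, fun x hx => ?_⟩
          by_cases hxv : x = v
          · subst hxv
            rw [htwin y hy.2]
            exact h' u ⟨huv.1 hx, huv'⟩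
          · exact h' x ⟨hx, hxv⟩
    obtain ⟨b, hb, hbC, -⟩ := h.complete t _ _ hcon
    refine ⟨b, hb, ?_⟩
    ext w
    simp only [twinSets, pick_self, hbC, Set.mem_ofPred_eq, Set.mem_sdiff, Set.mem_singleton_iff]
    by_cases hw : w = v
    · subst hw
      simp [huv, huv']
    · simp [hw]
  · intro b hb c hc hbc
    refine h.inj t b hb c hc ?_
    have : ∀ d < size, A t d = twinSets A t u v t d ∩ S := by
      intro d hd
      ext w
      simp only [twinSets, pick_self, Set.mem_inter_iff, Set.mem_ofPred_eq]
      constructor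
      · intro hw
        exact ⟨Or.inl hw, (hsub d hd w hw).2⟩
      · rintro ⟨hw | ⟨rfl, -⟩, hwS⟩
        · exact hw
        · exact absurd hwS hv
    rw [this b hb, this c hc, hbc]

end Twin

/-! ### Maximal bicliques after the addition of a pending vertex -/

section Pend

variable {S : Set V} {t : Bool} {u v : V} {size : ℕ} {A : Bool → ℕ → Set V} {c b₀ : ℕ}

/-- The maximal bicliques after the addition of a pending vertex `v` adjacent to `u`, where `c`
introduced `u`; the maximal biclique that contains `v` gets the number `b₀`. -/
def pendSets (A : Bool → ℕ → Set V) (t : Bool) (u v : V) (c b₀ : ℕ) : Bool → ℕ → Set V :=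
  pick t (Function.update (A t) b₀ {u}) (Function.update (A (!t)) b₀ (insert v (A (!t) c)))

/-- The number of the maximal biclique that contains a pending vertex. -/
def PendIndex (A : Bool → ℕ → Set V) (t : Bool) (u : V) (size c b₀ size' : ℕ) : Prop :=
  A t c = {u} ∧ b₀ = c ∧ size' = size ∨ A t c ≠ {u} ∧ b₀ = size ∧ size' = size + 1

variable {size' : ℕ}

/-- On the side of `u`, the introducer `c` is the least biclique through `u`. Hence only `c` can
have the shore `{u}`, and in that case `c` is `b₀`. -/
theorem Concepts.ne_of_ne_pendIndex (h : Concepts G X S size A) (hc : c < size)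
    (hAc : A (!t) c = {w | w ∈ S ∧ G.Adj u w}) (hi : PendIndex A t u size c b₀ size')
    {b : ℕ} (hb : b < size) (hne : b ≠ b₀) : A t b ≠ {u} := by
  intro hbu
  rcases hi with ⟨hu, rfl, -⟩ | ⟨hu, rfl, -⟩
  · exact hne (h.inj t b hb b₀ hc (hbu.trans hu.symm))
  · apply hu
    have hcb := h.concept t b hb
    have hcc := h.concept t c hc
    have huc : u ∈ A t c := by
      have := (hcb.mem_left u).1 (by simp [hbu])
      refine (hcc.mem_left u).2 ⟨this.1, fun y hy => ?_⟩
      rw [hAc] at hy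
      exact hy.2
    have hsub : A t b ⊆ A t c := by
      rw [hbu]; exact Set.singleton_subset_iff.2 huc
    have hsub' : A (!t) b ⊆ A (!t) c := by
      intro y hy
      rw [hAc]
      have := (hcb.mem_right y).1 hy
      exact ⟨this.1.2, this.2 u (by simp [hbu])⟩
    rw [← hbu]
    exact ((hcc.subset_iff hcb).2 hsub').antisymm hsub

theorem PendIndex.lt_of_ne (hi : PendIndex A t u size c b₀ size') {b : ℕ} (hb : b < size')
    (hne : b ≠ b₀) : b < size := by
  rcases hi with ⟨-, -, rfl⟩ | ⟨-, rfl, rfl⟩ <;> omega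

theorem PendIndex.lt (hi : PendIndex A t u size c b₀ size') (hc : c < size) : b₀ < size' := by
  rcases hi with ⟨-, rfl, rfl⟩ | ⟨-, rfl, rfl⟩ <;> omega

theorem PendIndex.le (hi : PendIndex A t u size c b₀ size') : size ≤ size' := by
  rcases hi with ⟨-, rfl, rfl⟩ | ⟨-, rfl, rfl⟩ <;> omega

theorem isConcept_pend (hX : G.IsBipartiteWith X Xᶜ) (hu : u ∈ shore X t ∩ S) (hv : v ∉ S)
    (hvt : v ∈ shore X (!t)) (hpend : ∀ w ∈ S, G.Adj v w ↔ w = u) :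
    IsConcept G (shore X t ∩ insert v S) (shore X (!t) ∩ insert v S) {u}
      (insert v {w | w ∈ S ∧ G.Adj u w}) where
  nonempty_left := Set.singleton_nonempty u
  nonempty_right := Set.insert_nonempty _ _
  mem_left x := by
    constructor
    · rintro rfl
      refine ⟨⟨hu.1, Or.inr hu.2⟩, ?_⟩
      rintro y (rfl | hy)
      · exact ((hpend x hu.2).2 rfl).symm
      · exact hy.2
    · rintro ⟨⟨hxt, rfl | hxS⟩, h⟩
      · exact absurd hxt (mem_shore_not.1 hvt)
      · exact (hpend x hxS).1 (h v (Or.inl rfl)).symm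
  mem_right y := by
    constructor
    · rintro (rfl | hy)
      · exact ⟨⟨hvt, Or.inl rfl⟩, by rintro x rfl; exact ((hpend x hu.2).2 rfl).symm⟩
      · refine ⟨⟨mem_shore_of_adj hX hy.2 hu.1, Or.inr hy.1⟩, ?_⟩
        rintro x rfl
        exact hy.2
    · rintro ⟨⟨hyt, rfl | hyS⟩, h⟩
      · exact Or.inl rfl
      · exact Or.inr ⟨hyS, h u rfl⟩

/-- The only neighbor of `v` in `S` is `u`, so a concept that contains `v` has the shore `{u}`, and
`v` has no influence on the concepts with another shore on that side. -/
theorem Concepts.pend (h : Concepts G X S size A) (hX : G.IsBipartiteWith X Xᶜ)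
    (hu : u ∈ shore X t ∩ S) (hv : v ∉ S)
    (hvt : v ∈ shore X (!t)) (hpend : ∀ w ∈ S, G.Adj v w ↔ w = u) (hc : c < size)
    (hAc : A (!t) c = {w | w ∈ S ∧ G.Adj u w}) (hi : PendIndex A t u size c b₀ size') :
    Concepts G X (insert v S) size' (pendSets A t u v c b₀) := by
  have hnew := isConcept_pend hX hu hv hvt hpend
  apply Concepts.of_side t
  · intro b hb
    simp only [pendSets, pick_self, pick_not, Function.update_apply]
    split_ifs with hbb
    · rw [hAc]
      exact hnew
    · have hbs := hi.lt_of_ne hb hbb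
      have hcb := h.concept t b hbs
      refine ⟨hcb.1, hcb.2, fun x => ?_, fun y => ?_⟩
      · rw [hcb.mem_left]
        refine and_congr_left fun _ => ⟨fun h => ⟨h.1, Or.inr h.2⟩, ?_⟩
        rintro ⟨h1, rfl | h2⟩
        · exact absurd h1 (mem_shore_not.1 hvt)
        · exact ⟨h1, h2⟩
      · rw [hcb.mem_right]
        refine ⟨fun h => ⟨⟨h.1.1, Or.inr h.1.2⟩, h.2⟩, ?_⟩
        rintro ⟨⟨h1, rfl | h2⟩, h3⟩
        · exfalso
          refine h.ne_of_ne_pendIndex hc hAc hi hbs hbb ?_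
          refine Set.eq_singleton_iff_nonempty_unique_mem.2 ⟨hcb.1, fun x hx => ?_⟩
          exact (hpend x ((hcb.mem_left x).1 hx).1.2).1 (h3 x hx).symm
        · exact ⟨⟨h1, h2⟩, h3⟩
  · intro C D hCD
    have hC : ∀ x ∈ C, x ∈ shore X t ∩ S := by
      intro x hx
      obtain ⟨h1, rfl | h2⟩ := ((hCD.mem_left x).1 hx).1
      · exact absurd h1 (mem_shore_not.1 hvt)
      · exact ⟨h1, h2⟩
    by_cases hCu : C = {u}
    · exact ⟨b₀, hi.lt hc, by simp [pendSets, hCu]⟩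
    · have hvD : v ∉ D := fun hvD => hCu <|
        Set.eq_singleton_iff_nonempty_unique_mem.2 ⟨hCD.1, fun x hx =>
          (hpend x (hC x hx).2).1 (((hCD.mem_right v).1 hvD).2 x hx).symm⟩
      have hcon : IsConcept G (shore X t ∩ S) (shore X (!t) ∩ S) C D := by
        refine ⟨hCD.1, hCD.2, fun x => ?_, fun y => ?_⟩
        · rw [hCD.mem_left]
          refine and_congr_left fun h => ⟨?_, fun h => ⟨h.1, Or.inr h.2⟩⟩
          rintro ⟨h1, rfl | h2⟩
          · exact absurd h1 (mem_shore_not.1 hvt)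
          · exact ⟨h1, h2⟩
        · constructor
          · intro hy
            have := (hCD.mem_right y).1 hy
            refine ⟨⟨this.1.1, this.1.2.resolve_left ?_⟩, this.2⟩
            rintro rfl
            exact hvD hy
          · rintro ⟨h1, h2⟩
            exact (hCD.mem_right y).2 ⟨⟨h1.1, Or.inr h1.2⟩, h2⟩
      obtain ⟨b, hb, hbC, -⟩ := h.complete t C D hcon
      refine ⟨b, hb.trans_le hi.le, ?_⟩
      have hbb : b ≠ b₀ := by
        rintro rfl
        rcases hi with ⟨h1, h2, -⟩ | ⟨-, h1, -⟩
        · exact hCu (by rw [← hbC, h2, h1])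
        · omega
      simp [pendSets, hbb, hbC]
  · intro b hb d hd hbd
    simp only [pendSets, pick_self, Function.update_apply] at hbd
    split_ifs at hbd with h1 h2 h2
    · exact h1.trans h2.symm
    · exact absurd hbd.symm (h.ne_of_ne_pendIndex hc hAc hi (hi.lt_of_ne hd h2) h2)
    · exact absurd hbd (h.ne_of_ne_pendIndex hc hAc hi (hi.lt_of_ne hb h1) h1)
    · exact h.inj t b (hi.lt_of_ne hb h1) d (hi.lt_of_ne hd h2) hbd

end Pend

end

/-! ## The representation under construction -/

/-- The data of a representation under construction.  The path of the maximal biclique `b` starts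
with the arc of `cellVal (firstCell t b)`: this indirection lets all paths that start with the arc
of `u` be prolonged at once. -/
structure Model (V : Type*) where
  size : ℕ
  parent : V → Option V
  cellOf : V → V
  cellVal : V → V
  firstCell : Bool → ℕ → V
  last : Bool → ℕ → V
  nb : Bool → ℕ → List ℕ
  intro : V → Option ℕ
  sets : Bool → ℕ → Set V

section

variable {V : Type*}

/-- The model `M` represents the maximal bicliques of the subgraph induced by `S`. -/
structure Model.Valid (G : SimpleGraph V) (X S : Set V) (M : Model V) : Prop where
  concepts : Concepts G X S M.size M.sets
  intro_eq : ∀ t, ∀ v ∈ shore X t ∩ S, ∀ b, M.intro v = some b ↔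
    b < M.size ∧ M.sets (!t) b = {w | w ∈ S ∧ G.Adj v w}
  nb_nodup : ∀ t, ∀ b < M.size, (M.nb t b).Nodup
  mem_nb : ∀ t, ∀ b < M.size, ∀ c, c ∈ M.nb t b ↔ c < M.size ∧ Cov M.size M.sets t b c
  parent_mem : ∀ t, ∀ v ∈ shore X t ∩ S, ∀ w, M.parent v = some w → w ∈ shore X t ∩ S
  rooted : ∀ v ∈ S, Rooted M.parent v
  cellOf_mem : ∀ v ∈ S, M.cellOf v ∈ S
  cellVal_mem : ∀ v ∈ S, M.cellVal v ∈ S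
  cellVal_cellOf : ∀ v ∈ S, M.cellVal (M.cellOf v) = v
  cellOf_cellVal : ∀ v ∈ S, M.cellOf (M.cellVal v) = v
  firstCell_mem : ∀ t, ∀ b < M.size, M.firstCell t b ∈ S
  seg : ∀ t, ∀ b < M.size, ∃ l, Seg M.parent (M.cellVal (M.firstCell t b)) (M.last t b) l ∧
    l.Nodup ∧ ∀ v, v ∈ l ↔ v ∈ M.sets t b

variable {G : SimpleGraph V} {X S : Set V}

theorem Seg.congr {parent parent' : V → Option V} {α β : V} {l : List V}
    (h : Seg parent α β l) (heq : ∀ w ∈ l, parent' w = parent w) : Seg parent' α β l := by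
  induction h with
  | base => exact .base
  | step h _ ih =>
    exact .step ((heq _ (by simp)).trans h) (ih fun w hw => heq w (by simp [hw]))

theorem Concepts.subset {size : ℕ} {A : Bool → ℕ → Set V} (h : Concepts G X S size A) {t : Bool}
    {b : ℕ} (hb : b < size) {v : V} (hv : v ∈ A t b) : v ∈ shore X t ∩ S :=
  (((h.concept t b hb).mem_left v).1 hv).1

variable [DecidableEq V]

/-- Addition of a false twin `v` of `u`. -/
def Model.twin (M : Model V) (t : Bool) (u v : V) : Model V where
  size := M.size
  parent := Function.update (Function.update M.parent v (M.parent u)) u (some v)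
  cellOf := Function.update (Function.update M.cellOf v (M.cellOf u)) u v
  cellVal := Function.update (Function.update M.cellVal (M.cellOf u) v) v u
  firstCell := M.firstCell
  last := M.last
  nb := M.nb
  intro := Function.update M.intro v (M.intro u)
  sets := twinSets M.sets t u v

/-- Insertion of `v` between `u` and its parent prolongs the paths through `u`. -/
theorem Seg.insert_above {parent : V → Option V} {u v α β : V} {l : List V}
    (h : Seg parent α β l) (hl : l.Nodup) (hv : v ∉ l) (hu : u ≠ v) :
    ∃ l', Seg (Function.update (Function.update parent v (parent u)) u (some v))
      (if α = u then v else α) β l' ∧ l'.Nodup ∧ ∀ w, w ∈ l' ↔ w ∈ l ∨ w = v ∧ u ∈ l := by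
  induction h with
  | base =>
    by_cases hα : α = u
    · subst hα
      rw [if_pos rfl]
      refine ⟨[α, v], .step (by simp) .base, by simpa using hu, fun w => by simp⟩
    · rw [if_neg hα]
      refine ⟨[α], .base, by simp, fun w => by simp [Ne.symm hα]⟩
  | @step β γ l h hl' ih =>
    obtain ⟨l', h1, h2, h3⟩ := ih (List.nodup_cons.1 hl).2 fun h => hv (by simp [h])
    have hγ := (List.nodup_cons.1 hl).1
    by_cases hγu : γ = u
    · subst hγu
      have hγl' : γ ∉ l' := fun h => by
        rcases (h3 γ).1 h with h | ⟨h, -⟩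
        · exact hγ h
        · exact hu h
      have hvl' : v ∉ l' := fun h => by
        rcases (h3 v).1 h with h | ⟨-, h⟩
        · exact hv (by simp [h])
        · exact hγ h
      refine ⟨γ :: v :: l', .step (by simp) (.step ?_ h1), ?_, fun w => ?_⟩
      · simp [hu.symm, h]
      · simp [h2, hγl', hvl', hu]
      · simp only [List.mem_cons, h3]
        simp only [hγ, and_false, or_false, and_true]
        tauto
    · have hγv : γ ≠ v := fun h => hv (by simp [h])
      refine ⟨γ :: l', .step ?_ h1, ?_, fun w => ?_⟩
      · simp [hγu, hγv, h]
      · rw [List.nodup_cons]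
        refine ⟨fun h => ?_, h2⟩
        rcases (h3 γ).1 h with h | ⟨h, -⟩
        · exact hγ h
        · exact hγv h
      · simp only [List.mem_cons, h3, Ne.symm hγu, false_or]
        tauto

/-- The cell of `u` passes to `v`, and `u` receives the fresh cell `v`, to which no path refers yet.
So exactly the paths that started with `u` now start with `v`. The shores opposite `u` are
unchanged, hence so are the covering pairs. -/
theorem Model.Valid.twin (hX : G.IsBipartiteWith X Xᶜ) {M : Model V} (hM : M.Valid G X S)
    {t : Bool} {u v : V} (hu : u ∈ shore X t ∩ S) (hv : v ∉ S)
    (hvt : v ∈ shore X t) (htwin : ∀ w ∈ S, G.Adj v w ↔ G.Adj u w) :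
    (M.twin t u v).Valid G X (insert v S) := by
  have hc := hM.concepts.twin hu hv hvt htwin
  have huv : u ≠ v := by rintro rfl; exact hv hu.2
  have hne : ∀ {w}, w ∈ S → w ≠ v := by rintro w hw rfl; exact hv hw
  have hcS : M.cellOf u ∈ S := hM.cellOf_mem u hu.2
  have hsets : ∀ b, (M.twin t u v).sets (!t) b = M.sets (!t) b := fun b => by
    simp [Model.twin, twinSets]
  have hsets' : ∀ b w, w ∈ (M.twin t u v).sets t b ↔
      w ∈ M.sets t b ∨ w = v ∧ u ∈ M.sets t b := fun b w => by
    simp [Model.twin, twinSets]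
  have hfirst : ∀ t', ∀ b < M.size, (M.twin t u v).cellVal ((M.twin t u v).firstCell t' b) =
      if M.cellVal (M.firstCell t' b) = u then v else M.cellVal (M.firstCell t' b) := by
    intro t' b hb
    have hfS := hM.firstCell_mem t' b hb
    simp only [Model.twin, Function.update_apply, if_neg (hne hfS)]
    have : M.firstCell t' b = M.cellOf u ↔ M.cellVal (M.firstCell t' b) = u := by
      constructor
      · intro h; rw [h, hM.cellVal_cellOf u hu.2]
      · intro h; rw [← hM.cellOf_cellVal _ hfS, h]
    simp only [this]
  refine ⟨hc, ?_, hM.nb_nodup, ?_, ?_, ?_, ?_, ?_, ?_, ?_, ?_, ?_⟩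
  · have hint : ∀ w ∈ S, (M.twin t u v).intro w = M.intro w := fun w hw => by
      simp [Model.twin, hne hw]
    refine (forall_side t).2 ⟨?_, ?_⟩
    · rintro w ⟨hwt, rfl | hwS⟩ b
      · have : (M.twin t u w).intro w = M.intro u := by simp [Model.twin]
        rw [this, hM.intro_eq t u hu, hsets]
        refine and_congr_right fun _ => ?_
        have : {z | z ∈ insert w S ∧ G.Adj w z} = {z | z ∈ S ∧ G.Adj u z} := by
          ext z
          constructor
          · rintro ⟨rfl | hz, h⟩
            · exact absurd h (G.loopless.irrefl _)
            · exact ⟨hz, (htwin z hz).1 h⟩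
          · rintro ⟨hz, h⟩
            exact ⟨Or.inr hz, (htwin z hz).2 h⟩
        rw [this]
      · rw [hint w hwS, hM.intro_eq t w ⟨hwt, hwS⟩, hsets]
        refine and_congr_right fun _ => ?_
        have : {z | z ∈ insert v S ∧ G.Adj w z} = {z | z ∈ S ∧ G.Adj w z} := by
          ext z
          constructor
          · rintro ⟨rfl | hz, h⟩
            · exact absurd h (not_adj_of_mem_shore hX hwt hvt)
            · exact ⟨hz, h⟩
          · rintro ⟨hz, h⟩
            exact ⟨Or.inr hz, h⟩
        rw [this]
    · rintro w ⟨hwt, rfl | hwS⟩ b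
      · exact absurd hvt (mem_shore_not.1 hwt)
      · rw [hint w hwS, hM.intro_eq (!t) w ⟨hwt, hwS⟩, Bool.not_not]
        refine and_congr_right fun hb => ?_
        constructor
        · intro h
          ext z
          rw [hsets', h]
          constructor
          · rintro (⟨hz, h⟩ | ⟨rfl, hz, h⟩)
            · exact ⟨Or.inr hz, h⟩
            · exact ⟨Or.inl rfl, ((htwin w hwS).2 h.symm).symm⟩
          · rintro ⟨rfl | hz, h⟩
            · exact Or.inr ⟨rfl, hu.2, ((htwin w hwS).1 h.symm).symm⟩
            · exact Or.inl ⟨hz, h⟩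
        · intro h
          ext z
          constructor
          · intro hz
            have : z ∈ (M.twin t u v).sets t b := (hsets' b z).2 (Or.inl hz)
            rw [h] at this
            exact ⟨(hM.concepts.subset hb hz).2, this.2⟩
          · rintro ⟨hz, h'⟩
            have : z ∈ (M.twin t u v).sets t b := by
              rw [h]; exact ⟨Or.inr hz, h'⟩
            exact ((hsets' b z).1 this).resolve_right fun h => hne hz h.1
  · intro t' b hb c
    rw [show (M.twin t u v).nb = M.nb from rfl, hM.mem_nb t' b hb c]
    refine and_congr_right fun hc' => ?_
    exact (hM.concepts.cov_congr hc (!t) (fun b _ => hsets b) t' hb hc').symm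
  · intro t' w hw z hz
    simp only [Model.twin, Function.update_apply] at hz
    have huS : ∀ {w}, w ∈ shore X t' ∩ S → w ∈ shore X t' ∩ insert v S :=
      fun h => ⟨h.1, Or.inr h.2⟩
    have hside : ∀ {a b}, a ∈ shore X t → b ∈ shore X t → a ∈ shore X t' → b ∈ shore X t' := by
      intro a b ha hb ha'
      rcases Bool.eq_or_eq_not t' t with rfl | rfl
      · exact hb
      · exact absurd ha (mem_shore_not.1 ha')
    split_ifs at hz with h1 h2
    · obtain rfl := Option.some.inj hz
      subst h1
      exact ⟨hside hu.1 hvt hw.1, Or.inl rfl⟩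
    · subst h2
      exact huS (hM.parent_mem t' u ⟨hside hvt hu.1 hw.1, hu.2⟩ z hz)
    · exact huS (hM.parent_mem t' w ⟨hw.1, hw.2.resolve_left h2⟩ z hz)
  · have key : ∀ w, Rooted M.parent w → w ∈ S → Rooted (M.twin t u v).parent w := by
      have hpS : ∀ w ∈ S, ∀ z, M.parent w = some z → z ∈ S := by
        intro w hw z hz
        by_cases hwt : w ∈ shore X t
        · exact (hM.parent_mem t w ⟨hwt, hw⟩ z hz).2
        · exact (hM.parent_mem (!t) w ⟨mem_shore_not.2 hwt, hw⟩ z hz).2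
      intro w hw
      induction hw with
      | @root w h =>
        intro hwS
        by_cases hwu : w = u
        · subst hwu
          exact .child (w := v) (by simp [Model.twin])
            (.root (by simp [Model.twin, huv.symm, h]))
        · exact .root (by simp [Model.twin, hwu, hne hwS, h])
      | @child w z h hz ih =>
        intro hwS
        have hr := ih (hpS w hwS z h)
        by_cases hwu : w = u
        · subst hwu
          exact .child (w := v) (by simp [Model.twin])
            (.child (w := z) (by simp [Model.twin, huv.symm, h]) hr)
        · exact .child (w := z) (by simp [Model.twin, hwu, hne hwS, h]) hr
    rintro w (rfl | hw)
    -- The added vertex is now the parent of `u`, so it inherits rootedness from `u`.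
    · have := key u (hM.rooted u hu.2) hu.2
      cases this with
      | root h => simp [Model.twin] at h
      | @child _ z h hz =>
        have : z = w := by simpa [Model.twin, eq_comm] using h
        exact this ▸ hz
    · exact key w (hM.rooted w hw) hw
  · rintro w hw
    simp only [Model.twin, Function.update_apply]
    split_ifs with h1 h2
    · exact Or.inl rfl
    · exact Or.inr hcS
    · exact Or.inr (hM.cellOf_mem w (hw.resolve_left h2))
  · rintro w hw
    simp only [Model.twin, Function.update_apply]
    split_ifs with h1 h2
    · exact Or.inr hu.2
    · exact Or.inl rfl
    · exact Or.inr (hM.cellVal_mem w (hw.resolve_left h1))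
  · rintro w hw
    simp only [Model.twin, Function.update_apply]
    by_cases h1 : w = u
    · simp [h1]
    · by_cases h2 : w = v
      · simp [h2, huv.symm, hne hcS]
      · have hwS := hw.resolve_left h2
        have h3 : M.cellOf w ≠ M.cellOf u := fun h => h1 <| by
          rw [← hM.cellVal_cellOf w hwS, h, hM.cellVal_cellOf u hu.2]
        simp [h1, h2, hne (hM.cellOf_mem w hwS), h3, hM.cellVal_cellOf w hwS]
  · rintro w hw
    simp only [Model.twin, Function.update_apply]
    by_cases h1 : w = v
    · simp [h1]
    · have hwS := hw.resolve_left h1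
      by_cases h2 : w = M.cellOf u
      · simp [h2, hne hcS, huv.symm]
      · have h3 : M.cellVal w ≠ u := fun h => h2 <| by
          rw [← hM.cellOf_cellVal w hwS, h]
        simp [h1, h2, h3, hne (hM.cellVal_mem w hwS), hM.cellOf_cellVal w hwS]
  · exact fun t' b hb => Or.inr (hM.firstCell_mem t' b hb)
  · intro t' b hb
    obtain ⟨l, h1, h2, h3⟩ := hM.seg t' b hb
    have hvl : v ∉ l := fun h => hv (hM.concepts.subset hb ((h3 v).1 h)).2
    obtain ⟨l', h1', h2', h3'⟩ := h1.insert_above h2 hvl huv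
    refine ⟨l', ?_, h2', fun w => ?_⟩
    · rw [hfirst t' b hb]
      exact h1'
    · rw [h3', h3, h3]
      rcases Bool.eq_or_eq_not t' t with rfl | rfl
      · exact (hsets' b w).symm
      · rw [hsets]
        refine or_iff_left fun h => ?_
        exact mem_shore_not.1 (hM.concepts.subset hb h.2).1 hu.1

/-- Addition of a pending vertex `v` adjacent to `u`, where `c` introduced `u`; the maximal
biclique that contains `v` gets the number `b₀`. -/
def Model.pend (M : Model V) (t : Bool) (u v : V) (c b₀ size' : ℕ) : Model V where
  size := size'
  parent := Function.update M.parent v (some (M.last (!t) c))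
  cellOf := Function.update M.cellOf v v
  cellVal := Function.update M.cellVal v v
  firstCell := pick t (Function.update (M.firstCell t) b₀ (M.cellOf u))
    (Function.update (M.firstCell (!t)) b₀ (M.firstCell (!t) c))
  last := pick t (Function.update (M.last t) b₀ u) (Function.update (M.last (!t)) b₀ v)
  nb := if size' = M.size then M.nb else
    pick t (Function.update (M.nb t) b₀ [c])
      (Function.update (Function.update (M.nb (!t)) c (b₀ :: M.nb (!t) c)) b₀ [])
  intro := Function.update (Function.update M.intro u (some b₀)) v (some b₀)
  sets := pendSets M.sets t u v c b₀

/-- The shore of `c` opposite `u` is the old neighborhood of `u`; hanging `v` below the end of its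
path makes the prolonged path represent the new shore. The other shore is the arc of `u` alone,
reached through the cell of `u`. Since `v` is a leaf of its tree, the other paths are not affected.
-/
theorem Model.Valid.pend (hX : G.IsBipartiteWith X Xᶜ) {M : Model V} (hM : M.Valid G X S)
    {t : Bool} {u v : V} {c b₀ size' : ℕ} (hu : u ∈ shore X t ∩ S) (hv : v ∉ S)
    (hvt : v ∈ shore X (!t)) (hpend : ∀ w ∈ S, G.Adj v w ↔ w = u)
    (hcu : M.intro u = some c) (hi : PendIndex M.sets t u M.size c b₀ size') :
    (M.pend t u v c b₀ size').Valid G X (insert v S) := by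
  obtain ⟨hc, hAc⟩ := (hM.intro_eq t u hu c).1 hcu
  have hC := hM.concepts
  have hC' := hC.pend hX hu hv hvt hpend hc hAc hi
  have huv : u ≠ v := by rintro rfl; exact hv hu.2
  have hne : ∀ {w}, w ∈ S → w ≠ v := by rintro w hw rfl; exact hv hw
  have hb₀ := hi.lt hc
  have hold : ∀ {b}, b < size' → b ≠ b₀ → b < M.size := fun hb h => hi.lt_of_ne hb h
  have hset : ∀ t', ∀ b, b ≠ b₀ → (M.pend t u v c b₀ size').sets t' b = M.sets t' b := by
    refine (forall_side t).2 ⟨fun b hb => ?_, fun b hb => ?_⟩ <;>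
      simp [Model.pend, pendSets, hb]
  have hset_t : (M.pend t u v c b₀ size').sets t b₀ = {u} := by simp [Model.pend, pendSets]
  have hset_n : (M.pend t u v c b₀ size').sets (!t) b₀ = insert v {w | w ∈ S ∧ G.Adj u w} := by
    simp [Model.pend, pendSets, hAc]
  have hsing : ∀ b < M.size, b ≠ b₀ → M.sets t b ≠ {u} := fun b hb hne =>
    hC.ne_of_ne_pendIndex hc hAc hi hb hne
  refine ⟨hC', ?_, ?_, ?_, ?_, ?_, ?_, ?_, ?_, ?_, ?_, ?_⟩
  · have hint : ∀ w ∈ S, w ≠ u → (M.pend t u v c b₀ size').intro w = M.intro w :=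
      fun w hw h => by simp [Model.pend, hne hw, h]
    refine (forall_side t).2 ⟨?_, ?_⟩
    · rintro w ⟨hwt, rfl | hwS⟩ b
      · exact absurd hwt (mem_shore_not.1 hvt)
      · by_cases hwu : w = u
        · subst hwu
          have : (M.pend t w v c b₀ size').intro w = some b₀ := by simp [Model.pend, huv]
          rw [this, Option.some.injEq]
          have hN : {z | z ∈ insert v S ∧ G.Adj w z} = insert v {z | z ∈ S ∧ G.Adj w z} := by
            ext z
            constructor
            · rintro ⟨rfl | hz, h⟩
              · exact Or.inl rfl
              · exact Or.inr ⟨hz, h⟩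
            · rintro (rfl | ⟨hz, h⟩)
              · exact ⟨Or.inl rfl, ((hpend w hwS).2 rfl).symm⟩
              · exact ⟨Or.inr hz, h⟩
          rw [hN, ← hset_n]
          constructor
          · rintro rfl
            exact ⟨hb₀, rfl⟩
          · rintro ⟨hb, h⟩
            exact (hC'.inj (!t) b hb b₀ hb₀ h).symm
        · rw [hint w hwS hwu, hM.intro_eq t w ⟨hwt, hwS⟩]
          have hN : {z | z ∈ insert v S ∧ G.Adj w z} = {z | z ∈ S ∧ G.Adj w z} := by
            ext z
            constructor
            · rintro ⟨rfl | hz, h⟩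
              · exact absurd ((hpend w hwS).1 h.symm) hwu
              · exact ⟨hz, h⟩
            · rintro ⟨hz, h⟩
              exact ⟨Or.inr hz, h⟩
          rw [hN]
          by_cases hbb : b = b₀
          · subst hbb
            constructor
            · rintro ⟨hb, h⟩
              exfalso
              -- If `c` is reused, a vertex `w` introduced by it would lie in its shore `{u}`;
              -- otherwise `b₀` was not an old number.
              rcases hi with ⟨h1, rfl, -⟩ | ⟨-, h1, -⟩
              · have : w ∈ M.sets t b := by
                  refine ((hC.concept t b hb).mem_left w).2 ⟨⟨hwt, hwS⟩, fun y hy => ?_⟩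
                  rw [h] at hy
                  exact hy.2
                rw [h1] at this
                exact hwu this
              · omega
            · rintro ⟨-, h⟩
              have : v ∈ (M.pend t u v c b size').sets (!t) b := by
                rw [hset_n]; exact Or.inl rfl
              rw [h] at this
              exact absurd this.1 hv
          · rw [hset _ b hbb]
            exact and_congr_left fun _ => ⟨fun h => h.trans_le hi.le, fun h => hold h hbb⟩
    · rw [Bool.not_not]
      rintro w ⟨hwt, rfl | hwS⟩ b
      · have : (M.pend t u w c b₀ size').intro w = some b₀ := by simp [Model.pend]
        rw [this, Option.some.injEq]
        have hN : {z | z ∈ insert w S ∧ G.Adj w z} = {u} := by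
          ext z
          constructor
          · rintro ⟨rfl | hz, h⟩
            · exact absurd h (G.loopless.irrefl _)
            · exact (hpend z hz).1 h
          · rintro rfl
            exact ⟨Or.inr hu.2, (hpend z hu.2).2 rfl⟩
        rw [hN, ← hset_t]
        constructor
        · rintro rfl
          exact ⟨hb₀, rfl⟩
        · rintro ⟨hb, h⟩
          exact (hC'.inj t b hb b₀ hb₀ h).symm
      · have hwu : w ≠ u := by
          rintro rfl
          exact mem_shore_not.1 hwt hu.1
        rw [hint w hwS hwu, hM.intro_eq (!t) w ⟨hwt, hwS⟩, Bool.not_not]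
        have hN : {z | z ∈ insert v S ∧ G.Adj w z} = {z | z ∈ S ∧ G.Adj w z} := by
          ext z
          constructor
          · rintro ⟨rfl | hz, h⟩
            · exact absurd h (not_adj_of_mem_shore hX hwt hvt)
            · exact ⟨hz, h⟩
          · rintro ⟨hz, h⟩
            exact ⟨Or.inr hz, h⟩
        rw [hN]
        by_cases hbb : b = b₀
        · subst hbb
          rw [hset_t]
          rcases hi with ⟨h1, h2, h3⟩ | ⟨h1, h2, h3⟩
          · subst h2 h3
            rw [h1]
            rfl
          · constructor
            · rintro ⟨hb, -⟩
              omega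
            · rintro ⟨-, h⟩
              exfalso
              have huw : G.Adj w u := by
                have : u ∈ {z | z ∈ S ∧ G.Adj w z} := by rw [← h]; rfl
                exact this.2
              -- If `u` were the only neighbor of `w` in `S`, then `w` would generate an old concept
              -- with the shore `{u}`, and there is none in this case.
              have hcon := isConcept_neighbors (P := shore X (!t) ∩ S) (Q := shore X t ∩ S)
                ⟨hwt, hwS⟩ ⟨u, hu, huw⟩
              obtain ⟨d, hd, -, hd'⟩ := hC.complete (!t) _ _ (by rw [Bool.not_not]; exact hcon)
              rw [Bool.not_not] at hd'
              refine hsing d hd (by omega) (hd'.trans ?_)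
              rw [h]
              ext z
              constructor
              · rintro ⟨hz, hz'⟩
                exact ⟨hz.2, hz'⟩
              · rintro ⟨hz, hz'⟩
                refine ⟨⟨?_, hz⟩, hz'⟩
                have := mem_shore_of_adj hX hz' hwt
                rwa [Bool.not_not] at this
        · rw [hset _ b hbb]
          exact and_congr_left fun _ => ⟨fun h => h.trans_le hi.le, fun h => hold h hbb⟩
  · intro t' b hb
    rcases hi with ⟨h1, h2, h3⟩ | ⟨h1, h2, h3⟩
    · subst h3
      simp only [Model.pend, if_true]
      exact hM.nb_nodup t' b hb
    · have hsz : ¬ size' = M.size := by omega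
      have hb' : b ≠ b₀ → b < M.size := fun h => by
        change b < size' at hb
        omega
      simp only [Model.pend, if_neg hsz]
      rcases Bool.eq_or_eq_not t' t with rfl | rfl
      · simp only [pick_self, Function.update_apply]
        split_ifs with h
        · simp
        · exact hM.nb_nodup t' b (hb' h)
      · simp only [pick_not, Function.update_apply]
        split_ifs with h h'
        · simp
        · refine List.nodup_cons.2 ⟨fun hm => ?_, hM.nb_nodup _ c hc⟩
          have := ((hM.mem_nb _ c hc b₀).1 hm).1
          omega
        · exact hM.nb_nodup _ b (hb' h)
  · rcases hi with ⟨h1, h2, h3⟩ | ⟨h1, h2, h3⟩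
    · subst h3 h2
      intro t' b hb d
      have : (M.pend t u v b₀ b₀ M.size).nb = M.nb := by simp [Model.pend]
      rw [this, hM.mem_nb t' b hb d]
      refine and_congr_right fun hd => ?_
      refine (hC.cov_congr hC' t (fun b _ => ?_) t' hb hd).symm
      by_cases hbb : b = b₀
      · rw [hbb, h1]; exact hset_t
      · exact hset t b hbb
    · subst h3 h2
      have huc : u ∈ M.sets t c := by
        refine ((hC.concept t c hc).mem_left u).2 ⟨hu, fun y hy => ?_⟩
        rw [hAc] at hy
        exact hy.2
      -- The new shore is a singleton, so the new biclique is minimal on side `t`. It lies between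
      -- no two old ones, and the old covering pairs persist.
      have hbot : ∀ b < M.size, ¬ (M.pend t u v c M.size (M.size + 1)).sets t b ⊂
          (M.pend t u v c M.size (M.size + 1)).sets t M.size := by
        intro b hb hlt'
        rw [hset_t, hset t b hb.ne, Set.ssubset_singleton_iff] at hlt'
        exact (hC.concept t b hb).nonempty_left.ne_empty hlt'
      have cov_old : ∀ {b d}, b < M.size → d < M.size →
          (Cov (M.size + 1) (M.pend t u v c M.size (M.size + 1)).sets t b d ↔
            Cov M.size M.sets t b d) := by
        intro b d hb hd
        unfold Cov
        constructor
        · rintro ⟨h, h'⟩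
          rw [hset t b hb.ne, hset t d hd.ne] at h h'
          refine ⟨h, fun e he => ?_⟩
          have := h' e (by omega)
          rwa [hset t e he.ne] at this
        · rintro ⟨h, h'⟩
          rw [hset t b hb.ne, hset t d hd.ne]
          refine ⟨h, fun e he => ?_⟩
          by_cases hes : e = M.size
          · intro h''
            rw [← hset t b hb.ne, hes] at h''
            exact absurd h'' (hbot b hb)
          · rw [hset t e hes]
            exact h' e (by omega)
      have cov_top : ∀ {b}, b < M.size + 1 →
          ¬ Cov (M.size + 1) (M.pend t u v c M.size (M.size + 1)).sets t b M.size := by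
        intro b hb h
        by_cases hbs : b = M.size
        · rw [hbs] at h
          exact h.1.ne rfl
        · exact hbot b (by omega) h.1
      have hcne : c ≠ M.size := hc.ne
      have hlast : (M.pend t u v c M.size (M.size + 1)).sets t M.size ⊂
          (M.pend t u v c M.size (M.size + 1)).sets t c := by
        rw [hset_t, hset t c hcne]
        exact (Set.singleton_subset_iff.2 huc).ssubset_of_ne (Ne.symm h1)
      have cov_new : ∀ {d}, d < M.size →
          (Cov (M.size + 1) (M.pend t u v c M.size (M.size + 1)).sets t M.size d ↔ d = c) := by
        -- Everything above the new biclique contains `u` and is therefore above `c`, which makes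
        -- `c` its only cover.
        have hleast : ∀ d < M.size, u ∈ M.sets t d → M.sets t c ⊆ M.sets t d := by
          intro d hd hud
          rw [(hC.concept t c hc).subset_iff (hC.concept t d hd), hAc]
          intro y hy
          have hy' := (hC.concept t d hd).mem_right y |>.1 hy
          exact ⟨hy'.1.2, hy'.2 u hud⟩
        intro d hd
        constructor
        · rintro ⟨h, h'⟩
          by_contra hdc
          have hud : u ∈ M.sets t d := by
            rw [hset_t, hset t d hd.ne] at h
            exact h.1 rfl
          refine h' c (by omega) hlast ?_
          rw [hset t d hd.ne, hset t c hcne]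
          exact (hleast d hd hud).ssubset_of_ne fun h => hdc (hC.inj t c hc d hd h).symm
        · rintro rfl
          refine ⟨hlast, fun e he h h' => ?_⟩
          have hes : e ≠ M.size := fun h'' => (h''.symm ▸ h).ne rfl
          rw [hset_t, hset t e hes] at h
          rw [hset t e hes, hset t d hcne] at h'
          exact h'.2 (hleast e (by omega) (h.1 rfl))
      have hsz : ¬ M.size + 1 = M.size := by omega
      refine (forall_side t).2 ⟨fun b hb d => ?_, fun b hb d => ?_⟩
      · change _ ↔ d < M.size + 1 ∧ Cov (M.size + 1) _ t b d
        change b < M.size + 1 at hb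
        by_cases hbb : b = M.size
        · subst hbb
          have : (M.pend t u v c M.size (M.size + 1)).nb t M.size = [c] := by simp [Model.pend]
          rw [this, List.mem_singleton]
          constructor
          · rintro rfl
            exact ⟨by omega, (cov_new hc).2 rfl⟩
          · rintro ⟨hd, h⟩
            by_cases hds : d = M.size
            · rw [hds] at h
              exact absurd h (cov_top hb)
            · exact (cov_new (by omega)).1 h
        · have : (M.pend t u v c M.size (M.size + 1)).nb t b = M.nb t b := by
            simp [Model.pend, hbb]
          rw [this, hM.mem_nb t b (by omega)]
          constructor
          · rintro ⟨hd, h⟩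
            exact ⟨by omega, (cov_old (by omega) hd).2 h⟩
          · rintro ⟨hd, h⟩
            by_cases hds : d = M.size
            · rw [hds] at h
              exact absurd h (cov_top hb)
            · exact ⟨by omega, (cov_old (by omega) (by omega)).1 h⟩
      · change b < M.size + 1 at hb
        -- The lists of the other side record the same pairs reversed, so the facts about side `t`
        -- settle them.
        have hcov : d < M.size + 1 ∧
            Cov (M.size + 1) (M.pend t u v c M.size (M.size + 1)).sets (!t) b d ↔
            d < M.size + 1 ∧
            Cov (M.size + 1) (M.pend t u v c M.size (M.size + 1)).sets t d b :=
          and_congr_right fun hd => hC'.cov_not t hb hd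
        change _ ↔ d < M.size + 1 ∧ Cov (M.size + 1) _ (!t) b d
        rw [hcov]
        by_cases hbb : b = M.size
        · subst hbb
          have : (M.pend t u v c M.size (M.size + 1)).nb (!t) M.size = [] := by
            simp [Model.pend]
          rw [this]
          refine ⟨fun h => by simp at h, fun h => absurd h.2 (cov_top h.1)⟩
        · have hb' : b < M.size := by omega
          have hold' : d ∈ M.nb (!t) b ↔
              d < M.size ∧ Cov (M.size + 1) (M.pend t u v c M.size (M.size + 1)).sets t d b := by
            rw [hM.mem_nb (!t) b hb']
            refine and_congr_right fun hd => ?_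
            rw [hC.cov_not t hb' hd, cov_old hd hb']
          have : d ∈ (M.pend t u v c M.size (M.size + 1)).nb (!t) b ↔
              (b = c ∧ d = M.size) ∨ d ∈ M.nb (!t) b := by
            by_cases hbc : b = c
            · subst hbc
              simp [Model.pend, hcne]
            · simp [Model.pend, hbb, hbc]
          rw [this, hold']
          constructor
          · rintro (⟨rfl, rfl⟩ | ⟨hd, h⟩)
            · exact ⟨by omega, (cov_new hb').2 rfl⟩
            · exact ⟨by omega, h⟩
          · rintro ⟨hd, h⟩
            by_cases hds : d = M.size
            · subst hds
              exact Or.inl ⟨(cov_new hb').1 h, rfl⟩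
            · exact Or.inr ⟨by omega, h⟩
  · have huS : ∀ {t' w}, w ∈ shore X t' ∩ S → w ∈ shore X t' ∩ insert v S :=
      fun h => ⟨h.1, Or.inr h.2⟩
    intro t' w hw z hz
    simp only [Model.pend, Function.update_apply] at hz
    split_ifs at hz with h
    · subst h
      obtain rfl : t' = !t := by
        rcases Bool.eq_or_eq_not t' t with rfl | rfl
        · exact absurd hw.1 (mem_shore_not.1 hvt)
        · rfl
      obtain rfl := Option.some.inj hz
      obtain ⟨l, h1, -, h3⟩ := hM.seg (!t) c hc
      exact huS (hC.subset hc ((h3 _).1 h1.head_mem))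
    · exact huS (hM.parent_mem t' w ⟨hw.1, hw.2.resolve_left h⟩ z hz)
  · have key : ∀ w, Rooted M.parent w → w ∈ S → Rooted (M.pend t u v c b₀ size').parent w := by
      have hpS : ∀ w ∈ S, ∀ z, M.parent w = some z → z ∈ S := by
        intro w hw z hz
        by_cases hwt : w ∈ shore X t
        · exact (hM.parent_mem t w ⟨hwt, hw⟩ z hz).2
        · exact (hM.parent_mem (!t) w ⟨mem_shore_not.2 hwt, hw⟩ z hz).2
      intro w hw
      induction hw with
      | @root w h => exact fun hwS => .root (by simp [Model.pend, hne hwS, h])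
      | @child w z h hz ih =>
        exact fun hwS => .child (w := z) (by simp [Model.pend, hne hwS, h]) (ih (hpS w hwS z h))
    rintro w (rfl | hw)
    · obtain ⟨l, h1, -, h3⟩ := hM.seg (!t) c hc
      have hl := (hC.subset hc ((h3 _).1 h1.head_mem)).2
      exact .child (w := M.last (!t) c) (by simp [Model.pend]) (key _ (hM.rooted _ hl) hl)
    · exact key w (hM.rooted w hw) hw
  · intro w hw
    simp only [Model.pend, Function.update_apply]
    split_ifs with h
    · exact Or.inl rfl
    · exact Or.inr (hM.cellOf_mem w (hw.resolve_left h))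
  · intro w hw
    simp only [Model.pend, Function.update_apply]
    split_ifs with h
    · exact Or.inl rfl
    · exact Or.inr (hM.cellVal_mem w (hw.resolve_left h))
  · intro w hw
    simp only [Model.pend, Function.update_apply]
    by_cases h : w = v
    · simp [h]
    · have := hw.resolve_left h
      simp [h, hne (hM.cellOf_mem w this), hM.cellVal_cellOf w this]
  · intro w hw
    simp only [Model.pend, Function.update_apply]
    by_cases h : w = v
    · simp [h]
    · have := hw.resolve_left h
      simp [h, hne (hM.cellVal_mem w this), hM.cellOf_cellVal w this]
  · refine (forall_side t).2 ⟨fun b hb => ?_, fun b hb => ?_⟩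
    · simp only [Model.pend, pick_self, Function.update_apply]
      split_ifs with h
      · exact Or.inr (hM.cellOf_mem u hu.2)
      · exact Or.inr (hM.firstCell_mem t b (hold hb h))
    · simp only [Model.pend, pick_not, Function.update_apply]
      split_ifs with h
      · exact Or.inr (hM.firstCell_mem (!t) c hc)
      · exact Or.inr (hM.firstCell_mem (!t) b (hold hb h))
  · have hcell : ∀ w ∈ S, (M.pend t u v c b₀ size').cellVal w = M.cellVal w := fun w hw => by
      simp [Model.pend, hne hw]
    have hframe : ∀ t', ∀ b < M.size, ∀ l, (∀ w, w ∈ l ↔ w ∈ M.sets t' b) →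
        ∀ α β, Seg M.parent α β l → Seg (M.pend t u v c b₀ size').parent α β l := by
      intro t' b hb l hl α β h
      refine h.congr fun w hw => ?_
      simp [Model.pend, hne (hC.subset hb ((hl w).1 hw)).2]
    intro t' b hb
    by_cases hbb : b = b₀
    · subst hbb
      rcases Bool.eq_or_eq_not t' t with rfl | rfl
      · refine ⟨[u], ?_, by simp, fun w => by rw [hset_t]; simp⟩
        have h1 : (M.pend t' u v c b size').firstCell t' b = M.cellOf u := by simp [Model.pend]
        have h2 : (M.pend t' u v c b size').last t' b = u := by simp [Model.pend]
        rw [h1, h2, hcell _ (hM.cellOf_mem u hu.2), hM.cellVal_cellOf u hu.2]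
        exact .base
      · obtain ⟨l, h1, h2, h3⟩ := hM.seg (!t) c hc
        have hvl : v ∉ l := fun h => hv (hC.subset hc ((h3 v).1 h)).2
        refine ⟨v :: l, ?_, List.nodup_cons.2 ⟨hvl, h2⟩, fun w => ?_⟩
        · have e1 : (M.pend t u v c b size').firstCell (!t) b = M.firstCell (!t) c := by
            simp [Model.pend]
          have e2 : (M.pend t u v c b size').last (!t) b = v := by simp [Model.pend]
          rw [e1, e2, hcell _ (hM.firstCell_mem _ c hc)]
          exact .step (by simp [Model.pend]) (hframe _ c hc l h3 _ _ h1)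
        · rw [hset_n, ← hAc, List.mem_cons, h3]
          rfl
    · have hb' := hold hb hbb
      obtain ⟨l, h1, h2, h3⟩ := hM.seg t' b hb'
      refine ⟨l, ?_, h2, fun w => by rw [h3, hset _ b hbb]⟩
      have e : (M.pend t u v c b₀ size').firstCell t' b = M.firstCell t' b ∧
          (M.pend t u v c b₀ size').last t' b = M.last t' b := by
        rcases Bool.eq_or_eq_not t' t with rfl | rfl <;> simp [Model.pend, hbb]
      rw [e.1, e.2, hcell _ (hM.firstCell_mem _ b hb')]
      exact hframe _ b hb' l h3 _ _ h1

end

/-! ### Models of one vertex and one edge, and access to introducers -/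

section

variable {V : Type*} {G : SimpleGraph V} {X S : Set V}

/-- The model of a graph with one vertex. -/
def Model.single (x : V) : Model V where
  size := 0
  parent := fun _ => none
  cellOf := id
  cellVal := id
  firstCell := fun _ _ => x
  last := fun _ _ => x
  nb := fun _ _ => []
  intro := fun _ => none
  sets := fun _ _ => ∅

/-- A single vertex lies on one shore, so no concept has both shores nonempty. -/
theorem Model.valid_single (x : V) : (Model.single x).Valid G X {x} := by
  refine ⟨⟨?_, ?_, ?_⟩, ?_, ?_, ?_, ?_, ?_, ?_, ?_, ?_, ?_, ?_, ?_⟩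
  · intro t b hb
    exact absurd hb (Nat.not_lt_zero b)
  · intro t C D h
    obtain ⟨a, ha⟩ := h.1
    obtain ⟨b, hb⟩ := h.2
    have ha' := (h.mem_left a).1 ha
    have hb' := (h.mem_right b).1 hb
    have : b = a := hb'.1.2.trans ha'.1.2.symm
    exact absurd ha'.1.1 (mem_shore_not.1 (this ▸ hb'.1.1))
  · intro t b hb
    exact absurd hb (Nat.not_lt_zero b)
  · intro t v _ b
    refine ⟨fun h => ?_, fun h => absurd h.1 (Nat.not_lt_zero b)⟩
    simp [Model.single] at h
  · intro t b hb
    exact absurd hb (Nat.not_lt_zero b)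
  · intro t b hb
    exact absurd hb (Nat.not_lt_zero b)
  · intro t v _ w h
    simp [Model.single] at h
  · exact fun v _ => .root rfl
  · exact fun v hv => hv
  · exact fun v hv => hv
  · exact fun v _ => rfl
  · exact fun v _ => rfl
  · intro t b hb
    exact absurd hb (Nat.not_lt_zero b)
  · intro t b hb
    exact absurd hb (Nat.not_lt_zero b)

/-- The model of a graph with two adjacent vertices. -/
def Model.edge (x y : V) : Model V where
  size := 1
  parent := fun _ => none
  cellOf := id
  cellVal := id
  firstCell := fun t _ => if t then x else y
  last := fun t _ => if t then x else y
  nb := fun _ _ => []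
  intro := fun _ => some 0
  sets := fun t _ => if t then {x} else {y}

theorem Model.valid_edge (hX : G.IsBipartiteWith X Xᶜ) {x y : V} (hx : x ∈ X)
    (hxy : G.Adj x y) : (Model.edge x y).Valid G X {x, y} := by
  have hyX : y ∉ X := hX.mem_of_mem_adj hx hxy
  have hX' : ∀ z, z ∈ X ∩ {x, y} ↔ z = x := by
    intro z
    constructor
    · rintro ⟨h, rfl | rfl⟩
      · rfl
      · exact absurd h hyX
    · rintro rfl
      exact ⟨hx, Or.inl rfl⟩
  have hY' : ∀ z, z ∈ Xᶜ ∩ {x, y} ↔ z = y := by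
    intro z
    constructor
    · rintro ⟨h, rfl | rfl⟩
      · exact absurd hx h
      · rfl
    · rintro rfl
      exact ⟨hyX, Or.inr rfl⟩
  have hb0 : ∀ {b}, b < (Model.edge x y).size → b = 0 := fun h => Nat.lt_one_iff.1 h
  refine ⟨.of_side true ?_ ?_ ?_, ?_, ?_, ?_, ?_, ?_, ?_, ?_, ?_, ?_, ?_, ?_⟩
  · intro b _
    refine ⟨⟨x, rfl⟩, ⟨y, rfl⟩, fun z => ?_, fun z => ?_⟩
    · change z = x ↔ z ∈ X ∩ {x, y} ∧ ∀ w, w = y → G.Adj z w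
      rw [hX']
      exact ⟨by rintro rfl; exact ⟨rfl, by rintro w rfl; exact hxy⟩, fun h => h.1⟩
    · change z = y ↔ z ∈ Xᶜ ∩ {x, y} ∧ ∀ w, w = x → G.Adj w z
      rw [hY']
      exact ⟨by rintro rfl; exact ⟨rfl, by rintro w rfl; exact hxy⟩, fun h => h.1⟩
  · intro C D h
    refine ⟨0, Nat.zero_lt_one, ?_⟩
    have hC : ∀ z ∈ C, z = x := fun z hz => (hX' z).1 ((h.mem_left z).1 hz).1
    exact (Set.eq_singleton_iff_nonempty_unique_mem.2 ⟨h.1, hC⟩).symm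
  · intro b hb c hc _
    rw [hb0 hb, hb0 hc]
  · refine (forall_side true).2 ⟨fun v hv b => ?_, fun v hv b => ?_⟩
    · obtain rfl := (hX' v).1 hv
      change some 0 = some b ↔ b < 1 ∧ {y} = _
      have : {w | w ∈ ({v, y} : Set V) ∧ G.Adj v w} = {y} := by
        ext w
        constructor
        · rintro ⟨rfl | rfl, h⟩
          · exact absurd h (G.loopless.irrefl _)
          · rfl
        · rintro rfl
          exact ⟨Or.inr rfl, hxy⟩
      rw [this]
      simp [eq_comm]
    · obtain rfl := (hY' v).1 hv
      change some 0 = some b ↔ b < 1 ∧ {x} = _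
      have : {w | w ∈ ({x, v} : Set V) ∧ G.Adj v w} = {x} := by
        ext w
        constructor
        · rintro ⟨rfl | rfl, h⟩
          · rfl
          · exact absurd h (G.loopless.irrefl _)
        · rintro rfl
          exact ⟨Or.inl rfl, hxy.symm⟩
      rw [this]
      simp [eq_comm]
  · exact fun _ _ _ => List.nodup_nil
  · intro t b hb c
    refine ⟨fun h => by simp [Model.edge] at h, fun ⟨hc, h⟩ => ?_⟩
    rw [hb0 hb, hb0 hc] at h
    exact absurd rfl h.1.ne
  · intro t v _ w h
    simp [Model.edge] at h
  · exact fun v _ => .root rfl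
  · exact fun v hv => hv
  · exact fun v hv => hv
  · exact fun v _ => rfl
  · exact fun v _ => rfl
  · exact (forall_side true).2 ⟨fun _ _ => Or.inl rfl, fun _ _ => Or.inr rfl⟩
  · refine (forall_side true).2 ⟨fun b _ => ⟨[x], .base, by simp, fun v => by simp [Model.edge]⟩,
      fun b _ => ⟨[y], .base, by simp, fun v => by simp [Model.edge]⟩⟩

/-- The addition of a pending vertex at `u` starts from the introducer of `u`; a neighbor of `u`
guarantees it. -/
theorem Model.Valid.exists_intro (hX : G.IsBipartiteWith X Xᶜ) {M : Model V}
    (hM : M.Valid G X S) {t : Bool} {u w : V} (hu : u ∈ shore X t ∩ S) (hw : w ∈ S)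
    (huw : G.Adj u w) : ∃ c, M.intro u = some c := by
  obtain ⟨c, hc, -, hc'⟩ := hM.concepts.complete t _ _ (isConcept_neighbors
    (P := shore X t ∩ S) (Q := shore X (!t) ∩ S) hu ⟨w, ⟨mem_shore_of_adj hX huw hu.1, hw⟩, huw⟩)
  refine ⟨c, (hM.intro_eq t u hu c).2 ⟨hc, hc'.trans ?_⟩⟩
  ext z
  constructor
  · rintro ⟨h, h'⟩
    exact ⟨h.2, h'⟩
  · rintro ⟨h, h'⟩
    exact ⟨⟨mem_shore_of_adj hX h' hu.1, h⟩, h'⟩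

/-- This is how the program distinguishes the two cases of `PendIndex` in constant time. -/
theorem Model.Valid.first_eq_last_iff {M : Model V} (hM : M.Valid G X S) {t : Bool} {u : V}
    {c : ℕ} (hu : u ∈ shore X t ∩ S) (hc : M.intro u = some c) :
    M.cellVal (M.firstCell t c) = M.last t c ↔ M.sets t c = {u} := by
  obtain ⟨hc, hAc⟩ := (hM.intro_eq t u hu c).1 hc
  obtain ⟨l, h1, h2, h3⟩ := hM.seg t c hc
  have huc : u ∈ M.sets t c := by
    refine ((hM.concepts.concept t c hc).mem_left u).2 ⟨hu, fun y hy => ?_⟩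
    rw [hAc] at hy
    exact hy.2
  constructor
  · intro h
    have hl := (h1.eq_singleton_iff h2).1 h
    have hmem : ∀ z, z ∈ M.sets t c ↔ z = M.cellVal (M.firstCell t c) := fun z => by
      rw [← h3, hl, List.mem_singleton]
    ext z
    rw [hmem, (hmem u).1 huc]
    rfl
  · intro h
    have ha := (h3 _).1 h1.last_mem
    have hb := (h3 _).1 h1.head_mem
    rw [h] at ha hb
    exact (show _ = u from ha).trans (show _ = u from hb).symm

end

/-! ## From the model to the representation -/

section

variable {n : ℕ} {G : SimpleGraph (Fin n)} {X : Set (Fin n)} {M : Model (Fin n)}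

theorem Model.Valid.isConcept_true (hM : M.Valid G X Set.univ) {b : ℕ} (hb : b < M.size) :
    IsConcept G X Xᶜ (M.sets true b) (M.sets false b) := by
  simpa [shore] using hM.concepts.concept true b hb

theorem Model.Valid.bijective (hM : M.Valid G X Set.univ) :
    Function.Bijective fun b : Fin M.size => MaxBiclique.ofConcept (hM.isConcept_true b.2) := by
  constructor
  · intro b c h
    exact Fin.ext (hM.concepts.inj true b b.2 c c.2 (congrArg MaxBiclique.shoreX h))
  · intro B
    obtain ⟨b, hb, h, -⟩ := hM.concepts.complete true B.shoreX B.shoreY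
      (by simpa [shore] using B.isConcept)
    exact ⟨⟨b, hb⟩, MaxBiclique.ext_shoreX h⟩

theorem Model.Valid.cov_iff (hM : M.Valid G X Set.univ) (b c : Fin M.size) :
    Cov M.size M.sets true b c ↔
      MaxBiclique.ofConcept (hM.isConcept_true b.2) ⋖
        MaxBiclique.ofConcept (hM.isConcept_true c.2) := by
  constructor
  · rintro ⟨h, h'⟩
    refine ⟨h, fun D => ?_⟩
    obtain ⟨d, rfl⟩ := hM.bijective.2 D
    exact h' d d.2
  · rintro ⟨h, h'⟩
    refine ⟨h, fun d hd => ?_⟩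
    exact @h' (.ofConcept (hM.isConcept_true hd))

theorem Model.Valid.nb_lt (hM : M.Valid G X Set.univ) (t : Bool) (b : Fin M.size) :
    ∀ c ∈ M.nb t b, c < M.size := fun c hc => ((hM.mem_nb t b b.2 c).1 hc).1

theorem Model.Valid.intro_lt (hM : M.Valid G X Set.univ) (v : Fin n) :
    ∀ b ∈ M.intro v, b < M.size := by
  intro b hb
  by_cases h : v ∈ shore X true
  · exact ((hM.intro_eq true v ⟨h, trivial⟩ b).1 hb).1
  · exact ((hM.intro_eq false v ⟨h, trivial⟩ b).1 hb).1

theorem Model.Valid.isArborescence (hM : M.Valid G X Set.univ) (t : Bool) :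
    IsArborescence (arcTree (shore X t) M.parent) (insert none (some '' shore X t)) none :=
  isArborescence_arcTree (fun v _ => hM.rooted v trivial)
    fun v hv w h => (hM.parent_mem t v ⟨hv, trivial⟩ w h).1

theorem Model.Valid.isIntervalOf (hM : M.Valid G X Set.univ) (t : Bool) {b : ℕ}
    (hb : b < M.size) : IsIntervalOf (shore X t) M.parent (M.cellVal (M.firstCell t b))
      (M.last t b) (M.sets t b) := by
  obtain ⟨l, h1, -, h3⟩ := hM.seg t b hb
  have := h1.isIntervalOf (S := shore X t) fun v hv => (hM.concepts.subset hb ((h3 v).1 hv)).1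
  rwa [show {v | v ∈ l} = M.sets t b from Set.ext h3] at this

theorem Model.Valid.isIntroducer_iff (hX : G.IsBipartiteWith X Xᶜ) (hM : M.Valid G X Set.univ)
    (v : Fin n) (b : Fin M.size) : M.intro v = some b.val ↔
      IsIntroducer v (MaxBiclique.ofConcept (hM.isConcept_true b.2)) := by
  by_cases h : v ∈ X
  · rw [isIntroducer_iff_of_mem h, hM.intro_eq true v ⟨h, trivial⟩, and_iff_right b.2]
    change M.sets false b = _ ↔ M.sets false b = _
    have : {w | w ∈ Set.univ ∧ G.Adj v w} = {y | y ∈ Xᶜ ∧ G.Adj v y} := by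
      ext w
      exact ⟨fun hw => ⟨hX.mem_of_mem_adj h hw.2, hw.2⟩, fun hw => ⟨trivial, hw.2⟩⟩
    rw [this]
  · rw [isIntroducer_iff_of_notMem h, hM.intro_eq false v ⟨h, trivial⟩, and_iff_right b.2]
    change M.sets true b = _ ↔ M.sets true b = _
    have : {w | w ∈ Set.univ ∧ G.Adj v w} = {y | y ∈ X ∧ G.Adj v y} := by
      ext w
      exact ⟨fun hw => ⟨hX.symm.mem_of_mem_adj h hw.2, hw.2⟩, fun hw => ⟨trivial, hw.2⟩⟩
    rw [this]

theorem mem_pmap_mk {m : ℕ} {l : List ℕ} (h : ∀ c ∈ l, c < m) (c : Fin m) :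
    c ∈ l.pmap Fin.mk h ↔ c.val ∈ l := by
  rw [List.mem_pmap]
  exact ⟨fun ⟨a, ha, e⟩ => e ▸ ha, fun hc => ⟨c, hc, rfl⟩⟩

/-- The representation described by a model of the whole graph. -/
noncomputable def Model.Valid.toRep (hX : G.IsBipartiteWith X Xᶜ) (hM : M.Valid G X Set.univ) :
    ImplicitRep G X where
  parent := M.parent
  treeX := hM.isArborescence true
  treeY := hM.isArborescence false
  size := M.size
  biclique := Equiv.ofBijective _ hM.bijective
  firstX b := M.cellVal (M.firstCell true b)
  lastX b := M.last true b
  firstY b := M.cellVal (M.firstCell false b)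
  lastY b := M.last false b
  intervalX b := hM.isIntervalOf true b.2
  intervalY b := hM.isIntervalOf false b.2
  upper b := (M.nb true b).pmap Fin.mk (hM.nb_lt true b)
  upper_nodup b := (hM.nb_nodup true b b.2).pmap fun _ _ _ _ h => congrArg Fin.val h
  mem_upper b c := by
    rw [mem_pmap_mk, hM.mem_nb true b b.2, and_iff_right c.2, hM.cov_iff]
    rfl
  lower b := (M.nb false b).pmap Fin.mk (hM.nb_lt false b)
  lower_nodup b := (hM.nb_nodup false b b.2).pmap fun _ _ _ _ h => congrArg Fin.val h
  mem_lower b c := by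
    rw [mem_pmap_mk, hM.mem_nb false b b.2, and_iff_right c.2]
    exact (hM.concepts.cov_not true b.2 c.2).trans (hM.cov_iff c b)
  introducer v := (M.intro v).pmap Fin.mk (hM.intro_lt v)
  introducer_eq v b := by
    change _ ↔ IsIntroducer v (MaxBiclique.ofConcept (hM.isConcept_true b.2))
    rw [← hM.isIntroducer_iff hX, Option.pmap_eq_some_iff]
    constructor
    · rintro ⟨a, h, e, rfl⟩
      exact e
    · intro h
      exact ⟨b, b.2, h, rfl⟩

end

/-! ## Initial segments of a reverse pruning sequence -/

/-- The first `i` vertices. -/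
def VertexSequence.initial {n : ℕ} (s : VertexSequence n) (i : ℕ) : Set (Fin n) :=
  {w | ∃ j : Fin n, j.val < i ∧ s.vert j = w}

section

variable {n : ℕ} {G : SimpleGraph (Fin n)} {s : VertexSequence n}

theorem VertexSequence.initial_succ (i : Fin n) :
    s.initial (i + 1) = insert (s.vert i) (s.initial i) := by
  ext w
  constructor
  · rintro ⟨j, hj, rfl⟩
    rcases Nat.lt_succ_iff_lt_or_eq.1 hj with h | h
    · exact Or.inr ⟨j, h, rfl⟩
    · exact Or.inl (congrArg s.vert (Fin.ext h))
  · rintro (rfl | ⟨j, hj, rfl⟩)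
    · exact ⟨i, by simp, rfl⟩
    · exact ⟨j, by omega, rfl⟩

theorem IsReversePruning.initial_eq_univ (h : IsReversePruning G s) : s.initial n = Set.univ := by
  ext w
  obtain ⟨j, rfl⟩ := h.1.2 w
  exact ⟨fun _ => trivial, fun _ => ⟨j, j.2, rfl⟩⟩

theorem IsReversePruning.vert_notMem (h : IsReversePruning G s) (i : Fin n) :
    s.vert i ∉ s.initial i := by
  rintro ⟨j, hj, e⟩
  rw [h.1.1 e] at hj
  exact lt_irrefl _ hj

theorem IsReversePruning.ref_mem (h : IsReversePruning G s) {i : Fin n} (hi : 0 < i.val) :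
    s.ref i ∈ s.initial i := (h.2 i hi).1

theorem IsReversePruning.adj_of_pending (h : IsReversePruning G s) {i : Fin n} (hi : 0 < i.val)
    (hk : s.kind i = .pending) : ∀ w ∈ s.initial i, G.Adj (s.vert i) w ↔ w = s.ref i := by
  have h' := (h.2 i hi).2
  rw [hk] at h'
  rintro w ⟨j, hj, rfl⟩
  constructor
  · intro ha
    have : s.vert j ∈ s.nbhd G i (s.vert i) := ⟨ha, j, Fin.le_def.2 hj.le, rfl⟩
    rwa [h'] at this
  · intro e
    have : s.vert j ∈ s.nbhd G i (s.vert i) := by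
      rw [h', e]; rfl
    exact this.1

theorem IsReversePruning.adj_of_twin (h : IsReversePruning G s) {i : Fin n} (hi : 0 < i.val)
    (hk : s.kind i = .twin) : ∀ w ∈ s.initial i, G.Adj (s.vert i) w ↔ G.Adj (s.ref i) w := by
  have h' := (h.2 i hi).2
  rw [hk] at h'
  rintro w ⟨j, hj, rfl⟩
  have := Set.ext_iff.1 h'.1 (s.vert j)
  constructor
  · exact fun ha => (this.1 ⟨ha, j, Fin.le_def.2 hj.le, rfl⟩).1
  · exact fun ha => (this.2 ⟨ha, j, Fin.le_def.2 hj.le, rfl⟩).1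

theorem IsReversePruning.ref_one (h : IsReversePruning G s) {i₀ i₁ : Fin n} (h0 : i₀.val = 0)
    (h1 : i₁.val = 1) : s.ref i₁ = s.vert i₀ := by
  obtain ⟨j, hj, e⟩ := h.ref_mem (i := i₁) (by omega)
  rw [← e]
  congr 1
  exact Fin.ext (by omega)

theorem VertexSequence.initial_two {i₀ i₁ : Fin n} (h0 : i₀.val = 0) (h1 : i₁.val = 1) :
    s.initial 2 = {s.vert i₀, s.vert i₁} := by
  ext w
  constructor
  · rintro ⟨j, hj, rfl⟩
    have : j.val = 0 ∨ j.val = 1 := by omega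
    rcases this with h | h
    · exact Or.inl (congrArg s.vert (Fin.ext (by omega)))
    · exact Or.inr (congrArg s.vert (Fin.ext (by omega)))
  · rintro (rfl | rfl)
    · exact ⟨i₀, by omega, rfl⟩
    · exact ⟨i₁, by omega, rfl⟩

theorem VertexSequence.initial_one {i₀ : Fin n} (h0 : i₀.val = 0) :
    s.initial 1 = {s.vert i₀} := by
  ext w
  constructor
  · rintro ⟨j, hj, rfl⟩
    exact congrArg s.vert (Fin.ext (by omega))
  · rintro rfl
    exact ⟨i₀, by omega, rfl⟩

/-- The second vertex of a reverse pruning sequence of a connected graph is pending: otherwise it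
would never be connected to the first one. -/
theorem IsReversePruning.kind_one (h : IsReversePruning G s) (hG : G.Connected) {i₁ : Fin n}
    (h1 : i₁.val = 1) : s.kind i₁ = .pending := by
  cases hk : s.kind i₁ with
  | pending => rfl
  | twin =>
    exfalso
    let i₀ : Fin n := ⟨0, by omega⟩
    have href := h.ref_one (i₀ := i₀) rfl h1
    have hnadj : ¬ G.Adj (s.vert i₀) (s.vert i₁) := by
      intro ha
      have h' := (h.2 i₁ (by omega)).2
      rw [hk, href] at h'
      exact h'.2 ⟨ha, i₁, le_rfl, rfl⟩
    have hne : s.vert i₁ ≠ s.vert i₀ := fun e => by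
      have := congrArg Fin.val (h.1.1 e)
      simp [i₀, h1] at this
    -- `C` separates the first two vertices and no edge crosses it: each later vertex joins the side
    -- of the vertex it refers to.
    have key : ∀ i, 2 ≤ i → i ≤ n → ∃ C : Set (Fin n), s.vert i₀ ∈ C ∧ s.vert i₁ ∉ C ∧
        ∀ a ∈ s.initial i, ∀ b ∈ s.initial i, G.Adj a b → (a ∈ C ↔ b ∈ C) := by
      intro i hi
      induction i, hi using Nat.le_induction with
      | base =>
        intro _
        refine ⟨{s.vert i₀}, rfl, hne, ?_⟩
        rw [VertexSequence.initial_two (i₀ := i₀) rfl h1]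
        rintro a (rfl | rfl) b (rfl | rfl) hab
        · rfl
        · exact absurd hab hnadj
        · exact absurd hab.symm hnadj
        · rfl
      | succ i hi ih =>
        intro hin
        obtain ⟨C, hC0, hC1, hC⟩ := ih (by omega)
        let j : Fin n := ⟨i, hin⟩
        have hj : 0 < j.val := by change 0 < i; omega
        have hvj : s.vert j ∉ s.initial i := h.vert_notMem j
        have hrj : s.ref j ∈ s.initial i := h.ref_mem hj
        have hmem : ∀ k : Fin n, k.val < i → s.vert k ≠ s.vert j := fun k hk e =>
          hvj ⟨k, hk, e⟩
        have hstep : ∀ b ∈ s.initial i, G.Adj (s.vert j) b → (s.ref j ∈ C ↔ b ∈ C) := by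
          intro b hb hab
          cases hkj : s.kind j with
          | pending => rw [(h.adj_of_pending hj hkj b hb).1 hab]
          | twin => exact hC _ hrj b hb ((h.adj_of_twin hj hkj b hb).1 hab)
        have hne' : ∀ b ∈ s.initial i, b ≠ s.vert j := by
          rintro b hb rfl
          exact hvj hb
        refine ⟨{w | w = s.vert j ∧ s.ref j ∈ C ∨ w ≠ s.vert j ∧ w ∈ C},
          Or.inr ⟨hmem i₀ (by change 0 < i; omega), hC0⟩, ?_, ?_⟩
        · rintro (⟨e, -⟩ | ⟨-, e⟩)
          · exact hmem i₁ (by omega) e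
          · exact hC1 e
        · change ∀ a ∈ s.initial (j.val + 1), ∀ b ∈ s.initial (j.val + 1), _
          rw [VertexSequence.initial_succ j]
          rintro a (rfl | ha) b (rfl | hb) hab
          · rfl
          · have := hstep b hb hab
            have := hne' b hb
            simp_all
          · have := hstep a ha hab.symm
            have := hne' a ha
            simp_all
          · have := hC a ha b hb hab
            have := hne' a ha
            have := hne' b hb
            simp_all
    obtain ⟨C, hC0, hC1, hC⟩ := key n (by omega) le_rfl
    rw [h.initial_eq_univ] at hC
    have hall : ∀ a b, G.Walk a b → (a ∈ C ↔ b ∈ C) := by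
      intro a b w
      induction w with
      | nil => rfl
      | cons hab _ ih => exact (hC _ trivial _ trivial hab).trans ih
    obtain ⟨w⟩ := hG.preconnected (s.vert i₀) (s.vert i₁)
    exact hC1 ((hall _ _ w).1 hC0)

theorem IsReversePruning.adj_one (h : IsReversePruning G s) (hG : G.Connected) {i₀ i₁ : Fin n}
    (h0 : i₀.val = 0) (h1 : i₁.val = 1) : G.Adj (s.vert i₀) (s.vert i₁) := by
  refine ((h.adj_of_pending (i := i₁) (by omega) (h.kind_one hG h1) _ ?_).2
    (h.ref_one h0 h1).symm).symm
  exact ⟨i₀, by omega, rfl⟩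

/-- The first two vertices are adjacent; afterwards a pending vertex has its reference as a
neighbor, and a twin inherits a neighbor from its reference. -/
theorem IsReversePruning.exists_adj (h : IsReversePruning G s) (hG : G.Connected) {i : ℕ}
    (hi : 2 ≤ i) (hin : i ≤ n) : ∀ u ∈ s.initial i, ∃ w ∈ s.initial i, G.Adj u w := by
  induction i, hi using Nat.le_induction with
  | base =>
    have hadj := h.adj_one hG (i₀ := ⟨0, by omega⟩) (i₁ := ⟨1, by omega⟩) rfl rfl
    rw [VertexSequence.initial_two (i₀ := ⟨0, by omega⟩) (i₁ := ⟨1, by omega⟩) rfl rfl]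
    rintro u (rfl | rfl)
    · exact ⟨_, Or.inr rfl, hadj⟩
    · exact ⟨_, Or.inl rfl, hadj.symm⟩
  | succ i hi ih =>
    have ih := ih (by omega)
    let j : Fin n := ⟨i, hin⟩
    have hj : 0 < j.val := by change 0 < i; omega
    have hrj : s.ref j ∈ s.initial i := h.ref_mem hj
    change ∀ u ∈ s.initial (j.val + 1), ∃ w ∈ s.initial (j.val + 1), _
    rw [VertexSequence.initial_succ j]
    rintro u (rfl | hu)
    · cases hkj : s.kind j with
      | pending => exact ⟨_, Or.inr hrj, (h.adj_of_pending hj hkj _ hrj).2 rfl⟩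
      | twin =>
        obtain ⟨w, hw, hadj⟩ := ih _ hrj
        exact ⟨w, Or.inr hw, (h.adj_of_twin hj hkj w hw).2 hadj⟩
    · obtain ⟨w, hw, hadj⟩ := ih u hu
      exact ⟨w, Or.inr hw, hadj⟩

end

/-! ## The program that builds the representation -/

abbrev aCellOf : ℕ := 19
abbrev aCellVal : ℕ := 20

/-- The arrays of the two shores. -/
def aFirst : Bool → ℕ
  | true => aFirstX
  | false => aFirstY

def aLast : Bool → ℕ
  | true => aLastX
  | false => aLastY

def aHead : Bool → ℕ
  | true => aUpperHead
  | false => aLowerHead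

def aNext : Bool → ℕ
  | true => aUpperNext
  | false => aLowerNext

def aItem : Bool → ℕ
  | true => aUpperItem
  | false => aLowerItem

/-- Code of a shore. -/
def sideCode : Bool → ℕ
  | true => 0
  | false => 1

/-- Code of an optional number. -/
def natCode : Option ℕ → ℕ
  | none => 0
  | some b => b + 1

/-! Register `0` holds `n`, register `1` the number of vertices treated, register `2` the number of
maximal bicliques, registers `3` and `4` the constants `1` and `0`, register `5` the new vertex,
register `7` the vertex it refers to and register `8` the shore of the latter. -/

/-- The last five instructions exchange cells: the old cell of `u` passes to `v`, and `u` gets the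
fresh cell with address `v`. -/
def twinProg : Prog :=
  .block [.store aSide 5 8, .load 9 aParent 7, .store aParent 5 9, .add 9 5 3,
    .store aParent 7 9, .load 9 aIntroducer 7, .store aIntroducer 5 9, .load 9 aCellOf 7,
    .store aCellOf 5 9, .store aCellVal 9 5, .store aCellOf 7 5, .store aCellVal 5 7]

/-- Attach the new vertex to the end of the path of its neighborhood, and load the ends of the other
path of the introducer. -/
def pendHead (t : Bool) : Prog :=
  .block [.load 9 aIntroducer 7, .sub 9 9 3, .load 11 (aLast (!t)) 9, .add 12 11 3,
    .store aParent 5 12, .load 11 (aFirst t) 9, .load 11 aCellVal 11, .load 12 (aLast t) 9]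

/-- Create a maximal biclique and the cells for its cover pair. -/
def addEdge (t : Bool) : Prog :=
  .block [.move 10 2, .add 2 2 3, .store (aItem t) 10 9, .store (aNext t) 10 4,
    .store (aHead t) 10 10, .store (aItem (!t)) 10 10, .load 11 (aHead (!t)) 9,
    .store (aNext (!t)) 10 11, .store (aHead (!t)) 9 10, .store (aHead (!t)) 10 4]

/-- The new vertex lies opposite its neighbor, so its shore code is 1 (register `3`) or 0 (register
`4`) according to `t`. If the introducer is reused, the first cell copied from it is simply written
back. -/
def pendTail (t : Bool) : Prog :=
  .block [.load 11 aCellOf 7, .store (aFirst t) 10 11, .store (aLast t) 10 7,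
    .load 11 (aFirst (!t)) 9, .store (aFirst (!t)) 10 11, .store (aLast (!t)) 10 5,
    .store aSide 5 (if t then 3 else 4), .add 12 10 3, .store aIntroducer 7 12,
    .store aIntroducer 5 12, .store aCellOf 5 5, .store aCellVal 5 5]

def pendProg (t : Bool) : Prog :=
  .block [pendHead t, .ite (.eq 11 12) (.move 10 9) (addEdge t), pendTail t]

def buildBody : Prog :=
  .block [.load 5 inVert 1, .load 6 inKind 1, .load 7 inRef 1, .load 8 aSide 7,
    .ite (.eq 6 4) (.ite (.eq 8 4) (pendProg true) (pendProg false)) twinProg, .add 1 1 3]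

def initOne : Prog :=
  .block [.const 3 1, .const 4 0, .const 2 0, .load 5 inVert 4, .store aSide 5 4,
    .store aParent 5 4, .store aIntroducer 5 4, .store aCellOf 5 5, .store aCellVal 5 5]

def initTwo : Prog :=
  .block [.load 6 inVert 3, .store aSide 6 3, .store aParent 6 4, .store aIntroducer 5 3,
    .store aIntroducer 6 3, .store aCellOf 6 6, .store aCellVal 6 6, .const 2 1,
    .store aFirstX 4 5, .store aLastX 4 5, .store aFirstY 4 6, .store aLastY 4 6,
    .store aUpperHead 4 4, .store aLowerHead 4 4, .const 1 2]

/-- Cells are resolved into first arcs only here, when no later twin can change their contents. -/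
def finishBody : Prog :=
  .block [.load 6 aFirstX 5, .load 6 aCellVal 6, .store aFirstX 5 6,
    .load 6 aFirstY 5, .load 6 aCellVal 6, .store aFirstY 5 6, .add 5 5 3]

def build : Prog :=
  .block [initOne,
    .ite (.lt 3 0) (.block [initTwo, .while (.lt 1 0) buildBody]) .skip,
    .store aSize 4 2, .const 5 0, .while (.lt 5 2) finishBody]

/-! ### Effect and cost of the straight-line program pieces -/

theorem wp_twinProg {M v u : ℕ} {σ : State} (h5 : σ.reg 5 = v) (h7 : σ.reg 7 = u)
    (h3 : σ.reg 3 = 1) (hv : v + 1 ≤ M) (hu : u ≤ M) (h8 : σ.reg 8 ≤ M)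
    (hp : σ.arr aParent u ≤ M) (hi : σ.arr aIntroducer u ≤ M) (hc : σ.arr aCellOf u ≤ M) :
    twinProg.wp M (fun σ' t => t ≤ 20 ∧
      σ'.arr aSide = Function.update (σ.arr aSide) v (σ.reg 8) ∧
      σ'.arr aParent = Function.update (Function.update (σ.arr aParent) v (σ.arr aParent u)) u
        (v + 1) ∧
      σ'.arr aIntroducer = Function.update (σ.arr aIntroducer) v (σ.arr aIntroducer u) ∧
      σ'.arr aCellOf = Function.update (Function.update (σ.arr aCellOf) v (σ.arr aCellOf u)) u v ∧
      σ'.arr aCellVal =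
        Function.update (Function.update (σ.arr aCellVal) (σ.arr aCellOf u) v) v u ∧
      (∀ a, a ≠ aSide → a ≠ aParent → a ≠ aIntroducer → a ≠ aCellOf → a ≠ aCellVal →
        σ'.arr a = σ.arr a) ∧
      ∀ r, r < 5 → σ'.reg r = σ.reg r) σ := by
  simp [twinProg, Prog.block, Prog.wp, h5, h7, h3]
  and_intros
  any_goals omega
  all_goals
    intros
    split_ifs <;> first | omega | rfl

theorem wp_pendHead {M v u c : ℕ} (t : Bool) {σ : State} (h5 : σ.reg 5 = v) (h7 : σ.reg 7 = u)
    (h3 : σ.reg 3 = 1) (hv : v ≤ M) (hu : u ≤ M) (hi : σ.arr aIntroducer u = c + 1)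
    (hc : c + 1 ≤ M) (hl' : σ.arr (aLast (!t)) c + 1 ≤ M) (hf : σ.arr (aFirst t) c ≤ M)
    (hl : σ.arr (aLast t) c ≤ M) (hcv : σ.arr aCellVal (σ.arr (aFirst t) c) ≤ M) :
    (pendHead t).wp M (fun σ' T => T ≤ 10 ∧
      σ'.arr aParent = Function.update (σ.arr aParent) v (σ.arr (aLast (!t)) c + 1) ∧
      (∀ a, a ≠ aParent → σ'.arr a = σ.arr a) ∧ σ'.reg 9 = c ∧
      σ'.reg 11 = σ.arr aCellVal (σ.arr (aFirst t) c) ∧ σ'.reg 12 = σ.arr (aLast t) c ∧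
      ∀ r, r < 9 → σ'.reg r = σ.reg r) σ := by
  cases t <;>
  · simp only [aFirst, aLast, Bool.not_true, Bool.not_false] at *
    simp [pendHead, Prog.block, Prog.wp, h5, h7, h3, hi, aFirst, aLast]
    and_intros
    any_goals omega
    all_goals
      intros
      split_ifs <;> omega

theorem wp_addEdge {M b c : ℕ} (t : Bool) {σ : State} (h2 : σ.reg 2 = b) (h3 : σ.reg 3 = 1)
    (h4 : σ.reg 4 = 0) (h9 : σ.reg 9 = c) (hb : b + 1 ≤ M) (hc : c ≤ M)
    (hh : σ.arr (aHead (!t)) c ≤ M) :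
    (addEdge t).wp M (fun σ' T => T ≤ 10 ∧
      σ'.arr (aItem t) = Function.update (σ.arr (aItem t)) b c ∧
      σ'.arr (aNext t) = Function.update (σ.arr (aNext t)) b 0 ∧
      σ'.arr (aHead t) = Function.update (σ.arr (aHead t)) b b ∧
      σ'.arr (aItem (!t)) = Function.update (σ.arr (aItem (!t))) b b ∧
      σ'.arr (aNext (!t)) = Function.update (σ.arr (aNext (!t))) b (σ.arr (aHead (!t)) c) ∧
      σ'.arr (aHead (!t)) = Function.update (Function.update (σ.arr (aHead (!t))) c b) b 0 ∧
      (∀ a, a < aUpperHead ∨ aLowerItem < a → σ'.arr a = σ.arr a) ∧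
      σ'.reg 10 = b ∧ σ'.reg 2 = b + 1 ∧
      ∀ r, r < 10 → r ≠ 2 → σ'.reg r = σ.reg r) σ := by
  cases t <;>
  · simp only [aHead, Bool.not_true, Bool.not_false] at *
    simp [addEdge, Prog.block, Prog.wp, h2, h3, h4, h9, aHead, aNext, aItem]
    and_intros
    any_goals omega
    all_goals
      intros
      simp only [aUpperHead, aUpperNext, aUpperItem, aLowerHead, aLowerNext, aLowerItem] at *
      split_ifs <;> first | omega | rfl

theorem wp_pendTail {M v u b c : ℕ} (t : Bool) {σ : State} (h5 : σ.reg 5 = v) (h7 : σ.reg 7 = u)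
    (h3 : σ.reg 3 = 1) (h4 : σ.reg 4 = 0) (h9 : σ.reg 9 = c) (h10 : σ.reg 10 = b)
    (hv : v ≤ M) (hu : u ≤ M) (hb : b + 1 ≤ M) (hc : c ≤ M) (hco : σ.arr aCellOf u ≤ M)
    (hf : σ.arr (aFirst (!t)) c ≤ M) :
    (pendTail t).wp M (fun σ' T => T ≤ 20 ∧
      σ'.arr aSide = Function.update (σ.arr aSide) v (sideCode (!t)) ∧
      σ'.arr aIntroducer =
        Function.update (Function.update (σ.arr aIntroducer) u (b + 1)) v (b + 1) ∧
      σ'.arr aCellOf = Function.update (σ.arr aCellOf) v v ∧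
      σ'.arr aCellVal = Function.update (σ.arr aCellVal) v v ∧
      σ'.arr (aFirst t) = Function.update (σ.arr (aFirst t)) b (σ.arr aCellOf u) ∧
      σ'.arr (aFirst (!t)) = Function.update (σ.arr (aFirst (!t))) b (σ.arr (aFirst (!t)) c) ∧
      σ'.arr (aLast t) = Function.update (σ.arr (aLast t)) b u ∧
      σ'.arr (aLast (!t)) = Function.update (σ.arr (aLast (!t))) b v ∧
      (∀ a, a < aSide ∨ a = aParent ∨ aUpperHead ≤ a ∧ a ≤ aLowerItem → σ'.arr a = σ.arr a) ∧
      ∀ r, r < 5 → σ'.reg r = σ.reg r) σ := by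
  cases t <;>
  · simp only [aFirst, Bool.not_true, Bool.not_false] at *
    simp [pendTail, Prog.block, Prog.wp, h5, h7, h3, h4, h9, h10, aFirst, aLast, sideCode]
    and_intros
    any_goals omega
    all_goals
      intros
      simp only [aSide, aParent, aFirstX, aFirstY, aLastX, aLastY, aIntroducer, aCellOf, aCellVal,
        aUpperHead, aLowerItem] at *
      split_ifs <;> first | omega | rfl

theorem optCode_le {m : ℕ} (o : Option (Fin m)) : optCode o ≤ m := by
  cases o with
  | none => exact Nat.zero_le _
  | some u => exact u.2

theorem HoldsList.le_bound {next item : ℕ → ℕ} {bound p : ℕ} {l : List ℕ}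
    (h : HoldsList next item bound p l) : p ≤ bound := by
  cases l with
  | nil => exact (show p = 0 from h) ▸ Nat.zero_le _
  | cons _ _ => exact h.2.1

theorem HoldsList.congr {next item next' item' : ℕ → ℕ} {bound bound' p : ℕ} {l : List ℕ}
    (h : HoldsList next item bound p l) (hb : bound ≤ bound')
    (heq : ∀ q ≤ bound, next' q = next q ∧ item' q = item q) :
    HoldsList next' item' bound' p l := by
  induction l generalizing p with
  | nil => exact h
  | cons x l ih =>
    obtain ⟨h1, h2, h3, h4⟩ := h
    exact ⟨h1, h2.trans hb, (heq p h2).2.trans h3, (heq p h2).1 ▸ ih h4⟩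

theorem HoldsInput.congr {n : ℕ} {s : VertexSequence n} {σ τ : State} (h : HoldsInput s σ)
    (hr : τ.reg 0 = σ.reg 0) (ha : ∀ a, a < aSide → τ.arr a = σ.arr a) : HoldsInput s τ where
  size := hr.trans h.size
  vert := by rw [ha inVert (by decide)]; exact h.vert
  kind := by rw [ha inKind (by decide)]; exact h.kind
  ref := by rw [ha inRef (by decide)]; exact h.ref

/-- The memory holds the sequence and, on the set `S` of vertices treated, the model `M`. -/
structure Holds {n : ℕ} (s : VertexSequence n) (X S : Set (Fin n)) (M : Model (Fin n))
    (σ : State) : Prop where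
  input : HoldsInput s σ
  one : σ.reg 3 = 1
  zero : σ.reg 4 = 0
  size : σ.reg 2 = M.size
  side : ∀ t, ∀ v ∈ shore X t ∩ S, σ.arr aSide v = sideCode t
  parent : ∀ v ∈ S, σ.arr aParent v = optCode (M.parent v)
  intro : ∀ v ∈ S, σ.arr aIntroducer v = natCode (M.intro v)
  cellOf : ∀ v ∈ S, σ.arr aCellOf v = M.cellOf v
  cellVal : ∀ v ∈ S, σ.arr aCellVal v = M.cellVal v
  first : ∀ t, ∀ b < M.size, σ.arr (aFirst t) b = M.firstCell t b
  last : ∀ t, ∀ b < M.size, σ.arr (aLast t) b = M.last t b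
  list : ∀ t, ∀ b < M.size, HoldsList (σ.arr (aNext t)) (σ.arr (aItem t)) (M.size - 1)
    (σ.arr (aHead t) b) (M.nb t b)

/-! ### The program pieces carry out the operations on models -/

section

variable {n B : ℕ} {s : VertexSequence n} {G : SimpleGraph (Fin n)} {X S : Set (Fin n)}
  {M : Model (Fin n)} {σ : State} {t : Bool} {u v : Fin n}

theorem Holds.twin (h : Holds s X S M σ) (hM : M.Valid G X S) (hB : n + 1 ≤ B)
    (hsize : M.size < n) (hu : u ∈ shore X t ∩ S) (hv : v ∉ S) (hvt : v ∈ shore X t)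
    (h5 : σ.reg 5 = v) (h7 : σ.reg 7 = u) (h8 : σ.reg 8 = sideCode t) :
    twinProg.wp B (fun σ' T => T ≤ 20 ∧ σ'.reg 1 = σ.reg 1 ∧
      Holds s X (insert v S) (M.twin t u v) σ') σ := by
  have hint : natCode (M.intro u) ≤ n := by
    cases hi : M.intro u with
    | none => exact Nat.zero_le _
    | some c =>
      have := ((hM.intro_eq t u hu c).1 hi).1
      simp only [natCode]
      omega
  refine Prog.wp_mono _ (wp_twinProg h5 h7 h.one (by omega) (by omega)
    (by rw [h8]; cases t <;> simp [sideCode]; omega)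
    (by rw [h.parent u hu.2]; exact (optCode_le _).trans (by omega))
    (by rw [h.intro u hu.2]; omega) (by rw [h.cellOf u hu.2]; omega)) ?_
  rintro σ' T ⟨hT, e_side, e_parent, e_intro, e_cellOf, e_cellVal, e_arr, e_reg⟩
  have e_first : ∀ t', σ'.arr (aFirst t') = σ.arr (aFirst t') := fun t' => by
    cases t' <;> exact e_arr _ (by decide) (by decide) (by decide) (by decide) (by decide)
  have e_last : ∀ t', σ'.arr (aLast t') = σ.arr (aLast t') := fun t' => by
    cases t' <;> exact e_arr _ (by decide) (by decide) (by decide) (by decide) (by decide)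
  have e_head : ∀ t', σ'.arr (aHead t') = σ.arr (aHead t') := fun t' => by
    cases t' <;> exact e_arr _ (by decide) (by decide) (by decide) (by decide) (by decide)
  have e_next : ∀ t', σ'.arr (aNext t') = σ.arr (aNext t') := fun t' => by
    cases t' <;> exact e_arr _ (by decide) (by decide) (by decide) (by decide) (by decide)
  have e_item : ∀ t', σ'.arr (aItem t') = σ.arr (aItem t') := fun t' => by
    cases t' <;> exact e_arr _ (by decide) (by decide) (by decide) (by decide) (by decide)
  refine ⟨hT, e_reg 1 (by decide), h.input.congr (e_reg 0 (by decide)) fun a ha =>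
    e_arr a ha.ne ?_ ?_ ?_ ?_, (e_reg 3 (by decide)).trans h.one,
    (e_reg 4 (by decide)).trans h.zero, (e_reg 2 (by decide)).trans h.size, ?_, ?_, ?_, ?_, ?_,
    ?_, ?_, ?_⟩
  iterate 4
    simp only [aSide, aParent, aIntroducer, aCellOf, aCellVal] at *
    omega
  · rintro t' w ⟨hwt, hw⟩
    simp only [e_side, h8, Function.update_apply, Fin.val_inj]
    split_ifs with hwv
    · subst hwv
      rcases Bool.eq_or_eq_not t' t with rfl | rfl
      · rfl
      · exact absurd hvt (mem_shore_not.1 hwt)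
    · exact h.side t' w ⟨hwt, hw.resolve_left hwv⟩
  · intro w hw
    simp only [e_parent, Model.twin, Function.update_apply, Fin.val_inj]
    split_ifs with h1 h2
    · rfl
    · exact h.parent u hu.2
    · exact h.parent w (hw.resolve_left h2)
  · intro w hw
    simp only [e_intro, Model.twin, Function.update_apply, Fin.val_inj]
    split_ifs with h1
    · exact h.intro u hu.2
    · exact h.intro w (hw.resolve_left h1)
  · intro w hw
    simp only [e_cellOf, Model.twin, Function.update_apply, Fin.val_inj]
    split_ifs with h1 h2
    · rfl
    · exact h.cellOf u hu.2
    · exact h.cellOf w (hw.resolve_left h2)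
  · intro w hw
    simp only [e_cellVal, Model.twin, Function.update_apply, Fin.val_inj, h.cellOf u hu.2]
    split_ifs with h1 h2
    · rfl
    · rfl
    · exact h.cellVal w (hw.resolve_left h1)
  · intro t' b hb
    rw [e_first]
    exact h.first t' b hb
  · intro t' b hb
    rw [e_last]
    exact h.last t' b hb
  · intro t' b hb
    rw [e_head, e_next, e_item]
    exact h.list t' b hb

/-- An additional biclique brings exactly one cover pair, hence one cell in each of the two pools of
list cells; its own number serves as the address of both. `tail` treats the part common to the two
cases. -/
theorem Holds.pend (h : Holds s X S M σ) (hM : M.Valid G X S) (hB : n + 1 ≤ B)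
    (hsize : M.size < n) (hu : u ∈ shore X t ∩ S) (hv : v ∉ S) (hvt : v ∈ shore X (!t))
    (h5 : σ.reg 5 = v) (h7 : σ.reg 7 = u) {c : ℕ} (hcu : M.intro u = some c) :
    (pendProg t).wp B (fun σ' T => T ≤ 60 ∧ σ'.reg 1 = σ.reg 1 ∧
      ∃ b₀ size', PendIndex M.sets t u M.size c b₀ size' ∧
        Holds s X (insert v S) (M.pend t u v c b₀ size') σ') σ := by
  have hcs := ((hM.intro_eq t u hu c).1 hcu).1
  have hfS := hM.firstCell_mem t c hcs
  have hf' := (M.firstCell (!t) c).2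
  have hl' := (M.last (!t) c).2
  have range_list : ∀ t', (aUpperHead ≤ aHead t' ∧ aHead t' ≤ aLowerItem) ∧
      (aUpperHead ≤ aNext t' ∧ aNext t' ≤ aLowerItem) ∧
      aUpperHead ≤ aItem t' ∧ aItem t' ≤ aLowerItem := fun t' => by cases t' <;> decide
  have range_fl : ∀ t', (aParent < aFirst t' ∧ aFirst t' < aUpperHead) ∧
      aParent < aLast t' ∧ aLast t' < aUpperHead := fun t' => by cases t' <;> decide
  simp only [pendProg, Prog.block, Prog.wp]
  refine Prog.wp_mono _ (wp_pendHead (c := c) t h5 h7 h.one (by omega) (by omega)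
    (by rw [h.intro u hu.2, hcu]; rfl) (by omega) (by rw [h.last _ c hcs]; omega)
    (by rw [h.first _ c hcs]; omega) (by rw [h.last _ c hcs]; omega)
    (by rw [h.first _ c hcs, h.cellVal _ hfS]; omega)) ?_
  rintro σ₁ T₁ ⟨hT₁, p_parent, p_arr, p9, p11, p12, p_reg⟩
  rw [h.first _ c hcs, h.cellVal _ hfS] at p11
  rw [h.last _ c hcs] at p12 p_parent
  have p2 := (p_reg 2 (by decide)).trans h.size
  have p3 := (p_reg 3 (by decide)).trans h.one
  have p4 := (p_reg 4 (by decide)).trans h.zero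
  have p5 := (p_reg 5 (by decide)).trans h5
  have p7 := (p_reg 7 (by decide)).trans h7
  -- The common end, from the state `σ₂` in which register `10` holds `b₀`.
  have tail : ∀ (σ₂ : State) (b₀ size' T₂ : ℕ), T₂ ≤ 20 →
      PendIndex M.sets t u M.size c b₀ size' →
      (∀ a, a < aUpperHead ∨ aLowerItem < a → σ₂.arr a = σ₁.arr a) →
      (∀ r, r < 10 → r ≠ 2 → σ₂.reg r = σ₁.reg r) → σ₂.reg 10 = b₀ → σ₂.reg 2 = size' →
      (∀ t', ∀ b < size', HoldsList (σ₂.arr (aNext t')) (σ₂.arr (aItem t')) (size' - 1)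
        (σ₂.arr (aHead t') b) ((M.pend t u v c b₀ size').nb t' b)) →
      (pendTail t).wp B (fun σ' T => T₁ + (T₂ + T) ≤ 50 ∧ σ'.reg 1 = σ.reg 1 ∧
        ∃ b₀ size', PendIndex M.sets t u M.size c b₀ size' ∧
          Holds s X (insert v S) (M.pend t u v c b₀ size') σ') σ₂ := by
    intro σ₂ b₀ size' T₂ hT₂ hi q_arr q_reg q10 q2 q_list
    have hb₀ := hi.lt hcs
    have hs' : size' ≤ M.size + 1 := by rcases hi with ⟨-, -, rfl⟩ | ⟨-, -, rfl⟩ <;> omega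
    have r_arr : ∀ a, a < aUpperHead ∨ aLowerItem < a → a ≠ aParent → σ₂.arr a = σ.arr a :=
      fun a ha ha' => (q_arr a ha).trans (p_arr a ha')
    have r_first : ∀ t', σ₂.arr (aFirst t') = σ.arr (aFirst t') := fun t' =>
      r_arr _ (Or.inl (range_fl t').1.2) (range_fl t').1.1.ne'
    have r_last : ∀ t', σ₂.arr (aLast t') = σ.arr (aLast t') := fun t' =>
      r_arr _ (Or.inl (range_fl t').2.2) (range_fl t').2.1.ne'
    have r_reg : ∀ r, r < 9 → r ≠ 2 → σ₂.reg r = σ.reg r := fun r hr hr' =>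
      (q_reg r (by omega) hr').trans (p_reg r hr)
    refine Prog.wp_mono _ (wp_pendTail (v := v) (u := u) (b := b₀) (c := c) t
      ((q_reg 5 (by decide) (by decide)).trans p5) ((q_reg 7 (by decide) (by decide)).trans p7)
      ((q_reg 3 (by decide) (by decide)).trans p3) ((q_reg 4 (by decide) (by decide)).trans p4)
      ((q_reg 9 (by decide) (by decide)).trans p9) q10 (by omega) (by omega) (by omega)
      (by omega) (by rw [r_arr aCellOf (by decide) (by decide), h.cellOf u hu.2]; omega)
      (by rw [r_first, h.first _ c hcs]; omega)) ?_
    rintro σ' T ⟨hT, e_side, e_intro, e_cellOf, e_cellVal, e_first, e_first', e_last, e_last',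
      e_arr, e_reg⟩
    rw [r_arr aSide (by decide) (by decide)] at e_side
    rw [r_arr aIntroducer (by decide) (by decide)] at e_intro
    rw [r_arr aCellOf (by decide) (by decide)] at e_cellOf
    rw [r_arr aCellVal (by decide) (by decide)] at e_cellVal
    rw [r_first, r_arr aCellOf (by decide) (by decide), h.cellOf u hu.2] at e_first
    rw [r_first, h.first _ c hcs] at e_first'
    rw [r_last] at e_last e_last'
    have hold : ∀ {b}, b < size' → b ≠ b₀ → b < M.size := fun hb h => hi.lt_of_ne hb h
    refine ⟨by omega, (e_reg 1 (by decide)).trans (r_reg 1 (by decide) (by decide)), b₀, size',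
      hi, h.input.congr ((e_reg 0 (by decide)).trans (r_reg 0 (by decide) (by decide)))
        fun a ha => (e_arr a (Or.inl ha)).trans (r_arr a (Or.inl (ha.trans (by decide)))
          (ha.trans (by decide)).ne),
      (e_reg 3 (by decide)).trans ((q_reg 3 (by decide) (by decide)).trans p3),
      (e_reg 4 (by decide)).trans ((q_reg 4 (by decide) (by decide)).trans p4),
      (e_reg 2 (by decide)).trans q2, ?_, ?_, ?_, ?_, ?_, ?_, ?_, ?_⟩
    · rintro t' w ⟨hwt, hw⟩
      simp only [e_side, Function.update_apply, Fin.val_inj]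
      split_ifs with hwv
      · subst hwv
        rcases Bool.eq_or_eq_not t' t with rfl | rfl
        · exact absurd hwt (mem_shore_not.1 hvt)
        · rfl
      · exact h.side t' w ⟨hwt, hw.resolve_left hwv⟩
    · intro w hw
      rw [e_arr aParent (by decide), q_arr aParent (by decide), p_parent]
      simp only [Model.pend, Function.update_apply, Fin.val_inj]
      split_ifs with h1
      · rfl
      · exact h.parent w (hw.resolve_left h1)
    · intro w hw
      simp only [e_intro, Model.pend, Function.update_apply, Fin.val_inj]
      split_ifs with h1 h2
      · rfl
      · rfl
      · exact h.intro w (hw.resolve_left h1)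
    · intro w hw
      simp only [e_cellOf, Model.pend, Function.update_apply, Fin.val_inj]
      split_ifs with h1
      · rfl
      · exact h.cellOf w (hw.resolve_left h1)
    · intro w hw
      simp only [e_cellVal, Model.pend, Function.update_apply, Fin.val_inj]
      split_ifs with h1
      · rfl
      · exact h.cellVal w (hw.resolve_left h1)
    · refine (forall_side t).2 ⟨fun b hb => ?_, fun b hb => ?_⟩
      · simp only [e_first, Model.pend, pick_self, Function.update_apply]
        split_ifs with h1
        · rfl
        · exact h.first t b (hold hb h1)
      · simp only [e_first', Model.pend, pick_not, Function.update_apply]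
        split_ifs with h1
        · rfl
        · exact h.first (!t) b (hold hb h1)
    · refine (forall_side t).2 ⟨fun b hb => ?_, fun b hb => ?_⟩
      · simp only [e_last, Model.pend, pick_self, Function.update_apply]
        split_ifs with h1
        · rfl
        · exact h.last t b (hold hb h1)
      · simp only [e_last', Model.pend, pick_not, Function.update_apply]
        split_ifs with h1
        · rfl
        · exact h.last (!t) b (hold hb h1)
    · intro t' b hb
      rw [e_arr _ (Or.inr (Or.inr (range_list t').1)),
        e_arr _ (Or.inr (Or.inr (range_list t').2.1)),
        e_arr _ (Or.inr (Or.inr (range_list t').2.2))]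
      exact q_list t' b hb
  have p_list : ∀ t', σ₁.arr (aHead t') = σ.arr (aHead t') ∧
      σ₁.arr (aNext t') = σ.arr (aNext t') ∧ σ₁.arr (aItem t') = σ.arr (aItem t') := fun t' => by
    cases t' <;> exact ⟨p_arr _ (by decide), p_arr _ (by decide), p_arr _ (by decide)⟩
  have hfl := hM.first_eq_last_iff hu hcu
  have hholds : Test.Holds (.eq 11 12) σ₁ ↔ M.sets t c = {u} := by
    rw [← hfl, ← Fin.val_inj, ← p11, ← p12]
    rfl
  refine ⟨fun hb => ⟨by omega, ?_⟩, fun hb => ?_⟩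
  · refine Prog.wp_mono _ (tail (σ₁.setReg 10 (σ₁.reg 9)) c M.size 2 (by omega)
      (Or.inl ⟨hholds.1 hb, rfl, rfl⟩) (fun _ _ => rfl) (fun r hr _ => ?_) (by simp [p9])
      (by simp [p2]) ?_) ?_
    · simp [hr.ne]
    · intro t' b hb
      have : (M.pend t u v c c M.size).nb = M.nb := by simp [Model.pend]
      simp only [State.arr_setReg]
      rw [(p_list t').1, (p_list t').2.1, (p_list t').2.2, this]
      exact h.list t' b hb
    · rintro σ' T ⟨hT, h'⟩
      exact ⟨by omega, h'⟩
  · have hhd := (h.list (!t) c hcs).le_bound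
    refine Prog.wp_mono _ (wp_addEdge (b := M.size) (c := c) t p2 p3 p4 p9 (by omega) (by omega)
      (by rw [(p_list _).1]; omega)) ?_
    rintro σ₂ T₂ ⟨hT₂, q_item, q_next, q_head, q_item', q_next', q_head', q_arr, q10, q2, q_reg⟩
    refine Prog.wp_mono _ (tail σ₂ M.size (M.size + 1) (1 + T₂) (by omega)
      (Or.inr ⟨fun e => hb (hholds.2 e), rfl, rfl⟩) q_arr q_reg q10 q2 ?_) ?_
    · rw [(p_list _).1] at q_head
      rw [(p_list _).2.1] at q_next
      rw [(p_list _).2.2] at q_item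
      rw [(p_list _).1] at q_head'
      rw [(p_list _).2.1, (p_list _).1] at q_next'
      rw [(p_list _).2.2] at q_item'
      -- The introducer `c` is an earlier biclique, so the new number is not the null reference.
      have hpos : 0 < M.size := by omega
      have hold : ∀ {b}, b < M.size + 1 → b ≠ M.size → b < M.size := fun _ _ => by omega
      have frame : ∀ t', (∀ q, q ≠ M.size → σ₂.arr (aNext t') q = σ.arr (aNext t') q ∧
          σ₂.arr (aItem t') q = σ.arr (aItem t') q) → ∀ b < M.size,
          HoldsList (σ₂.arr (aNext t')) (σ₂.arr (aItem t')) (M.size + 1 - 1)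
            (σ.arr (aHead t') b) (M.nb t' b) := by
        intro t' heq b hb
        refine (h.list t' b hb).congr (by omega) fun q hq => heq q (by omega)
      have frame_t := frame t fun q hq => by simp [q_next, q_item, hq]
      have frame_n := frame (!t) fun q hq => by simp [q_next', q_item', hq]
      refine (forall_side t).2 ⟨fun b hb => ?_, fun b hb => ?_⟩
      · by_cases hbb : b = M.size
        · have : (M.pend t u v c M.size (M.size + 1)).nb t b = [c] := by
            simp [Model.pend, hbb]
          rw [this, hbb]
          refine ⟨?_, ?_, ?_, ?_⟩
          · simpa [q_head] using hpos
          · simp [q_head]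
          · simp [q_head, q_item]
          · simp [q_head, q_next, HoldsList]
        · have : (M.pend t u v c M.size (M.size + 1)).nb t b = M.nb t b := by
            simp [Model.pend, hbb]
          rw [this, q_head, Function.update_of_ne hbb]
          exact frame_t b (hold hb hbb)
      · by_cases hbb : b = M.size
        · have : (M.pend t u v c M.size (M.size + 1)).nb (!t) b = [] := by
            simp [Model.pend, hbb]
          rw [this, q_head', hbb]
          simp [HoldsList]
        · by_cases hbc : b = c
          · have : (M.pend t u v c M.size (M.size + 1)).nb (!t) b = M.size :: M.nb (!t) c := by
              simp [Model.pend, hbc, hcs.ne]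
            rw [this, hbc]
            have e : σ₂.arr (aHead (!t)) c = M.size := by simp [q_head', hcs.ne]
            rw [e]
            refine ⟨hpos, by simp, by simp [q_item'], ?_⟩
            rw [show σ₂.arr (aNext (!t)) M.size = σ.arr (aHead (!t)) c by simp [q_next']]
            exact frame_n c hcs
          · have : (M.pend t u v c M.size (M.size + 1)).nb (!t) b = M.nb (!t) b := by
              simp [Model.pend, hbb, hbc]
            rw [this, q_head', Function.update_of_ne hbb, Function.update_of_ne hbc]
            exact frame_n b (hold hb hbb)
    · rintro σ' T ⟨hT, h'⟩
      exact ⟨by omega, h'⟩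

end

/-! ### Initialization, main loop and final pass -/

section

variable {n B : ℕ} {s : VertexSequence n} {G : SimpleGraph (Fin n)} {X S : Set (Fin n)}
  {M : Model (Fin n)} {σ : State} {t : Bool} {u v : Fin n}

theorem wp_initOne (hB : n + 1 ≤ B) (hσ : HoldsInput s σ) {i₀ : Fin n} (h0 : i₀.val = 0)
    (hX : s.vert i₀ ∈ X) :
    initOne.wp B (fun σ' T => T ≤ 10 ∧ σ'.reg 5 = s.vert i₀ ∧
      Holds s X {s.vert i₀} (Model.single (s.vert i₀)) σ') σ := by
  have hvert : σ.arr inVert 0 = s.vert i₀ := h0 ▸ hσ.vert i₀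
  have hside : ∀ t, s.vert i₀ ∈ shore X t → t = true := by
    intro t ht
    cases t
    · exact absurd hX ht
    · rfl
  have hwp : initOne.wp B (fun σ' T => T ≤ 10 ∧ σ'.reg 5 = s.vert i₀ ∧ σ'.reg 0 = σ.reg 0 ∧
      σ'.reg 3 = 1 ∧ σ'.reg 4 = 0 ∧ σ'.reg 2 = 0 ∧
      σ'.arr aSide (s.vert i₀) = 0 ∧ σ'.arr aParent (s.vert i₀) = 0 ∧
      σ'.arr aIntroducer (s.vert i₀) = 0 ∧ σ'.arr aCellOf (s.vert i₀) = s.vert i₀ ∧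
      σ'.arr aCellVal (s.vert i₀) = s.vert i₀ ∧ σ'.arr inVert = σ.arr inVert ∧
      σ'.arr inKind = σ.arr inKind ∧ σ'.arr inRef = σ.arr inRef) σ := by
    simp [initOne, Prog.block, Prog.wp, hvert]
    omega
  refine Prog.wp_mono _ hwp ?_
  rintro σ' T ⟨hT, h5, h0, h3, h4, h2, e1, e2, e3, e4, e5, f1, f2, f3⟩
  refine ⟨hT, h5, hσ.congr h0 fun a ha => ?_, h3, h4, h2, ?_, ?_, ?_, ?_, ?_, ?_, ?_, ?_⟩
  · have : a = 0 ∨ a = 1 ∨ a = 2 := by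
      simp only [aSide] at ha
      omega
    rcases this with rfl | rfl | rfl
    · exact f1
    · exact f2
    · exact f3
  · rintro t w ⟨hw, rfl⟩
    rw [hside t hw, e1]
    rfl
  · rintro w rfl
    exact e2
  · rintro w rfl
    exact e3
  · rintro w rfl
    exact e4
  · rintro w rfl
    exact e5
  all_goals exact fun t b hb => absurd hb (Nat.not_lt_zero b)

theorem wp_initTwo (hB : n + 1 ≤ B) {i₀ i₁ : Fin n} (h1 : i₁.val = 1)
    (hX : s.vert i₀ ∈ X) (hX' : s.vert i₁ ∉ X)
    (hσ : Holds s X {s.vert i₀} (Model.single (s.vert i₀)) σ) (h5 : σ.reg 5 = s.vert i₀) :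
    initTwo.wp B (fun σ' T => T ≤ 20 ∧ σ'.reg 1 = 2 ∧
      Holds s X {s.vert i₀, s.vert i₁} (Model.edge (s.vert i₀) (s.vert i₁)) σ') σ := by
  have hw := (s.vert i₁).2
  have hne : s.vert i₀ ≠ s.vert i₁ := fun e => hX' (e ▸ hX)
  have hne' : (s.vert i₀).val ≠ (s.vert i₁).val := fun e => hne (Fin.ext e)
  have hvert : σ.arr inVert 1 = s.vert i₁ := h1 ▸ hσ.input.vert i₁
  have h3 := hσ.one
  have h4 := hσ.zero
  have d1 : σ.arr aSide (s.vert i₀) = 0 := hσ.side true _ ⟨hX, rfl⟩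
  have d2 : σ.arr aParent (s.vert i₀) = 0 := hσ.parent _ rfl
  have d3 : σ.arr aCellOf (s.vert i₀) = s.vert i₀ := hσ.cellOf _ rfl
  have d4 : σ.arr aCellVal (s.vert i₀) = s.vert i₀ := hσ.cellVal _ rfl
  have hwp : initTwo.wp B (fun σ' T => T ≤ 20 ∧ σ'.reg 1 = 2 ∧ σ'.reg 0 = σ.reg 0 ∧
      σ'.reg 3 = 1 ∧ σ'.reg 4 = 0 ∧ σ'.reg 2 = 1 ∧
      (σ'.arr aSide (s.vert i₀) = 0 ∧ σ'.arr aSide (s.vert i₁) = 1) ∧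
      (σ'.arr aParent (s.vert i₀) = 0 ∧ σ'.arr aParent (s.vert i₁) = 0) ∧
      (σ'.arr aIntroducer (s.vert i₀) = 1 ∧ σ'.arr aIntroducer (s.vert i₁) = 1) ∧
      (σ'.arr aCellOf (s.vert i₀) = s.vert i₀ ∧ σ'.arr aCellOf (s.vert i₁) = s.vert i₁) ∧
      (σ'.arr aCellVal (s.vert i₀) = s.vert i₀ ∧ σ'.arr aCellVal (s.vert i₁) = s.vert i₁) ∧
      (σ'.arr aFirstX 0 = s.vert i₀ ∧ σ'.arr aFirstY 0 = s.vert i₁) ∧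
      (σ'.arr aLastX 0 = s.vert i₀ ∧ σ'.arr aLastY 0 = s.vert i₁) ∧
      (σ'.arr aUpperHead 0 = 0 ∧ σ'.arr aLowerHead 0 = 0) ∧ σ'.arr inVert = σ.arr inVert ∧
      σ'.arr inKind = σ.arr inKind ∧ σ'.arr inRef = σ.arr inRef) σ := by
    simp [initTwo, Prog.block, Prog.wp, hvert, h3, h4, h5, hne', d1, d2, d3, d4]
    omega
  refine Prog.wp_mono _ hwp ?_
  rintro σ' T ⟨hT, k1, k0, k3, k4, k2, e1, e2, e3, e4, e5, e6, e7, e8, f1, f2, f3⟩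
  have hb0 : ∀ {b}, b < (Model.edge (s.vert i₀) (s.vert i₁)).size → b = 0 := fun h =>
    Nat.lt_one_iff.1 h
  refine ⟨hT, k1, hσ.input.congr k0 fun a ha => ?_, k3, k4, k2, ?_, ?_, ?_, ?_, ?_, ?_, ?_, ?_⟩
  · have : a = 0 ∨ a = 1 ∨ a = 2 := by
      simp only [aSide] at ha
      omega
    rcases this with rfl | rfl | rfl
    · exact f1
    · exact f2
    · exact f3
  · refine (forall_side true).2 ⟨?_, ?_⟩
    · rintro w ⟨hw, rfl | rfl⟩
      · exact e1.1
      · exact absurd hw hX'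
    · rintro w ⟨hw, rfl | rfl⟩
      · exact absurd hX hw
      · exact e1.2
  · rintro w (rfl | rfl)
    · exact e2.1
    · exact e2.2
  · rintro w (rfl | rfl)
    · exact e3.1
    · exact e3.2
  · rintro w (rfl | rfl)
    · exact e4.1
    · exact e4.2
  · rintro w (rfl | rfl)
    · exact e5.1
    · exact e5.2
  · intro t b hb
    rw [hb0 hb]
    cases t
    · exact e6.2
    · exact e6.1
  · intro t b hb
    rw [hb0 hb]
    cases t
    · exact e7.2
    · exact e7.1
  · intro t b hb
    rw [hb0 hb]
    cases t
    · exact e8.2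
    · exact e8.1

/-- The invariant of the main loop after `i` vertices. -/
structure BuildInv (G : SimpleGraph (Fin n)) (s : VertexSequence n) (X : Set (Fin n)) (i : ℕ)
    (M : Model (Fin n)) (σ : State) : Prop where
  valid : M.Valid G X (s.initial i)
  holds : Holds s X (s.initial i) M σ
  size_lt : M.size < i
  counter : σ.reg 1 = i

/-- A vertex adds at most one biclique, so the number of bicliques stays below the number of
vertices treated, and with it every address in use stays within bounds. -/
theorem BuildInv.step (hX : G.IsBipartiteWith X Xᶜ) (hG : G.Connected)
    (hs : IsReversePruning G s) (hB : n + 1 ≤ B) {i : Fin n} (hi : 2 ≤ i.val)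
    (h : BuildInv G s X i M σ) :
    buildBody.wp B (fun σ' T => T ≤ 72 ∧ ∃ M', BuildInv G s X (i + 1) M' σ') σ := by
  have hin := i.2
  have hpos : 0 < i.val := by omega
  have hv := hs.vert_notMem i
  have hu := hs.ref_mem hpos
  have hsz := h.size_lt
  obtain ⟨w, hwS, hadj⟩ := hs.exists_adj hG hi hin.le _ hu
  obtain ⟨t, ht⟩ : ∃ t, s.ref i ∈ shore X t := by
    by_cases hx : s.ref i ∈ X
    · exact ⟨true, hx⟩
    · exact ⟨false, hx⟩
  have d1 := h.holds.input.vert i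
  have d2 := h.holds.input.kind i hpos
  have d3 := h.holds.input.ref i hpos
  have d4 := h.holds.side t _ ⟨ht, hu⟩
  have hcode : (s.kind i).code ≤ 1 := by cases s.kind i <;> simp [Kind.code]
  have hside : sideCode t ≤ 1 := by cases t <;> simp [sideCode]
  -- The state after the four loads.
  set τ := (((σ.setReg 5 (s.vert i)).setReg 6 (s.kind i).code).setReg 7 (s.ref i)).setReg 8
    (sideCode t) with hτ
  have hτh : Holds s X (s.initial i) M τ :=
    ⟨h.holds.input.congr (by simp [hτ]) fun _ _ => rfl, by simpa [hτ] using h.holds.one,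
      by simpa [hτ] using h.holds.zero, by simpa [hτ] using h.holds.size, h.holds.side,
      h.holds.parent, h.holds.intro, h.holds.cellOf, h.holds.cellVal, h.holds.first,
      h.holds.last, h.holds.list⟩
  have t5 : τ.reg 5 = s.vert i := by simp [hτ]
  have t6 : τ.reg 6 = (s.kind i).code := by simp [hτ]
  have t7 : τ.reg 7 = s.ref i := by simp [hτ]
  have t8 : τ.reg 8 = sideCode t := by simp [hτ]
  have t1 : τ.reg 1 = i := by simpa [hτ] using h.counter
  have t4 : τ.reg 4 = 0 := hτh.zero
  have finish : ∀ (σ' : State) (M' : Model (Fin n)) (T : ℕ), T ≤ 65 → σ'.reg 1 = τ.reg 1 →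
      M'.Valid G X (insert (s.vert i) (s.initial i)) →
      Holds s X (insert (s.vert i) (s.initial i)) M' σ' → M'.size ≤ M.size + 1 →
      σ'.reg 1 + σ'.reg 3 ≤ B ∧ T + 7 ≤ 72 ∧
        ∃ M', BuildInv G s X (i + 1) M' (σ'.setReg 1 (σ'.reg 1 + σ'.reg 3)) := by
    intro σ' M' T hT h1 hM' hh hle
    have h3 := hh.one
    refine ⟨by omega, by omega, M', ?_, ?_, by omega, by simp [h1, t1, h3]⟩
    · rw [VertexSequence.initial_succ]
      exact hM'
    · rw [VertexSequence.initial_succ]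
      exact ⟨hh.input.congr (by simp) fun _ _ => rfl, by simpa using hh.one,
        by simpa using hh.zero, by simpa using hh.size, hh.side, hh.parent, hh.intro, hh.cellOf,
        hh.cellVal, hh.first, hh.last, hh.list⟩
  have body : (Prog.ite (.eq 6 4) (.ite (.eq 8 4) (pendProg true) (pendProg false)) twinProg).wp B
      (fun σ' T => T ≤ 65 ∧ σ'.reg 1 = τ.reg 1 ∧ ∃ M' : Model (Fin n),
        M'.Valid G X (insert (s.vert i) (s.initial i)) ∧
        Holds s X (insert (s.vert i) (s.initial i)) M' σ' ∧ M'.size ≤ M.size + 1) τ := by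
    simp only [Prog.wp, Test.Holds, t4, t6, t8]
    cases hk : s.kind i with
    | pending =>
      have hadj' := hs.adj_of_pending hpos hk
      have hvt : s.vert i ∈ shore X (!t) :=
        mem_shore_of_adj hX ((hadj' _ hu).2 rfl).symm ht
      obtain ⟨c, hc⟩ := h.valid.exists_intro hX ⟨ht, hu⟩ hwS hadj
      have main : (pendProg t).wp B (fun σ' T => T ≤ 60 ∧ σ'.reg 1 = τ.reg 1 ∧
          ∃ M' : Model (Fin n), M'.Valid G X (insert (s.vert i) (s.initial i)) ∧
          Holds s X (insert (s.vert i) (s.initial i)) M' σ' ∧ M'.size ≤ M.size + 1) τ := by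
        refine Prog.wp_mono _ (hτh.pend h.valid hB (by omega) ⟨ht, hu⟩ hv hvt t5 t7 hc) ?_
        rintro σ' T ⟨hT, h1, b₀, size', hi, hh⟩
        refine ⟨hT, h1, _, h.valid.pend hX ⟨ht, hu⟩ hv hvt hadj' hc hi, hh, ?_⟩
        change size' ≤ M.size + 1
        rcases hi with ⟨-, -, rfl⟩ | ⟨-, -, rfl⟩ <;> omega
      refine ⟨fun _ => ⟨fun h0 => ?_, fun h0 => ?_⟩, fun h0 => absurd rfl h0⟩
      · obtain rfl : t = true := by
          cases t
          · simp [sideCode] at h0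
          · rfl
        refine Prog.wp_mono _ main ?_
        rintro σ' T ⟨hT, h'⟩
        exact ⟨by omega, h'⟩
      · obtain rfl : t = false := by
          cases t
          · rfl
          · simp [sideCode] at h0
        refine Prog.wp_mono _ main ?_
        rintro σ' T ⟨hT, h'⟩
        exact ⟨by omega, h'⟩
    | twin =>
      have hadj' := hs.adj_of_twin hpos hk
      have hvt : s.vert i ∈ shore X t := by
        have hw := mem_shore_of_adj hX hadj ht
        have := mem_shore_of_adj hX ((hadj' w hwS).2 hadj).symm hw
        rwa [Bool.not_not] at this
      refine ⟨fun h0 => absurd h0 Nat.one_ne_zero, fun _ => ?_⟩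
      refine Prog.wp_mono _ (hτh.twin h.valid hB (by omega) ⟨ht, hu⟩ hv hvt t5 t7 t8) ?_
      rintro σ' T ⟨hT, h1, hh⟩
      exact ⟨by omega, h1, _, h.valid.twin hX ⟨ht, hu⟩ hv hvt hadj', hh, Nat.le_succ _⟩
  simp only [buildBody, Prog.block]
  -- Unfolding stops at the conditional, which `body` treats as a whole.
  rw [Prog.wp, Prog.wp, Prog.wp, Prog.wp, Prog.wp, Prog.wp, Prog.wp, Prog.wp, Prog.wp]
  simp only [State.reg_setReg, State.arr_setReg, h.counter, d1]
  refine ⟨by omega, by omega, by simp; omega, by simp [d2]; omega,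
    by simp; omega, by simp [d3]; omega, by simp; omega,
    by simp [d3, d4]; omega, ?_⟩
  simp only [reduceIte, OfNat.one_ne_ofNat, d2, d3, d4]
  refine Prog.wp_mono _ body ?_
  rintro σ' T ⟨hT, h1, M', hM', hh, hle⟩
  obtain ⟨g1, g2, g3⟩ := finish σ' M' T hT h1 hM' hh hle
  exact ⟨g1, by omega, g3⟩

/-- The memory holds the representation, except that the starts of the paths are stored by means of
cells for the maximal bicliques with numbers `≥ j`. -/
structure FinishInv (X : Set (Fin n)) (M : Model (Fin n)) (j : ℕ) (σ : State) : Prop where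
  one : σ.reg 3 = 1
  counter : σ.reg 5 = j
  sizeReg : σ.reg 2 = M.size
  size : σ.arr aSize 0 = M.size
  side : ∀ t, ∀ v ∈ shore X t, σ.arr aSide v = sideCode t
  parent : ∀ v : Fin n, σ.arr aParent v = optCode (M.parent v)
  intro : ∀ v : Fin n, σ.arr aIntroducer v = natCode (M.intro v)
  cellVal : ∀ v : Fin n, σ.arr aCellVal v = M.cellVal v
  first : ∀ t, ∀ b < M.size, σ.arr (aFirst t) b =
    if b < j then M.cellVal (M.firstCell t b) else M.firstCell t b
  last : ∀ t, ∀ b < M.size, σ.arr (aLast t) b = M.last t b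
  list : ∀ t, ∀ b < M.size, HoldsList (σ.arr (aNext t)) (σ.arr (aItem t)) n
    (σ.arr (aHead t) b) (M.nb t b)

theorem FinishInv.step (hB : n + 1 ≤ B) {j : ℕ} (hj : j < M.size) (hn : M.size ≤ n)
    (h : FinishInv X M j σ) :
    finishBody.wp B (fun σ' T => T ≤ 10 ∧ FinishInv X M (j + 1) σ') σ := by
  have hx : σ.arr aFirstX j = M.firstCell true j := (h.first true j hj).trans (by simp)
  have hy : σ.arr aFirstY j = M.firstCell false j := (h.first false j hj).trans (by simp)
  have cx := h.cellVal (M.firstCell true j)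
  have cy := h.cellVal (M.firstCell false j)
  have hwp : finishBody.wp B (fun σ' T => T ≤ 10 ∧ σ'.reg 3 = 1 ∧ σ'.reg 5 = j + 1 ∧
      σ'.reg 2 = M.size ∧
      σ'.arr aFirstX = Function.update (σ.arr aFirstX) j (M.cellVal (M.firstCell true j)) ∧
      σ'.arr aFirstY = Function.update (σ.arr aFirstY) j (M.cellVal (M.firstCell false j)) ∧
      ∀ a, a ≠ aFirstX → a ≠ aFirstY → σ'.arr a = σ.arr a) σ := by
    simp [finishBody, Prog.block, Prog.wp, h.counter, h.one, h.sizeReg, hx, hy, cx, cy]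
    and_intros
    any_goals omega
    intro a h1 h2
    simp [h1, h2]
  refine Prog.wp_mono _ hwp ?_
  rintro σ' T ⟨hT, k3, k5, k2, e1, e2, e⟩
  have hfirst : ∀ t, σ'.arr (aFirst t) =
      Function.update (σ.arr (aFirst t)) j (M.cellVal (M.firstCell t j)) := fun t => by
    cases t
    · exact e2
    · exact e1
  refine ⟨hT, k3, k5, k2, ?_, ?_, ?_, ?_, ?_, ?_, ?_, ?_⟩
  · rw [e aSize (by decide) (by decide)]; exact h.size
  · rw [e aSide (by decide) (by decide)]; exact h.side
  · rw [e aParent (by decide) (by decide)]; exact h.parent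
  · rw [e aIntroducer (by decide) (by decide)]; exact h.intro
  · rw [e aCellVal (by decide) (by decide)]; exact h.cellVal
  · intro t b hb
    rw [hfirst, Function.update_apply]
    by_cases hbj : b = j
    · subst hbj
      simp
    · rw [if_neg hbj, h.first t b hb]
      have : b < j + 1 ↔ b < j := by omega
      simp only [this]
  · intro t
    have : σ'.arr (aLast t) = σ.arr (aLast t) := by
      cases t <;> exact e _ (by decide) (by decide)
    rw [this]
    exact h.last t
  · intro t
    have : σ'.arr (aHead t) = σ.arr (aHead t) ∧ σ'.arr (aNext t) = σ.arr (aNext t) ∧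
        σ'.arr (aItem t) = σ.arr (aItem t) := by
      cases t <;> exact ⟨e _ (by decide) (by decide), e _ (by decide) (by decide),
        e _ (by decide) (by decide)⟩
    rw [this.1, this.2.1, this.2.2]
    exact h.list t

theorem map_val_pmap_mk {m : ℕ} {l : List ℕ} (h : ∀ c ∈ l, c < m) :
    (l.pmap Fin.mk h).map Fin.val = l := by
  simp [List.map_pmap]

theorem optCode_pmap_mk {m : ℕ} {o : Option ℕ} (h : ∀ b ∈ o, b < m) :
    optCode (o.pmap Fin.mk h) = natCode o := by
  cases o <;> rfl

theorem FinishInv.stores (hX : G.IsBipartiteWith X Xᶜ) (hM : M.Valid G X Set.univ)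
    (hn : M.size ≤ n) (h : FinishInv X M M.size σ) : Stores (hM.toRep hX) σ where
  size_le := hn
  sideX v hv := h.side true v hv
  sideY v hv := h.side false v hv
  parent := h.parent
  size := h.size
  firstX b := (h.first true b b.2).trans (by rw [if_pos (show b.val < M.size from b.2)]; rfl)
  lastX b := h.last true b b.2
  firstY b := (h.first false b b.2).trans (by rw [if_pos (show b.val < M.size from b.2)]; rfl)
  lastY b := h.last false b b.2
  upper b := by
    have := h.list true b b.2
    rw [← map_val_pmap_mk (hM.nb_lt true b)] at this
    exact this
  lower b := by
    have := h.list false b b.2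
    rw [← map_val_pmap_mk (hM.nb_lt false b)] at this
    exact this
  introducer v := by
    rw [h.intro v, ← optCode_pmap_mk (hM.intro_lt v)]
    rfl

/-- The final part of the program. -/
theorem wp_finish (hX : G.IsBipartiteWith X Xᶜ) (hM : M.Valid G X Set.univ) (hB : n + 1 ≤ B)
    (hn : M.size < n) (h : Holds s X Set.univ M σ) :
    (Prog.block [.store aSize 4 2, .const 5 0, .while (.lt 5 2) finishBody]).wp B
      (fun σ' T => T ≤ 11 * n + 10 ∧ Stores (hM.toRep hX) σ') σ := by
  have h4 := h.zero
  have h2 := h.size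
  simp only [Prog.block, Prog.wp]
  refine ⟨by omega, by omega, by omega, ?_⟩
  refine Prog.wp_while (N := M.size) (fun j T τ => T ≤ 11 * j ∧ FinishInv X M j τ) ?_ ?_ ?_ ?_
  · rintro j T τ hj ⟨hT, hI⟩
    refine ⟨?_, Prog.wp_mono _ (hI.step hB hj hn.le) ?_⟩
    · simp only [Test.Holds, hI.counter, hI.sizeReg]
      exact hj
    · rintro τ' T' ⟨hT', hI'⟩
      exact ⟨by omega, hI'⟩
  · rintro T τ ⟨hT, hI⟩
    simp [Test.Holds, hI.counter, hI.sizeReg]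
  · refine ⟨by omega, by simpa using h.one, by simp, by simpa using h.size, by simp [h4, h2],
      fun t v hv => by simpa using h.side t v ⟨hv, trivial⟩,
      fun v => by simpa using h.parent v trivial, fun v => by simpa using h.intro v trivial,
      fun v => by simpa using h.cellVal v trivial, fun t b hb => ?_, fun t b hb => ?_,
      fun t b hb => ?_⟩
    · have : aFirst t ≠ aSize := by cases t <;> decide
      simpa [this] using h.first t b hb
    · have : aLast t ≠ aSize := by cases t <;> decide
      simpa [this] using h.last t b hb
    · have : aHead t ≠ aSize ∧ aNext t ≠ aSize ∧ aItem t ≠ aSize := by cases t <;> decide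
      simp only [State.arr_setReg, State.arr_setArr, this, if_false]
      exact (h.list t b hb).congr (by omega) fun _ _ => ⟨rfl, rfl⟩
  · rintro T τ ⟨hT, hI⟩
    exact ⟨by omega, hI.stores hX hM hn.le⟩

/-- An iteration of the main loop takes at most 72 steps and a test, so everything before the final
pass fits in 73n steps; the final pass takes at most 11n + 10, and the sum is at most 100n as n is
positive. -/
theorem build_correct (hG : IsBDH G) (hX : G.IsBipartiteWith X Xᶜ) (hs : IsReversePruning G s)
    (hs0 : ∀ i : Fin n, i.val = 0 → s.vert i ∈ X) (hB : n + 1 ≤ B) (hσ : HoldsInput s σ) :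
    ∃ (R : ImplicitRep G X) (σ' : State) (T : ℕ),
      Exec B build σ σ' T ∧ T ≤ 100 * n ∧ Stores R σ' := by
  have hn : 0 < n := Fin.pos_iff_nonempty.2 hG.1.nonempty
  let i₀ : Fin n := ⟨0, hn⟩
  have hx := hs0 i₀ rfl
  suffices hwp : build.wp B (fun σ' T => ∃ R : ImplicitRep G X, T ≤ 100 * n ∧ Stores R σ') σ by
    obtain ⟨σ', T, e, R, hT, hR⟩ := build.exists_exec_of_wp hwp
    exact ⟨R, σ', T, e, hT, hR⟩
  have hend : ∀ (M : Model (Fin n)) (τ : State) (T₀ : ℕ), M.Valid G X Set.univ →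
      Holds s X Set.univ M τ → M.size < n → T₀ ≤ 73 * n →
      (Prog.block [.store aSize 4 2, .const 5 0, .while (.lt 5 2) finishBody]).wp B
        (fun σ' T => ∃ R : ImplicitRep G X, T₀ + T ≤ 100 * n ∧ Stores R σ') τ := by
    intro M τ T₀ hM hh hlt hT₀
    refine Prog.wp_mono _ (wp_finish hX hM hB hlt hh) ?_
    rintro σ' T ⟨hT, hR⟩
    exact ⟨_, by omega, hR⟩
  change initOne.wp B (fun σ₁ T₁ => (Prog.ite (.lt 3 0)
    (.block [initTwo, .while (.lt 1 0) buildBody]) .skip).wp B (fun σ₂ T₂ =>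
      (Prog.block [.store aSize 4 2, .const 5 0, .while (.lt 5 2) finishBody]).wp B
        (fun σ₃ T₃ => ∃ R : ImplicitRep G X, T₁ + (T₂ + T₃) ≤ 100 * n ∧ Stores R σ₃) σ₂) σ₁) σ
  refine Prog.wp_mono _ (wp_initOne hB hσ (i₀ := i₀) rfl hx) ?_
  rintro σ₁ T₁ ⟨hT₁, h5, hh⟩
  have hb : Test.Holds (.lt 3 0) σ₁ ↔ 1 < n := by
    simp only [Test.Holds, hh.one, hh.input.size]
  refine ⟨fun h => ?_, fun h => ?_⟩
  · rw [hb] at h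
    let i₁ : Fin n := ⟨1, h⟩
    have hadj := hs.adj_one hG.1 (i₀ := i₀) (i₁ := i₁) rfl rfl
    have hx' : s.vert i₁ ∉ X := hX.mem_of_mem_adj hx hadj
    simp only [Prog.block]
    rw [Prog.wp]
    refine Prog.wp_mono _ (wp_initTwo hB (i₀ := i₀) (i₁ := i₁) rfl hx hx' hh h5) ?_
    rintro σ₂ T₂ ⟨hT₂, h1, hh₂⟩
    refine Prog.wp_while (N := n - 2)
      -- The shift by 2 accounts for the first edge, which `initTwo` has already stored.
      (fun j T τ => T ≤ 73 * j ∧ ∃ M, BuildInv G s X (j + 2) M τ) ?_ ?_ ?_ ?_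
    · rintro j T τ hj ⟨hT, M, hI⟩
      refine ⟨?_, ?_⟩
      · simp only [Test.Holds, hI.counter, hI.holds.input.size]
        omega
      · refine Prog.wp_mono _ (hI.step (i := ⟨j + 2, by omega⟩) hX hG.1 hs hB
          (Nat.le_add_left 2 j)) ?_
        rintro τ' T' ⟨hT', M', hI'⟩
        exact ⟨by omega, M', by simpa [add_right_comm] using hI'⟩
    · rintro T τ ⟨-, M, hI⟩
      simp only [Test.Holds, hI.counter, hI.holds.input.size]
      omega
    · refine ⟨Nat.zero_le _, Model.edge (s.vert i₀) (s.vert i₁), ?_, ?_, ?_, h1⟩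
      · rw [VertexSequence.initial_two (i₀ := i₀) (i₁ := i₁) rfl rfl]
        exact Model.valid_edge hX hx hadj
      · rw [VertexSequence.initial_two (i₀ := i₀) (i₁ := i₁) rfl rfl]
        exact hh₂
      · exact Nat.one_lt_two
    · rintro T τ ⟨hT, M, hI⟩
      have hn2 : n - 2 + 2 = n := by omega
      rw [hn2] at hI
      have hV := hI.valid
      have hH := hI.holds
      rw [hs.initial_eq_univ] at hV hH
      refine Prog.wp_mono _ (hend M τ (T₁ + (1 + (T₂ + (T + 1)))) hV hH hI.size_lt (by omega)) ?_
      rintro σ' T' ⟨R, hT', hR⟩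
      exact ⟨R, by omega, hR⟩
  · rw [hb] at h
    have huniv : ({s.vert i₀} : Set (Fin n)) = Set.univ := by
      have hn1 : s.initial 1 = s.initial n := congrArg s.initial (by omega)
      rw [← VertexSequence.initial_one (s := s) (i₀ := i₀) rfl, hn1, hs.initial_eq_univ]
    rw [huniv] at hh
    have hV := Model.valid_single (G := G) (X := X) (s.vert i₀)
    rw [huniv] at hV
    rw [Prog.wp]
    refine Prog.wp_mono _ (hend _ σ₁ (T₁ + (1 + 1)) hV hh hn (by omega)) ?_
    rintro σ' T' ⟨R, hT', hR⟩
    exact ⟨R, by omega, hR⟩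

end

end BDH

theorem mainTheorem9 :
    ∃ (build listVertices listBicliques : BDH.Prog) (K : ℕ),
      ∀ (n : ℕ) (G : SimpleGraph (Fin n)) (X : Set (Fin n)) (s : BDH.VertexSequence n),
        BDH.IsBDH G → G.IsBipartiteWith X Xᶜ → BDH.IsReversePruning G s →
        (∀ i : Fin n, i.val = 0 → s.vert i ∈ X) →
        -- computing an implicit representation in `O(n)` time and space
        (∀ σ : BDH.State, BDH.HoldsInput s σ →
          ∃ (R : BDH.ImplicitRep G X) (σ' : BDH.State) (t : ℕ),
            BDH.Exec (K * n) build σ σ' t ∧ t ≤ K * n ∧ BDH.Stores R σ') ∧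
        (∀ (R : BDH.ImplicitRep G X) (σ : BDH.State), BDH.Stores R σ →
          -- listing the vertices of the maximal biclique number `b`, shore by shore
          (∀ b : Fin R.size, σ.reg 0 = b →
            ∃ (σ' : BDH.State) (t : ℕ),
              BDH.Exec (K * n) listVertices σ σ' t ∧ BDH.Stores R σ' ∧
              t ≤ K * (R.biclique b).verts.ncard ∧
              BDH.Lists (σ'.read BDH.outA (σ'.reg 0)) (R.biclique b).shoreX ∧
              BDH.Lists (σ'.read BDH.outB (σ'.reg 1)) (R.biclique b).shoreY) ∧
          -- listing the maximal bicliques that contain the vertex `v`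
          (∀ v : Fin n, σ.reg 0 = v →
            ∃ (σ' : BDH.State) (t : ℕ),
              BDH.Exec (K * n) listBicliques σ σ' t ∧ BDH.Stores R σ' ∧
              t ≤ K * ({b : Fin R.size | v ∈ (R.biclique b).verts}.ncard + 1) ∧
              BDH.Lists (σ'.read BDH.outA (σ'.reg 0))
                {b : Fin R.size | v ∈ (R.biclique b).verts})) := by
  refine ⟨BDH.build, BDH.listVertices, BDH.listBicliques, 100, fun n G X s hG hX hs hs0 => ?_⟩
  -- A connected graph has a vertex; this lets a multiple of `n` absorb the additive constants.
  have hn : 0 < n := Fin.pos_iff_nonempty.2 hG.1.nonempty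
  have hB : n + 1 ≤ 100 * n := by omega
  refine ⟨fun σ hσ => BDH.build_correct hG hX hs hs0 hB hσ, fun R σ hR => ⟨fun b hb => ?_,
    fun v hv => ?_⟩⟩
  · obtain ⟨σ', t, h1, h2, h3, h4⟩ := BDH.listVertices_correct R σ hR b hb hB
    exact ⟨σ', t, h1, h2, by omega, h4⟩
  · obtain ⟨σ', t, h1, h2, h3, h4⟩ := BDH.listBicliques_correct hG.2.2 hX R σ hR v hv hB
    exact ⟨σ', t, h1, h2, by omega, h4⟩
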